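/- Let $Q$ be a strongly connected, locally finite, possibly infinite quiver, equipped with two sets $Q_2^+$ and $Q_2^-$ of finite cycles of length at least $3$ such that every arrow lies exactly once in exactly one cycle of $Q_2^+$ and exactly once in exactly one cycle of $Q_2^-$, and such that around every vertex the incidence graph of the arrows and cycles meeting that vertex is connected (an unweighted quiver polyhedron $\mathcal Q$). Let $|\mathcal Q|$ be the surface obtained by taking, for every cycle in $Q_2^+\cup Q_2^-$ of length $k$, a $k$-gon with edges labelled cyclically by the arrows of the cycle, and gluing edges with the same label. Let $\mathcal C_{\mathcal Q}$ be the category of paths in $Q$ modulo the relations that identify, for every arrow $a$, the path from the head to the tail of $a$ that completes $a$ to its cycle in $Q_2^+$ with the one that completes $a$ to its cycle in $Q_2^-$; its category algebra is the Jacobi algebra of $\mathcal Q$. One says that $\mathcal Q$ is cancellation if every morphism of $\mathcal C_{\mathcal Q}$ is monic and epic. For an arrow $a$, the zig ray of $a$ is the sequence of arrows $\mathcal Z_a^+[0]=a,\ \mathcal Z_a^+[1],\ \mathcal Z_a^+[2],\dots$ in which $\mathcal Z_a^+[i+1]$ is the arrow following $\mathcal Z_a^+[i]$ in its cycle of $Q_2^+$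 if $i$ is even, and in its cycle of $Q_2^-$ if $i$ is odd. The zag ray $\mathcal Z_a^-[i]_{i\ge 0}$ is defined in the same way with $Q_2^+$ and $Q_2^-$ interchanged. Theorem. If $|\mathcal Q|$ is contractible, then $\mathcal Q$ is cancellation if and only if for every arrow $a$ the zig ray and the zag ray starting at $a$ only meet in $a$, i.e. $$\mathcal Z_a^+[i]\neq \mathcal Z_a^-[j]\qquad\text{for all } i,j>0 .$$ -/

import Mathlib

open CategoryTheory

/-- An (unweighted) quiver polyhedron, possibly infinite, on a quiver with vertex set `V`;
its arrows are the elements `a` of `Quiver.Total V`, with tail `a.left` and head `a.right`.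

Every arrow lies exactly once in one cycle of `Q₂⁺` and exactly once in one cycle of `Q₂⁻`, so
each of the two sets of cycles is the same thing as the permutation sending an arrow to the one
that follows it in its positive (resp. negative) cycle: the cycles are the orbits of the
permutation, which have to be finite and to consist of consecutive arrows. The sign `true` stands
for `+`, and `false` for `-`. -/
structure QuiverPolyhedron (V : Type*) [Quiver V] where
  /-- `next s a` is the arrow that follows `a` in the cycle of sign `s` through `a`. -/
  next : Bool → Equiv.Perm (Quiver.Total V)
  /-- The arrow following `a` starts where `a` ends. -/
  left_next : ∀ s a, (next s a).left = a.right
  /-- The cycles are finite (the minimal period of a non-periodic point is `0`), and, all weights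
  being `1`, of length greater than `2`. -/
  two_lt_length : ∀ s a, 2 < Function.minimalPeriod (next s) a
  /-- The quiver is strongly connected. -/
  stronglyConnected : Quiver.IsStronglyConnected V
  /-- Manifold condition, first part: the quiver is locally finite. -/
  locallyFinite : ∀ v : V, {a : Quiver.Total V | a.right = v}.Finite
  /-- Manifold condition, second part: the incidence graph of the arrows and cycles around a vertex
  is connected. Crossing the positive corner between an incoming arrow `a` and the outgoing arrow
  `next true a`, and then the negative corner between `next true a` and the incoming arrow that
  precedes it in its negative cycle, is the permutation `(next false)⁻¹ * next true` of the
  arrows; it has to act transitively on the arrows entering a given vertex. -/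
  link_connected : ∀ a b : Quiver.Total V, a.right = b.right →
    ((next false)⁻¹ * next true).SameCycle a b

namespace QuiverPolyhedron

variable {V : Type*} [Quiver V] (Q : QuiverPolyhedron V)

/-- The length of the cycle of sign `s` through `a`. -/
noncomputable def length (s : Bool) (a : Quiver.Total V) : ℕ :=
  Function.minimalPeriod (Q.next s) a

/-- The arrows of a path, in the order in which they are traversed. -/
def arrows {v : V} : {w : V} → Quiver.Path v w → List (Quiver.Total V)
  | _, .nil => []
  | _, .cons p e => arrows p ++ [⟨_, _, e⟩]

/-- The arrows, in the order in which they are traversed, of the derivative `∂ₐc` of the cycle `c`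
of sign `s` through `a`, i.e. of the path from the head of `a` to the tail of `a` that runs through
`c` with `a` deleted. -/
noncomputable def derivative (s : Bool) (a : Quiver.Total V) : List (Quiver.Total V) :=
  (List.range (Q.length s a - 1)).map fun i => ((Q.next s) ^ (i + 1)) a

/-- The relations `∂ₐW = 0` of the superpotential `W = ∑_{c ∈ Q₂⁺} c - ∑_{c ∈ Q₂⁻} c`: for every
arrow `a`, the derivative by `a` of the positive cycle through `a` equals the one of the negative
cycle through `a`. -/
def jacobiRel : HomRel (Paths V) := fun _ _ p q =>
  ∃ a : Quiver.Total V, arrows p = Q.derivative true a ∧ arrows q = Q.derivative false a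

/-- The category whose category algebra is the Jacobi algebra of `Q`: the path category of the
quiver modulo the relations `∂ₐW = 0`. -/
abbrev JacobiCategory := CategoryTheory.Quotient Q.jacobiRel

/-- `Q` is cancellation: every morphism of its category is monic and epic. -/
def IsCancellation : Prop :=
  ∀ ⦃x y : Q.JacobiCategory⦄ (f : x ⟶ y), Mono f ∧ Epi f

/-- `Q.ray s a i` is the `i`-th arrow, `i ≥ 0`, of the zig ray (`s = true`) or zag ray
(`s = false`) from `a`: the path starting with `a` that alternately follows two consecutive arrows
of a positive cycle and two consecutive arrows of a negative cycle, the first two arrows being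
consecutive in the cycle of sign `s` through `a`. -/
def ray : Bool → Quiver.Total V → ℕ → Quiver.Total V
  | _, a, 0 => a
  | s, a, i + 1 => ray (!s) (Q.next s a) i

/-- The gluing of the polygons. The `k`-gon of a cycle of length `k` is cut, from its centre, into
`k` triangles, one for each edge. The point of barycentric coordinates `x` in the triangle of the
sign `s` and the arrow `a` has weight `x 0` at the tail of `a`, weight `x 1` at the head of `a`
and weight `x 2` at the centre of the cycle of sign `s` through `a`. -/
inductive Glue : (Σ _ : Bool × Quiver.Total V, stdSimplex ℝ (Fin 3)) →
    (Σ _ : Bool × Quiver.Total V, stdSimplex ℝ (Fin 3)) → Prop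
  /-- Consecutive triangles of one polygon share the segment from the centre to a corner. -/
  | spoke (s : Bool) (a : Quiver.Total V) (x y : stdSimplex ℝ (Fin 3))
      (hx : x.1 0 = 0) (hy : y.1 1 = 0) (hcorner : x.1 1 = y.1 0) (hcentre : x.1 2 = y.1 2) :
      Glue ⟨(s, a), x⟩ ⟨(s, Q.next s a), y⟩
  /-- The edges labelled `a` of the positive and of the negative polygon are identified. -/
  | edge (a : Quiver.Total V) (x : stdSimplex ℝ (Fin 3)) (hx : x.1 2 = 0) :
      Glue ⟨(true, a), x⟩ ⟨(false, a), x⟩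

/-- The surface `|Q|`: the polygons of the positive and negative cycles, glued along the edges
with the same label, with the quotient topology. -/
abbrev Realization := Quot Q.Glue

end QuiverPolyhedron

/-!
The strategy is to do combinatorics on lists of arrows. `cls` is the class of a path, and the cycles
at a vertex `x` have one common class `loop x`, which is central. Contractibility of `|Q|` enters
in two ways. Local systems on `|Q|` are trivial (`exists_potential_of_contractible`, by lifting a
contraction to a covering), so that functions on arrows or corners with trivial sums around polygons
and vertices have potentials (`exists_vertex_potential`, `exists_arrow_potential`), and differences
of parallel paths bound finite chains of polygons (`exists_boundary`). And there are infinitely many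
polygons (`infinite_total`), so that a finite chain of polygons is determined by its boundary.

Disjoint rays imply cancellation. If the zig ray and the zag ray of an arrow `a` only meet in `a`,
they bound a region of the plane. The indicator functions of these regions give, for every vertex
`v`, a weight on the arrows with sum `1` along every cycle (`RaysDisjoint.exists_wedge`), that is, a
degree on path classes with `loop` of degree `1`. It thus suffices that parallel paths are
equivalent up to a power of a loop (`RaysDisjoint.comparable`). Otherwise, take an incomparable pair
in a region without holes that is as small as possible. It bounds this region, and a strand that
enters the region through the first arrow of one of the paths has to leave it again. The paths along
the two sides of this strand, the ribbons, have degree `0` with respect to their starting points,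
and they cut the region into smaller ones, where paths are comparable. This makes the given pair
comparable.

Cancellation implies disjoint rays. Since the holonomy of the group of closed paths up to powers of
loops is trivial, parallel paths are equivalent after multiplication by loops
(`weakEq_of_isPath`). By cancellation, for a fixed vertex `v` every vertex has a minimal path to
`v`, and the exponent by which an arrow fails to be minimal is a perfect matching: it is `1` for
exactly one arrow of each polygon (`MinimalPaths`). Equivalences between minimal paths link all
arrows of weight `0` that leave a vertex `w`. So exactly one positive corner at `w ≠ v` has no arrow
of weight `1`, and none at `w = v` (`MinimalPaths.sum_ins`). The difference of the weights for the
two ends of an arrow `a` then has a potential, up to a correction at `a`. Comparing its values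
along the zig ray and the zag ray of `a` shows that these cannot meet
(`IsCancellation.exists_strand_potential`, `IsCancellation.raysDisjoint`).
-/

namespace QuiverPolyhedron

variable {V : Type*} [Quiver V] (Q : QuiverPolyhedron V)

/-! ### Coverings of the surface -/

section Covering

variable {G : Type*} [Group G] (m : Bool → Quiver.Total V → G)

/-- The gluing of `G` copies of every triangle of `|Q|` in which passing from the triangle of an
arrow `a` to the next triangle of the same polygon multiplies the index of the copy by `m s a`. -/
inductive CoverGlue : (Σ _ : Bool × Quiver.Total V × G, stdSimplex ℝ (Fin 3)) →
    (Σ _ : Bool × Quiver.Total V × G, stdSimplex ℝ (Fin 3)) → Prop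
  | spoke (s : Bool) (a : Quiver.Total V) (u : G) (x y : stdSimplex ℝ (Fin 3))
      (hx : x.1 0 = 0) (hy : y.1 1 = 0) (hcorner : x.1 1 = y.1 0) (hcentre : x.1 2 = y.1 2) :
      CoverGlue ⟨(s, a, u), x⟩ ⟨(s, Q.next s a, u * m s a), y⟩
  | edge (a : Quiver.Total V) (u : G) (x : stdSimplex ℝ (Fin 3)) (hx : x.1 2 = 0) :
      CoverGlue ⟨(true, a, u), x⟩ ⟨(false, a, u), x⟩

/-- The covering of `|Q|` with group `G` defined by the transition functions `m`. -/
abbrev Cover := Quot (Q.CoverGlue m)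

/-- The projection of the covering. -/
def coverProj : Q.Cover m → Q.Realization :=
  Quot.map (fun z => ⟨(z.1.1, z.1.2.1), z.2⟩) (by
    rintro _ _ (⟨s, a, u, x, y, hx, hy, h1, h2⟩ | ⟨a, u, x, hx⟩)
    · exact .spoke s a x y hx hy h1 h2
    · exact .edge a x hx)

/-- The group acts on the indices of the copies. -/
instance coverAction : MulAction G (Q.Cover m) where
  smul g := Quot.map (fun z => ⟨(z.1.1, z.1.2.1, g * z.1.2.2), z.2⟩) (by
    rintro _ _ (⟨s, a, u, x, y, hx, hy, h1, h2⟩ | ⟨a, u, x, hx⟩)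
    · have := CoverGlue.spoke (Q := Q) (m := m) s a (g * u) x y hx hy h1 h2
      simpa [mul_assoc] using this
    · exact .edge a _ x hx)
  one_smul := by
    rintro ⟨⟨⟨s, a, u⟩, x⟩⟩
    change Quot.mk _ _ = Quot.mk _ _
    simp
  mul_smul := by
    rintro g g' ⟨⟨⟨s, a, u⟩, x⟩⟩
    change Quot.mk _ _ = Quot.mk _ _
    simp [mul_assoc]

theorem smul_mk (g : G) (s : Bool) (a : Quiver.Total V) (u : G) (x : stdSimplex ℝ (Fin 3)) :
    g • (Quot.mk _ ⟨(s, a, u), x⟩ : Q.Cover m) = Quot.mk _ ⟨(s, a, g * u), x⟩ := rfl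

theorem continuous_coverProj : Continuous (Q.coverProj m) := by
  refine continuous_quot_lift _ (continuous_quot_mk.comp (continuous_sigma fun i => ?_))
  exact continuous_sigmaMk (σ := fun _ : Bool × Quiver.Total V => stdSimplex ℝ (Fin 3))
    (i := (i.1, i.2.1))

/-- The triangle of `|Q|` with sign `s` and arrow `a`. -/
def tri (s : Bool) (a : Quiver.Total V) : C(stdSimplex ℝ (Fin 3), Q.Realization) :=
  ⟨fun x => Quot.mk _ ⟨(s, a), x⟩, continuous_quot_mk.comp
    (continuous_sigmaMk (σ := fun _ : Bool × Quiver.Total V => stdSimplex ℝ (Fin 3)))⟩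

/-- The triangle of index `u` of the covering above the triangle of sign `s` and arrow `a`. -/
def coverTri (s : Bool) (a : Quiver.Total V) (u : G) :
    C(stdSimplex ℝ (Fin 3), Q.Cover m) :=
  ⟨fun x => Quot.mk _ ⟨(s, a, u), x⟩, continuous_quot_mk.comp
    (continuous_sigmaMk (σ := fun _ : Bool × Quiver.Total V × G => stdSimplex ℝ (Fin 3)))⟩

theorem isQuotientMap_coverProj : Topology.IsQuotientMap (Q.coverProj m) := by
  let S := Σ _ : Bool × Quiver.Total V, stdSimplex ℝ (Fin 3)
  let T := Σ _ : Bool × Quiver.Total V × G, stdSimplex ℝ (Fin 3)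
  let sec : S → T := fun z => ⟨(z.1.1, z.1.2, 1), z.2⟩
  have hsec : Continuous sec := continuous_sigma fun i =>
    continuous_sigmaMk (σ := fun _ : Bool × Quiver.Total V × G => stdSimplex ℝ (Fin 3))
      (i := (i.1, i.2, 1))
  refine .of_comp (f := fun z : S => (Quot.mk _ (sec z) : Q.Cover m))
    (continuous_quot_mk.comp hsec) (Q.continuous_coverProj m) ?_
  exact isQuotientMap_quot_mk

/-- Gluings of triangles of `|Q|` lift to the covering. -/
theorem exists_lift_of_mk_eq {z z' : Σ _ : Bool × Quiver.Total V, stdSimplex ℝ (Fin 3)}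
    (h : (Quot.mk _ z : Q.Realization) = Quot.mk _ z') (u : G) :
    ∃ u' : G, (Quot.mk _ ⟨(z.1.1, z.1.2, u), z.2⟩ : Q.Cover m) =
      Quot.mk _ ⟨(z'.1.1, z'.1.2, u'), z'.2⟩ := by
  have h' := Quot.eqvGen_exact h
  suffices H : (∀ u : G, ∃ u' : G, (Quot.mk _ ⟨(z.1.1, z.1.2, u), z.2⟩ : Q.Cover m) =
      Quot.mk _ ⟨(z'.1.1, z'.1.2, u'), z'.2⟩) ∧
      (∀ u : G, ∃ u' : G, (Quot.mk _ ⟨(z'.1.1, z'.1.2, u), z'.2⟩ : Q.Cover m) =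
      Quot.mk _ ⟨(z.1.1, z.1.2, u'), z.2⟩) from H.1 u
  clear h u
  induction h' with
  | rel z z' h =>
    obtain ⟨s, a, x, y, hx, hy, h1, h2⟩ | ⟨a, x, hx⟩ := h
    · refine ⟨fun u => ⟨u * m s a, Quot.sound (.spoke s a u x y hx hy h1 h2)⟩, fun u =>
        ⟨u * (m s a)⁻¹, ?_⟩⟩
      have := Quot.sound (CoverGlue.spoke (Q := Q) (m := m) s a (u * (m s a)⁻¹) x y hx hy h1 h2)
      simpa using this.symm
    · exact ⟨fun u => ⟨u, Quot.sound (.edge a u x hx)⟩,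
        fun u => ⟨u, (Quot.sound (.edge a u x hx)).symm⟩⟩
  | refl z => exact ⟨fun u => ⟨u, rfl⟩, fun u => ⟨u, rfl⟩⟩
  | symm _ _ _ ih => exact ⟨ih.2, ih.1⟩
  | trans _ _ _ _ _ ih1 ih2 =>
    refine ⟨fun u => ?_, fun u => ?_⟩
    · obtain ⟨u1, h1⟩ := ih1.1 u
      obtain ⟨u2, h2⟩ := ih2.1 u1
      exact ⟨u2, h1.trans h2⟩
    · obtain ⟨u1, h1⟩ := ih2.2 u
      obtain ⟨u2, h2⟩ := ih1.2 u1
      exact ⟨u2, h1.trans h2⟩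

/-- A `G`-equivariant coordinate, defined on an open set of the covering, separates the translates
of small neighbourhoods. -/
theorem exists_disjoint_of_coordinate
    (R : Bool → Quiver.Total V → G → stdSimplex ℝ (Fin 3) → G → Prop)
    (hfun : ∀ s a u x c c', R s a u x c → R s a u x c' → c = c')
    (hequiv : ∀ s a u x c g, R s a u x c → R s a (g * u) x (g * c))
    (hopen : ∀ s a u c, IsOpen {x | R s a u x c})
    (hspoke : ∀ s a u (x y : stdSimplex ℝ (Fin 3)) c, x.1 0 = 0 → y.1 1 = 0 → x.1 1 = y.1 0 →
      x.1 2 = y.1 2 → (R s a u x c ↔ R s (Q.next s a) (u * m s a) y c))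
    (hedge : ∀ a u (x : stdSimplex ℝ (Fin 3)) c, x.1 2 = 0 → (R true a u x c ↔ R false a u x c))
    {s : Bool} {a : Quiver.Total V} {u : G} {x : stdSimplex ℝ (Fin 3)} {c : G}
    (h : R s a u x c) :
    ∃ U ∈ nhds (Quot.mk _ ⟨(s, a, u), x⟩ : Q.Cover m),
      ∀ g : G, ((g • ·) '' U ∩ U).Nonempty → g = 1 := by
  let P : G → Q.Cover m → Prop := fun c => Quot.lift (fun z => R z.1.1 z.1.2.1 z.1.2.2 z.2 c) (by
    rintro _ _ (⟨s, a, u, x, y, hx, hy, h1, h2⟩ | ⟨a, u, x, hx⟩)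
    · exact propext (hspoke s a u x y c hx hy h1 h2)
    · exact propext (hedge a u x c hx))
  refine ⟨{e | P c e}, IsOpen.mem_nhds ?_ h, ?_⟩
  · refine isQuotientMap_quot_mk.isOpen_preimage.1 (isOpen_sigma_iff.2 fun i => ?_)
    exact hopen i.1 i.2.1 i.2.2 c
  · rintro g ⟨_, ⟨e, he, rfl⟩, hge⟩
    obtain ⟨⟨⟨s', a', u'⟩, x'⟩, rfl⟩ := Quot.exists_rep e
    have h1 : R s' a' (g * u') x' c := hge
    have h2 : R s' a' (g * u') x' (g * c) := hequiv _ _ _ _ _ g he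
    have := hfun _ _ _ _ _ _ h1 h2
    simpa using this.symm

/-- The projection is a covering if the products of the transition functions around the vertices
(`hκ`) and around the centres of the polygons (`hk`) are trivial. Around each point, the index of a
copy, corrected by `k` near a centre and by `κh` and `κt` near a vertex, is a coordinate on the
fibres. -/
theorem isQuotientCoveringMap_coverProj (κh κt : Quiver.Total V → G)
    (hκ : ∀ s a, m s a = κh a * (κt (Q.next s a))⁻¹) (k : Bool → Quiver.Total V → G)
    (hk : ∀ s a, m s a = k s a * (k s (Q.next s a))⁻¹) :
    IsQuotientCoveringMap (Q.coverProj m) G where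
  toIsQuotientMap := Q.isQuotientMap_coverProj m
  continuous_const_smul g := by
    refine continuous_quot_lift _ (continuous_quot_mk.comp (continuous_sigma fun i => ?_))
    exact continuous_sigmaMk (σ := fun _ : Bool × Quiver.Total V × G => stdSimplex ℝ (Fin 3))
      (i := (i.1, i.2.1, g * i.2.2))
  apply_eq_iff_mem_orbit {e₁ e₂} := by
    constructor
    · obtain ⟨⟨⟨s, a, u⟩, x⟩, rfl⟩ := Quot.exists_rep e₁
      obtain ⟨⟨⟨s', a', u'⟩, x'⟩, rfl⟩ := Quot.exists_rep e₂
      intro h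
      obtain ⟨u1, h1⟩ := Q.exists_lift_of_mk_eq m (z := ⟨(s, a), x⟩) (z' := ⟨(s', a'), x'⟩) h u
      refine ⟨u1 * u'⁻¹, ?_⟩
      rw [h1]
      change Quot.mk _ _ = Quot.mk _ _
      simp
    · rintro ⟨g, rfl⟩
      obtain ⟨⟨⟨s', a', u'⟩, x'⟩, rfl⟩ := Quot.exists_rep e₂
      rfl
  disjoint e := by
    obtain ⟨⟨⟨s, a, u⟩, x⟩, rfl⟩ := Quot.exists_rep e
    have hc : ∀ i : Fin 3, Continuous fun x : stdSimplex ℝ (Fin 3) => x.1 i := fun i =>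
      (continuous_apply i).comp continuous_subtype_val
    have hsum : ∀ x : stdSimplex ℝ (Fin 3), x.1 0 + x.1 1 + x.1 2 = 1 := fun x => by
      have := x.2.2
      rwa [Fin.sum_univ_three] at this
    have hnn : ∀ (x : stdSimplex ℝ (Fin 3)) i, 0 ≤ x.1 i := fun x => x.2.1
    have key : ∀ (p : Prop) (f g : stdSimplex ℝ (Fin 3) → ℝ), Continuous f → Continuous g →
        IsOpen {x | f x < g x ∧ p} := fun p f g hf hg => by
      by_cases hp : p <;> simp [hp, isOpen_lt hf hg]
    by_cases h2 : 0 < x.1 2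
    · -- in the interior of a polygon
      refine Q.exists_disjoint_of_coordinate m (fun s a u x c => 0 < x.1 2 ∧ u * k s a = c)
        ?_ ?_ ?_ ?_ ?_ (c := u * k s a) ⟨h2, rfl⟩
      · rintro s a u x c c' ⟨_, h⟩ ⟨_, h'⟩
        exact h.symm.trans h'
      · rintro s a u x c g ⟨h, h'⟩
        exact ⟨h, by rw [mul_assoc, h']⟩
      · exact fun s a u c => key _ _ _ continuous_const (hc 2)
      · intro s a u x y c _ _ _ h
        rw [h, hk]
        simp [mul_assoc]
      · intro a u x c h
        simp [h]
    · have h2' : x.1 2 = 0 := le_antisymm (not_lt.1 h2) (hnn x 2)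
      by_cases h01 : 0 < x.1 0 * x.1 1
      · -- in the interior of an edge
        refine Q.exists_disjoint_of_coordinate m (fun s a u x c => 0 < x.1 0 * x.1 1 ∧ u = c)
          ?_ ?_ ?_ ?_ ?_ (c := u) ⟨h01, rfl⟩
        · rintro s a u x c c' ⟨_, h⟩ ⟨_, h'⟩
          exact h.symm.trans h'
        · rintro s a u x c g ⟨h, h'⟩
          exact ⟨h, by rw [h']⟩
        · exact fun s a u c => key _ _ _ continuous_const ((hc 0).mul (hc 1))
        · intro s a u x y c h h' _ _
          simp [h, h']
        · intro a u x c h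
          simp
      · -- near a vertex
        have hv : ∃ c, (1 / 2 < x.1 1 ∧ u * κh a = c) ∨ (1 / 2 < x.1 0 ∧ u * κt a = c) := by
          have h0 : x.1 0 * x.1 1 = 0 :=
            le_antisymm (not_lt.1 h01) (mul_nonneg (hnn x 0) (hnn x 1))
          have := hsum x
          rcases mul_eq_zero.1 h0 with h | h
          · exact ⟨_, .inl ⟨by linarith, rfl⟩⟩
          · exact ⟨_, .inr ⟨by linarith, rfl⟩⟩
        obtain ⟨c, hv⟩ := hv
        refine Q.exists_disjoint_of_coordinate m (fun s a u x c =>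
          (1 / 2 < x.1 1 ∧ u * κh a = c) ∨ (1 / 2 < x.1 0 ∧ u * κt a = c)) ?_ ?_ ?_ ?_ ?_ hv
        · intro s a u x c c' h h'
          have h1 := hsum x
          have h2 := hnn x 2
          rcases h with h | h <;> rcases h' with h' | h'
          · exact h.2.symm.trans h'.2
          · linarith [h.1, h'.1]
          · linarith [h.1, h'.1]
          · exact h.2.symm.trans h'.2
        · rintro s a u x c g (⟨h, h'⟩ | ⟨h, h'⟩)
          · exact .inl ⟨h, by rw [mul_assoc, h']⟩
          · exact .inr ⟨h, by rw [mul_assoc, h']⟩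
        · exact fun s a u c => (key _ _ _ continuous_const (hc 1)).union
            (key _ _ _ continuous_const (hc 0))
        · intro s a u x y c hx hy h _
          rw [hx, hy, h, hκ]
          norm_num [mul_assoc]
        · intro a u x c h
          rfl

end Covering

/-- Local systems on a contractible `|Q|` are trivial. A local system is given by the transition
functions `m` between consecutive triangles of one polygon; it is trivial around the centres of
the polygons by `hk`, and around the vertices by `hκ`. -/
theorem exists_potential_of_contractible [ContractibleSpace Q.Realization] {G : Type*} [Group G]
    (m : Bool → Quiver.Total V → G) (κh κt : Quiver.Total V → G)
    (hκ : ∀ s a, m s a = κh a * (κt (Q.next s a))⁻¹) (k : Bool → Quiver.Total V → G)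
    (hk : ∀ s a, m s a = k s a * (k s (Q.next s a))⁻¹) :
    ∃ u : Quiver.Total V → G, ∀ s a, u (Q.next s a) = u a * m s a := by
  have hq := Q.isQuotientCoveringMap_coverProj m κh κt hκ k hk
  have cov := hq.isCoveringMap
  -- the contraction lifts to the covering, and ends in a section of the projection
  obtain ⟨σ, hσ⟩ : ∃ σ : C(Q.Realization, Q.Cover m), ∀ x, Q.coverProj m (σ x) = x := by
    obtain ⟨x₀, ⟨H⟩⟩ := (contractible_iff_id_nullhomotopic Q.Realization).1 ‹_›
    obtain ⟨e₀, he₀⟩ := hq.surjective x₀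
    let H' := H.symm
    refine ⟨(cov.liftHomotopy H'.toContinuousMap (.const _ e₀) fun a => ?_).comp
      ⟨fun x => (1, x), by fun_prop⟩, fun x => ?_⟩
    · simp [H', he₀]
    · have := congrFun (cov.liftHomotopy_lifts H'.toContinuousMap (.const _ e₀) fun a => by
        simp [H', he₀]) (1, x)
      simpa [H'] using this
  have : PreconnectedSpace (stdSimplex ℝ (Fin 3)) :=
    isPreconnected_iff_preconnectedSpace.1 (convex_stdSimplex ℝ (Fin 3)).isPreconnected
  -- on each triangle the section is one of the triangles of the covering
  have hlift : ∀ s a, ∃ u : G, ∀ x, σ (Q.tri s a x) = Q.coverTri m s a u x := by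
    intro s a
    let x₀ : stdSimplex ℝ (Fin 3) := stdSimplex.vertex 0
    have h1 : Q.coverProj m (σ (Q.tri s a x₀)) = Q.coverProj m (Q.coverTri m s a 1 x₀) := hσ _
    obtain ⟨g, hg⟩ := hq.apply_eq_iff_mem_orbit.1 h1
    refine ⟨g, fun x => congrFun (cov.eq_of_comp_eq (g₁ := fun x => σ (Q.tri s a x))
      (g₂ := fun x => Q.coverTri m s a g x) (by fun_prop) (by fun_prop) ?_ x₀ ?_) x⟩
    · ext x
      exact hσ _
    · dsimp only at hg ⊢
      rw [← hg]
      exact (Q.smul_mk m g s a 1 x₀).trans (by simp [coverTri])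
  choose U hU using hlift
  have hinj : ∀ s a u u' x, Q.coverTri m s a u x = Q.coverTri m s a u' x → u = u' := by
    intro s a u u' x h
    have := hq.isCancelSMul
    have h' : (u' * u⁻¹) • Q.coverTri m s a u x = (1 : G) • Q.coverTri m s a u x := by
      rw [one_smul]
      change (u' * u⁻¹) • (Quot.mk _ _ : Q.Cover m) = _
      rw [smul_mk]
      rw [inv_mul_cancel_right]
      exact h.symm
    exact (mul_inv_eq_one.1 (IsCancelSMul.right_cancel _ _ _ h')).symm
  have hedge : ∀ a, U true a = U false a := by
    intro a
    let x₀ : stdSimplex ℝ (Fin 3) := stdSimplex.vertex 0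
    have hx : x₀.1 2 = 0 := by simp [x₀]
    have e1 : Q.tri true a x₀ = Q.tri false a x₀ := Quot.sound (.edge a x₀ hx)
    have e2 : Q.coverTri m true a (U true a) x₀ = Q.coverTri m false a (U true a) x₀ :=
      Quot.sound (.edge a _ x₀ hx)
    exact hinj _ _ _ _ x₀ (by rw [← e2, ← hU, e1, hU])
  have hspoke : ∀ s a, U s (Q.next s a) = U s a * m s a := by
    intro s a
    let x₀ : stdSimplex ℝ (Fin 3) := stdSimplex.vertex 2
    have e1 : Q.tri s a x₀ = Q.tri s (Q.next s a) x₀ :=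
      Quot.sound (.spoke s a x₀ x₀ (by simp [x₀]) (by simp [x₀]) (by simp [x₀]) rfl)
    have e2 : Q.coverTri m s a (U s a) x₀ = Q.coverTri m s (Q.next s a) (U s a * m s a) x₀ :=
      Quot.sound (.spoke s a _ x₀ x₀ (by simp [x₀]) (by simp [x₀]) (by simp [x₀]) rfl)
    exact hinj _ _ _ _ x₀ (by rw [← e2, ← hU, ← e1, hU])
  refine ⟨U true, fun s a => ?_⟩
  cases s
  · rw [hedge, hspoke, hedge]
  · exact hspoke true a

/-! ### Paths as lists of arrows -/

/-- `IsPath x l y`: the list `l` of arrows is a path from `x` to `y`. -/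
def IsPath : V → List (Quiver.Total V) → V → Prop
  | x, [], y => x = y
  | x, e :: l, y => e.left = x ∧ IsPath e.right l y

@[simp] theorem isPath_nil {x y : V} : IsPath x [] y ↔ x = y := Iff.rfl

@[simp] theorem isPath_cons {x y : V} {e : Quiver.Total V} {l : List (Quiver.Total V)} :
    IsPath x (e :: l) y ↔ e.left = x ∧ IsPath e.right l y := Iff.rfl

theorem isPath_append {x y : V} {l l' : List (Quiver.Total V)} :
    IsPath x (l ++ l') y ↔ ∃ z, IsPath x l z ∧ IsPath z l' y := by
  induction l generalizing x with
  | nil => simp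
  | cons e l ih => simp [ih, and_assoc]

theorem IsPath.append {x y z : V} {l l' : List (Quiver.Total V)} (h : IsPath x l y)
    (h' : IsPath y l' z) : IsPath x (l ++ l') z := isPath_append.2 ⟨y, h, h'⟩

theorem IsPath.right_unique {x y y' : V} {l : List (Quiver.Total V)} (h : IsPath x l y)
    (h' : IsPath x l y') : y = y' := by
  induction l generalizing x with
  | nil => exact h.symm.trans h'
  | cons e l ih => exact ih h.2 h'.2

theorem isPath_arrows {x y : V} (p : Quiver.Path x y) : IsPath x (arrows p) y := by
  induction p with
  | nil => rfl
  | cons p e ih => exact ih.append ⟨rfl, rfl⟩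

theorem arrows_comp {x y z : V} (p : Quiver.Path x y) (q : Quiver.Path y z) :
    arrows (p.comp q) = arrows p ++ arrows q := by
  induction q with
  | nil => simp [arrows]
  | cons q e ih => simp [arrows, ih]

theorem arrows_injective {x y : V} :
    Function.Injective (arrows : Quiver.Path x y → List (Quiver.Total V)) := by
  intro p q h
  induction p with
  | nil =>
    cases q with
    | nil => rfl
    | cons q e => simp [arrows] at h
  | cons p e ih =>
    cases q with
    | nil => simp [arrows] at h
    | cons q f =>
      obtain ⟨h1, h2⟩ := List.append_inj' h rfl
      obtain ⟨rfl, -, h3⟩ := Quiver.Total.mk.inj (List.singleton_injective h2)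
      obtain rfl := eq_of_heq h3
      rw [ih h1]

theorem exists_arrows_eq {x y : V} {l : List (Quiver.Total V)} (h : IsPath x l y) :
    ∃ p : Quiver.Path x y, arrows p = l := by
  induction l generalizing x with
  | nil => obtain rfl := h; exact ⟨.nil, rfl⟩
  | cons e l ih =>
    obtain ⟨rfl, h⟩ := h
    obtain ⟨p, rfl⟩ := ih h
    exact ⟨(Quiver.Path.nil.cons e.hom).comp p, by rw [arrows_comp]; simp [arrows]⟩

theorem exists_isPath (Q : QuiverPolyhedron V) (x y : V) : ∃ l, IsPath x l y :=
  let ⟨p⟩ := Q.stronglyConnected x y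
  ⟨_, isPath_arrows p⟩

/-! ### Cycles and their derivatives -/

theorem length_next (s : Bool) (a : Quiver.Total V) : Q.length s (Q.next s a) = Q.length s a :=
  Function.minimalPeriod_apply
    (Function.minimalPeriod_pos_iff_mem_periodicPts.1 (by have := Q.two_lt_length s a; omega))

theorem two_lt (s : Bool) (a : Quiver.Total V) : 2 < Q.length s a := Q.two_lt_length s a

theorem pow_length (s : Bool) (a : Quiver.Total V) : (Q.next s ^ Q.length s a) a = a := by
  rw [Equiv.Perm.coe_pow]
  exact Function.isPeriodicPt_minimalPeriod _ _

theorem left_symm (s : Bool) (a : Quiver.Total V) : ((Q.next s).symm a).right = a.left := by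
  rw [← Q.left_next s, Equiv.apply_symm_apply]

theorem isPath_range (s : Bool) (a : Quiver.Total V) (n : ℕ) :
    IsPath a.right ((List.range n).map fun i => (Q.next s ^ (i + 1)) a)
      ((Q.next s ^ n) a).right := by
  induction n with
  | zero => rfl
  | succ n ih =>
    rw [List.range_succ, List.map_append]
    refine ih.append ⟨?_, rfl⟩
    change ((Q.next s ^ (n + 1)) a).left = _
    rw [pow_succ', Equiv.Perm.mul_apply, Q.left_next]

theorem isPath_derivative (s : Bool) (a : Quiver.Total V) :
    IsPath a.right (Q.derivative s a) a.left := by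
  have h := Q.isPath_range s a (Q.length s a - 1)
  have h2 := Q.two_lt s a
  have e : (Q.next s).symm a = (Q.next s ^ (Q.length s a - 1)) a := by
    rw [Equiv.symm_apply_eq, ← Equiv.Perm.mul_apply, ← pow_succ', Nat.sub_add_cancel (by omega),
      Q.pow_length]
  rwa [← e, left_symm] at h

/-- The cycle of sign `s` through `a`, as a list starting with `a`. -/
noncomputable def cyc (s : Bool) (a : Quiver.Total V) : List (Quiver.Total V) :=
  a :: Q.derivative s a

theorem isPath_cyc (s : Bool) (a : Quiver.Total V) : IsPath a.left (Q.cyc s a) a.left :=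
  ⟨rfl, Q.isPath_derivative s a⟩

theorem cyc_eq (s : Bool) (a : Quiver.Total V) :
    Q.cyc s a = (List.range (Q.length s a)).map fun i => (Q.next s ^ i) a := by
  have := Q.two_lt s a
  obtain ⟨n, hn⟩ := Nat.exists_eq_add_of_lt this
  rw [cyc, derivative, hn, show 2 + n + 1 = (n + 2) + 1 by omega, List.range_succ_eq_map]
  simp [Function.comp_def]

theorem cyc_next (s : Bool) (a : Quiver.Total V) :
    Q.cyc s (Q.next s a) = Q.derivative s a ++ [a] := by
  have h := Q.two_lt s a
  obtain ⟨n, hn⟩ := Nat.exists_eq_add_of_lt h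
  have hn' : Q.length s a = (n + 2) + 1 := by omega
  rw [cyc_eq, length_next, derivative, hn', List.range_succ, List.map_append]
  have := Q.pow_length s a
  rw [hn'] at this
  simp only [List.map_cons, List.map_nil, ← Equiv.Perm.mul_apply, ← pow_succ, this]
  rfl

/-- The derivative by `next s a`, without its last arrow `a`: the part of the cycle of sign `s`
through `a` from the head of `next s a` to the tail of `a`. -/
noncomputable def complement (s : Bool) (a : Quiver.Total V) : List (Quiver.Total V) :=
  (Q.derivative s a).tail

theorem derivative_eq_cons (s : Bool) (a : Quiver.Total V) :
    Q.derivative s a = Q.next s a :: Q.complement s a := by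
  have h := Q.two_lt s a
  obtain ⟨n, hn⟩ := Nat.exists_eq_add_of_lt h
  rw [complement, derivative, hn, show 2 + n + 1 - 1 = (n + 1) + 1 by omega,
    List.range_succ_eq_map]
  simp

theorem derivative_next (s : Bool) (a : Quiver.Total V) :
    Q.derivative s (Q.next s a) = Q.complement s a ++ [a] := by
  have := Q.cyc_next s a
  rw [cyc, Q.derivative_eq_cons s a, List.cons_append] at this
  exact (List.cons.inj this).2

theorem isPath_complement (s : Bool) (a : Quiver.Total V) :
    IsPath (Q.next s a).right (Q.complement s a) a.left := by
  have := Q.isPath_derivative s a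
  rw [derivative_eq_cons] at this
  exact this.2

theorem nodup_cyc (s : Bool) (a : Quiver.Total V) : (Q.cyc s a).Nodup := by
  rw [cyc_eq]
  refine List.Nodup.map_on ?_ List.nodup_range
  intro i hi j hj h
  rw [Equiv.Perm.coe_pow, Equiv.Perm.coe_pow] at h
  exact Function.iterate_injOn_Iio_minimalPeriod (List.mem_range.1 hi) (List.mem_range.1 hj) h

/-! ### Path classes -/

/-- The defining relations of the path classes. -/
def relations : FreeMonoid (Quiver.Total V) → FreeMonoid (Quiver.Total V) → Prop := fun w w' =>
  ∃ a, w = .ofList (Q.derivative true a) ∧ w' = .ofList (Q.derivative false a)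

/-- The monoid in which two paths are equal when they define the same morphism of the Jacobi
category. Its elements need not come from composable arrows. -/
abbrev PathMonoid := PresentedMonoid Q.relations

/-- The class of a list of arrows. -/
def cls (l : List (Quiver.Total V)) : Q.PathMonoid := PresentedMonoid.mk _ (.ofList l)

@[simp] theorem cls_nil : Q.cls [] = 1 := rfl

@[simp] theorem cls_append (l l' : List (Quiver.Total V)) :
    Q.cls (l ++ l') = Q.cls l * Q.cls l' := rfl

theorem cls_cons (e : Quiver.Total V) (l : List (Quiver.Total V)) :
    Q.cls (e :: l) = Q.cls [e] * Q.cls l := rfl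

theorem cls_derivative (s s' : Bool) (a : Quiver.Total V) :
    Q.cls (Q.derivative s a) = Q.cls (Q.derivative s' a) := by
  have : Q.cls (Q.derivative true a) = Q.cls (Q.derivative false a) :=
    PresentedMonoid.mk_eq_mk_of_rel ⟨a, rfl, rfl⟩
  cases s <;> cases s' <;> simp [this]

/-- The equality of classes is the smallest congruence that identifies the two derivatives by each
arrow. -/
theorem rel_of_cls_eq {R : List (Quiver.Total V) → List (Quiver.Total V) → Prop}
    (hR : Equivalence R)
    (happ : ∀ p p' q q', R p p' → R q q' → R (p ++ q) (p' ++ q'))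
    (hgen : ∀ a, R (Q.derivative true a) (Q.derivative false a))
    {p q : List (Quiver.Total V)} (h : Q.cls p = Q.cls q) : R p q := by
  have h' : conGen Q.relations (.ofList p) (.ofList q) := (Con.eq _).1 h
  let c : Con (FreeMonoid (Quiver.Total V)) :=
    { r := fun w w' => R w.toList w'.toList
      iseqv := ⟨fun _ => hR.refl _, hR.symm, hR.trans⟩
      mul' := happ _ _ _ _ }
  refine (Con.conGen_le (c := c)).2 ?_ h'
  rintro _ _ ⟨a, rfl, rfl⟩
  exact hgen a

theorem isPath_iff_of_cls_eq {p q : List (Quiver.Total V)} (h : Q.cls p = Q.cls q) (x y : V) :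
    IsPath x p y ↔ IsPath x q y := by
  refine Q.rel_of_cls_eq (R := fun p q => ∀ x y, IsPath x p y ↔ IsPath x q y)
    ⟨fun _ _ _ => Iff.rfl, fun h x y => (h x y).symm, fun h h' x y => (h x y).trans (h' x y)⟩
    ?_ ?_ h x y
  · intro p p' q q' hp hq x y
    simp [isPath_append, hp, hq]
  · intro a x y
    have key : ∀ s, IsPath x (Q.derivative s a) y ↔ a.right = x ∧ a.left = y := by
      intro s
      have h := Q.isPath_derivative s a
      constructor
      · intro h'
        have : a.right = x := by
          rw [derivative_eq_cons] at h h'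
          exact h.1.symm.trans h'.1
        subst this
        exact ⟨rfl, h.right_unique h'⟩
      · rintro ⟨rfl, rfl⟩
        exact h
    rw [key, key]

theorem sum_eq_of_cls_eq {M : Type*} [AddCommMonoid M] (w : Quiver.Total V → M)
    (hw : ∀ a, ((Q.derivative true a).map w).sum = ((Q.derivative false a).map w).sum)
    {p q : List (Quiver.Total V)} (h : Q.cls p = Q.cls q) : (p.map w).sum = (q.map w).sum := by
  refine Q.rel_of_cls_eq (R := fun p q => (p.map w).sum = (q.map w).sum)
    ⟨fun _ => rfl, Eq.symm, Eq.trans⟩ ?_ hw h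
  intro p p' q q' hp hq
  simp [hp, hq]

/-- One of the two derivatives by an arrow is replaced by the other one. -/
def Step (p q : List (Quiver.Total V)) : Prop :=
  ∃ l a s l', p = l ++ Q.derivative s a ++ l' ∧ q = l ++ Q.derivative (!s) a ++ l'

theorem reflTransGen_step_of_cls_eq {p q : List (Quiver.Total V)} (h : Q.cls p = Q.cls q) :
    Relation.ReflTransGen Q.Step p q := by
  refine Q.rel_of_cls_eq (R := Relation.ReflTransGen Q.Step) ⟨fun _ => .refl, ?_, .trans⟩ ?_ ?_ h
  · have : Std.Symm Q.Step := ⟨by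
      rintro _ _ ⟨l, a, s, l', rfl, rfl⟩
      exact ⟨l, a, !s, l', rfl, by rw [Bool.not_not]⟩⟩
    exact fun {_ _} h => (inferInstance : Std.Symm (Relation.ReflTransGen Q.Step)).symm _ _ h
  · intro p p' q q' hp hq
    refine .trans (hp.lift (· ++ q) ?_) (hq.lift (p' ++ ·) ?_)
    · rintro _ _ ⟨l, a, s, l', rfl, rfl⟩
      exact ⟨l, a, s, l' ++ q, by simp, by simp⟩
    · rintro _ _ ⟨l, a, s, l', rfl, rfl⟩
      exact ⟨p' ++ l, a, s, l', by simp, by simp⟩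
  · exact fun a => .single ⟨[], a, true, [], by simp, by simp⟩

theorem eq_nil_of_cls_eq_one {p : List (Quiver.Total V)} (h : Q.cls p = 1) : p = [] := by
  refine (Q.rel_of_cls_eq (R := fun p q => p = [] ↔ q = []) ⟨fun _ => Iff.rfl, Iff.symm, Iff.trans⟩
    ?_ ?_ (p := p) (q := []) h).2 rfl
  · intro p p' q q' hp hq
    simp [hp, hq]
  · intro a
    simp [derivative_eq_cons]

/-! ### The loops -/

theorem cls_cyc_next (s : Bool) (a : Quiver.Total V) :
    Q.cls (Q.cyc s (Q.next s a)) = Q.cls (Q.derivative s a) * Q.cls [a] := by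
  rw [cyc_next, cls_append]

theorem cls_cyc (s s' : Bool) (a : Quiver.Total V) : Q.cls (Q.cyc s a) = Q.cls (Q.cyc s' a) := by
  rw [cyc, cls_cons, Q.cls_derivative s s', ← cls_cons]; rfl

theorem cls_cyc_next_eq (s s' : Bool) (a : Quiver.Total V) :
    Q.cls (Q.cyc s (Q.next s a)) = Q.cls (Q.cyc s' (Q.next s' a)) := by
  rw [cls_cyc_next, cls_cyc_next, Q.cls_derivative s s']

/-- A function on the arrows that agrees on the two sides of every corner is constant on the arrows
that enter a vertex. -/
theorem eq_of_right_eq {X : Type*} (f : Quiver.Total V → X)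
    (hf : ∀ a b, Q.next true a = Q.next false b → f a = f b) {a b : Quiver.Total V}
    (h : a.right = b.right) : f a = f b := by
  obtain ⟨n, rfl⟩ := Q.link_connected a b h
  have hρ : ∀ c, f (((Q.next false)⁻¹ * Q.next true) c) = f c := fun c =>
    (hf _ _ (by simp)).symm
  have hρ' : ∀ c, f (((Q.next false)⁻¹ * Q.next true)⁻¹ c) = f c := fun c => by
    rw [← hρ]; simp
  clear h
  induction n using Int.induction_on with
  | zero => rfl
  | succ n ih => rw [ih, add_comm, zpow_add, zpow_one, Equiv.Perm.mul_apply, hρ]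
  | pred n ih => rw [ih, sub_eq_neg_add, zpow_add, zpow_neg_one, Equiv.Perm.mul_apply, hρ']

/-- A function on the arrows that takes the same value on the two arrows `next s a`, for every
arrow `a`, is constant on the arrows that leave a vertex. -/
theorem eq_of_left_eq {X : Type*} (f : Quiver.Total V → X)
    (hf : ∀ a, f (Q.next true a) = f (Q.next false a)) {a b : Quiver.Total V}
    (h : a.left = b.left) : f a = f b := by
  have := Q.eq_of_right_eq (fun c => f (Q.next true c)) (a := (Q.next true).symm a)
    (b := (Q.next true).symm b) (fun c d hcd => by rw [hf d, hcd])
    (by rw [left_symm, left_symm, h])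
  simpa using this

theorem cls_cyc_eq (s s' : Bool) {a b : Quiver.Total V} (h : a.left = b.left) :
    Q.cls (Q.cyc s a) = Q.cls (Q.cyc s' b) := by
  rw [Q.cls_cyc s' s]
  exact Q.eq_of_left_eq (fun a => Q.cls (Q.cyc s a)) (fun a => by
    rw [Q.cls_cyc s true, Q.cls_cyc s false, Q.cls_cyc_next_eq]) h

open Classical in
/-- The class of the cycles at a vertex (`1` in the absence of arrows). -/
noncomputable def loop (x : V) : Q.PathMonoid :=
  if h : ∃ a : Quiver.Total V, a.left = x then Q.cls (Q.cyc true h.choose) else 1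

theorem cls_cyc_eq_loop (s : Bool) (a : Quiver.Total V) : Q.cls (Q.cyc s a) = Q.loop a.left := by
  have h : ∃ b : Quiver.Total V, b.left = a.left := ⟨a, rfl⟩
  rw [loop, dif_pos h]
  exact Q.cls_cyc_eq _ _ h.choose_spec.symm

theorem cls_mul_derivative (s : Bool) (a : Quiver.Total V) :
    Q.cls [a] * Q.cls (Q.derivative s a) = Q.loop a.left := by
  rw [← Q.cls_cyc_eq_loop s, cyc, ← cls_cons]

theorem derivative_mul_cls (s : Bool) (a : Quiver.Total V) :
    Q.cls (Q.derivative s a) * Q.cls [a] = Q.loop a.right := by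
  rw [← cls_cyc_next, cls_cyc_eq_loop, left_next]

/-- The loops form a central element of the path algebra. -/
theorem loop_mul_cls {x y : V} {l : List (Quiver.Total V)} (h : IsPath x l y) :
    Q.loop x * Q.cls l = Q.cls l * Q.loop y := by
  induction l generalizing x with
  | nil => obtain rfl := h; simp
  | cons e l ih =>
    obtain ⟨rfl, h⟩ := h
    rw [cls_cons, mul_assoc, ← ih h, ← Q.cls_mul_derivative true, ← Q.derivative_mul_cls true]
    simp only [mul_assoc]

theorem loop_pow_mul_cls {x y : V} {l : List (Quiver.Total V)} (h : IsPath x l y) (n : ℕ) :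
    Q.loop x ^ n * Q.cls l = Q.cls l * Q.loop y ^ n := by
  induction n with
  | zero => simp
  | succ n ih => rw [pow_succ', mul_assoc, ih, ← mul_assoc, Q.loop_mul_cls h, mul_assoc, pow_succ']

theorem exists_left_eq (Q : QuiverPolyhedron V) [Nonempty (Quiver.Total V)] (x : V) :
    ∃ a : Quiver.Total V, a.left = x := by
  obtain ⟨b⟩ := ‹Nonempty (Quiver.Total V)›
  obtain ⟨l, hl⟩ := Q.exists_isPath x b.left
  cases l with
  | nil => exact ⟨b, hl.symm⟩
  | cons e l => exact ⟨e, hl.1⟩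

theorem exists_right_eq (Q : QuiverPolyhedron V) [Nonempty (Quiver.Total V)] (x : V) :
    ∃ a : Quiver.Total V, a.right = x := by
  obtain ⟨a, rfl⟩ := Q.exists_left_eq x
  exact ⟨(Q.next true).symm a, Q.left_symm true a⟩

theorem exists_isPath_loop_pow [Nonempty (Quiver.Total V)] (x : V) (n : ℕ) :
    ∃ l, IsPath x l x ∧ Q.cls l = Q.loop x ^ n ∧
      ∀ w : Quiver.Total V → ℤ, (∀ s a, ((Q.cyc s a).map w).sum = 1) → (l.map w).sum = n := by
  induction n with
  | zero => exact ⟨[], rfl, by simp, by simp⟩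
  | succ n ih =>
    obtain ⟨l, hl, hl', hw⟩ := ih
    obtain ⟨a, rfl⟩ := Q.exists_left_eq x
    refine ⟨_, hl.append (Q.isPath_cyc true a), by
      rw [cls_append, hl', cls_cyc_eq_loop, pow_succ], fun w h => ?_⟩
    rw [List.map_append, List.sum_append, hw w h, h]
    push_cast
    rfl

/-- A weight whose sum along every cycle is `1` is a degree function on the path classes. -/
theorem sum_eq_add_of_cls_eq [Nonempty (Quiver.Total V)] {w : Quiver.Total V → ℤ}
    (hw : ∀ s a, ((Q.cyc s a).map w).sum = 1) {p q : List (Quiver.Total V)} {y : V} {k : ℕ}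
    (h : Q.cls p = Q.cls q * Q.loop y ^ k) : (p.map w).sum = (q.map w).sum + k := by
  obtain ⟨l, -, hl, hlw⟩ := Q.exists_isPath_loop_pow y k
  rw [← hl, ← cls_append] at h
  rw [Q.sum_eq_of_cls_eq w (fun a => ?_) h, List.map_append, List.sum_append, hlw w hw]
  have h1 := hw true a
  have h2 := hw false a
  rw [cyc, List.map_cons, List.sum_cons] at h1 h2
  linarith

/-! ### Cancellation in terms of lists -/

/-- The morphism of the Jacobi category given by a path. -/
def morphism {x y : V} (p : Quiver.Path x y) :
    (CategoryTheory.Quotient.mk x : Q.JacobiCategory) ⟶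
      (CategoryTheory.Quotient.mk y : Q.JacobiCategory) :=
  (CategoryTheory.Quotient.functor Q.jacobiRel).map (X := x) (Y := y) p

theorem morphism_comp {x y z : V} (p : Quiver.Path x y) (q : Quiver.Path y z) :
    Q.morphism (p.comp q) = Q.morphism p ≫ Q.morphism q := rfl

theorem exists_morphism_eq {x y : V}
    (f : (CategoryTheory.Quotient.mk x : Q.JacobiCategory) ⟶
      (CategoryTheory.Quotient.mk y : Q.JacobiCategory)) :
    ∃ p : Quiver.Path x y, Q.morphism p = f := Quot.exists_rep f

theorem morphism_eq_iff {x y : V} (p q : Quiver.Path x y) :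
    Q.morphism p = Q.morphism q ↔ Q.cls (arrows p) = Q.cls (arrows q) := by
  constructor
  · intro h
    have h' := Quot.eqvGen_exact h
    clear h
    induction h' with
    | rel p q h =>
      obtain ⟨_, _, f, m₁, m₂, g, ⟨a, h1, h2⟩⟩ := h
      have key : ∀ {x x' y' y : V} (f : Quiver.Path x x') (m : Quiver.Path x' y')
          (g : Quiver.Path y' y), Q.cls (arrows (f.comp (m.comp g))) =
          Q.cls (arrows f) * (Q.cls (arrows m) * Q.cls (arrows g)) := fun f m g => by
        rw [← cls_append, ← cls_append, ← arrows_comp, ← arrows_comp]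
      refine (key f m₁ g).trans (.trans ?_ (key f m₂ g).symm)
      rw [h1, h2, Q.cls_derivative]
    | refl => rfl
    | symm _ _ _ ih => exact ih.symm
    | trans _ _ _ _ _ ih1 ih2 => exact ih1.trans ih2
  · intro h
    have H := Q.rel_of_cls_eq (R := fun l l' => Q.cls l = Q.cls l' ∧
      ∀ (x y : V) (p q : Quiver.Path x y), arrows p = l → arrows q = l' →
      Q.morphism p = Q.morphism q) ?_ ?_ ?_ h
    · exact H.2 _ _ _ _ rfl rfl
    · refine ⟨fun l => ⟨rfl, fun x y p q hp hq => ?_⟩, fun h => ⟨h.1.symm, fun x y p q hp hq =>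
        (h.2 _ _ _ _ hq hp).symm⟩, fun {l l' l''} h h' => ⟨h.1.trans h'.1, fun x y p q hp hq => ?_⟩⟩
      · rw [arrows_injective (hp.trans hq.symm)]
      · obtain ⟨r, hr⟩ := exists_arrows_eq ((Q.isPath_iff_of_cls_eq h.1 x y).1
          (hp ▸ isPath_arrows p))
        exact (h.2 _ _ _ _ hp hr).trans (h'.2 _ _ _ _ hr hq)
    · rintro l₁ l₁' l₂ l₂' ⟨h1, h1'⟩ ⟨h2, h2'⟩
      refine ⟨by simp [h1, h2], fun x y p q hp hq => ?_⟩
      obtain ⟨z, hz1, hz2⟩ := isPath_append.1 (hp ▸ isPath_arrows p)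
      obtain ⟨p1, hp1⟩ := exists_arrows_eq hz1
      obtain ⟨p2, hp2⟩ := exists_arrows_eq hz2
      obtain ⟨q1, hq1⟩ := exists_arrows_eq ((Q.isPath_iff_of_cls_eq h1 _ _).1 hz1)
      obtain ⟨q2, hq2⟩ := exists_arrows_eq ((Q.isPath_iff_of_cls_eq h2 _ _).1 hz2)
      obtain rfl : p = p1.comp p2 := arrows_injective (by rw [arrows_comp, hp, hp1, hp2])
      obtain rfl : q = q1.comp q2 := arrows_injective (by rw [arrows_comp, hq, hq1, hq2])
      rw [morphism_comp, morphism_comp, h1' _ _ _ _ hp1 hq1, h2' _ _ _ _ hp2 hq2]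
    · intro a
      refine ⟨Q.cls_derivative _ _ a, fun x y p q hp hq => ?_⟩
      exact CategoryTheory.Quotient.sound _ ⟨a, hp, hq⟩

/-- Cancellation of path classes. -/
theorem isCancellation_iff : Q.IsCancellation ↔
    (∀ x y z p q r, IsPath x p y → IsPath x q y → IsPath y r z → Q.cls p * Q.cls r =
      Q.cls q * Q.cls r → Q.cls p = Q.cls q) ∧
    (∀ x y z p q r, IsPath y p z → IsPath y q z → IsPath x r y → Q.cls r * Q.cls p =
      Q.cls r * Q.cls q → Q.cls p = Q.cls q) := by
  have hcomp : ∀ {x y z : V} (p q : Quiver.Path x y) (r s : Quiver.Path y z),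
      Q.morphism p ≫ Q.morphism r = Q.morphism q ≫ Q.morphism s ↔
      Q.cls (arrows p) * Q.cls (arrows r) = Q.cls (arrows q) * Q.cls (arrows s) := by
    intro x y z p q r s
    rw [← morphism_comp, ← morphism_comp, ← cls_append, ← cls_append, ← arrows_comp,
      ← arrows_comp]
    exact Q.morphism_eq_iff _ _
  constructor
  · intro H
    constructor
    · intro x y z p q r hp hq hr h
      obtain ⟨p, rfl⟩ := exists_arrows_eq hp
      obtain ⟨q, rfl⟩ := exists_arrows_eq hq
      obtain ⟨r, rfl⟩ := exists_arrows_eq hr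
      have := (H (Q.morphism r)).1
      exact (Q.morphism_eq_iff _ _).1 ((cancel_mono _).1 ((hcomp _ _ _ _).2 h))
    · intro x y z p q r hp hq hr h
      obtain ⟨p, rfl⟩ := exists_arrows_eq hp
      obtain ⟨q, rfl⟩ := exists_arrows_eq hq
      obtain ⟨r, rfl⟩ := exists_arrows_eq hr
      have := (H (Q.morphism r)).2
      exact (Q.morphism_eq_iff _ _).1 ((cancel_epi _).1 ((hcomp _ _ _ _).2 h))
  · rintro ⟨H1, H2⟩ ⟨x⟩ ⟨y⟩ f
    obtain ⟨r, rfl⟩ := Q.exists_morphism_eq f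
    refine ⟨⟨?_⟩, ⟨?_⟩⟩
    · rintro ⟨z⟩ f g h
      obtain ⟨p, rfl⟩ := Q.exists_morphism_eq f
      obtain ⟨q, rfl⟩ := Q.exists_morphism_eq g
      exact (Q.morphism_eq_iff p q).2 (H1 _ _ _ _ _ _ (isPath_arrows p) (isPath_arrows q)
        (isPath_arrows r) ((hcomp _ _ _ _).1 h))
    · rintro ⟨z⟩ f g h
      obtain ⟨p, rfl⟩ := Q.exists_morphism_eq f
      obtain ⟨q, rfl⟩ := Q.exists_morphism_eq g
      exact (Q.morphism_eq_iff p q).2 (H2 _ _ _ _ _ _ (isPath_arrows p) (isPath_arrows q)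
        (isPath_arrows r) ((hcomp _ _ _ _).1 h))

/-! ### Potentials -/

/-- A function on a set with a permutation all of whose orbits are finite is a coboundary if its
products over the orbits are trivial. -/
theorem exists_perm_potential {X G : Type*} [Group G] (ρ : Equiv.Perm X)
    (hρ : ∀ a, 0 < Function.minimalPeriod ρ a) (θ : X → G)
    (hθ : ∀ a, ((List.range (Function.minimalPeriod ρ a)).map fun i => θ ((ρ ^ i) a)).prod = 1) :
    ∃ k : X → G, ∀ a, k (ρ a) = k a * θ a := by
  let P : X → ℕ → G := fun a n => ((List.range n).map fun i => θ ((ρ ^ i) a)).prod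
  have hper : ∀ a, (ρ ^ Function.minimalPeriod ρ a) a = a := fun a => by
    rw [Equiv.Perm.coe_pow]; exact Function.isPeriodicPt_minimalPeriod _ _
  have hP : ∀ a n m, P a (n + m) = P a n * P ((ρ ^ n) a) m := fun a n m => by
    simp only [P, List.range_add, List.map_append, List.prod_append, List.map_map]
    congr 3
    funext i
    simp only [Function.comp_apply]
    rw [add_comm n, pow_add, Equiv.Perm.mul_apply]
  have hmod : ∀ a n, P a n = P a (n % Function.minimalPeriod ρ a) := fun a n => by
    have key : ∀ j i, P a (Function.minimalPeriod ρ a * j + i) = P a i := by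
      intro j i
      induction j with
      | zero => simp
      | succ j ih =>
        rw [mul_add, mul_one, add_comm (_ * j), add_assoc, hP, hper, ih]
        simp only [P, hθ, one_mul]
    conv_lhs => rw [← Nat.div_add_mod n (Function.minimalPeriod ρ a), key]
  have hPeq : ∀ a n m, (ρ ^ n) a = (ρ ^ m) a → P a n = P a m := by
    intro a n m h
    rw [hmod a n, hmod a m]
    congr 1
    rw [Equiv.Perm.coe_pow, Equiv.Perm.coe_pow, ← Function.iterate_mod_minimalPeriod_eq (n := n),
      ← Function.iterate_mod_minimalPeriod_eq (n := m)] at h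
    exact Function.iterate_injOn_Iio_minimalPeriod (Nat.mod_lt _ (hρ a)) (Nat.mod_lt _ (hρ a)) h
  let r : X → X := fun a => (Quotient.mk (Equiv.Perm.SameCycle.setoid ρ) a).out
  have hr : ∀ a, ρ.SameCycle (r a) a := fun a =>
    Quotient.exact (s := Equiv.Perm.SameCycle.setoid ρ) (Quotient.out_eq _)
  have hr' : ∀ a, r (ρ a) = r a := fun a => by
    simp only [r]
    congr 1
    exact Quotient.sound (s := Equiv.Perm.SameCycle.setoid ρ)
      (Equiv.Perm.sameCycle_apply_left.2 (Equiv.Perm.SameCycle.refl _ _))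
  have hn : ∀ a, ∃ n : ℕ, (ρ ^ n) (r a) = a := by
    intro a
    obtain ⟨z, hz⟩ := hr a
    set p := Function.minimalPeriod ρ (r a) with hp
    have h1 : ((ρ ^ p) ^ z.natAbs) (r a) = r a :=
      Equiv.Perm.pow_apply_eq_self_of_apply_eq_self (hper _) _
    have h2 : 0 ≤ z + (p * z.natAbs : ℕ) := by
      have : 0 < p := hρ _
      have : z.natAbs ≤ p * z.natAbs := Nat.le_mul_of_pos_left _ this
      omega
    obtain ⟨n, hn⟩ := Int.eq_ofNat_of_zero_le h2
    refine ⟨n, ?_⟩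
    rw [← zpow_natCast, ← hn, zpow_add, Equiv.Perm.mul_apply, zpow_natCast, pow_mul, h1, hz]
  choose n hn using hn
  refine ⟨fun a => P (r a) (n a), fun a => ?_⟩
  have h1 : P (r a) (n a + 1) = P (r a) (n a) * θ a := by
    rw [hP, hn]
    simp [P]
  change P (r (ρ a)) (n (ρ a)) = P (r a) (n a) * θ a
  rw [hr', ← h1]
  refine hPeq _ _ _ ?_
  rw [pow_succ', Equiv.Perm.mul_apply, hn]
  conv_rhs => rw [← hn (ρ a), hr']

theorem mem_cyc {s : Bool} {a b : Quiver.Total V} :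
    b ∈ Q.cyc s a ↔ (Q.next s).SameCycle a b := by
  rw [cyc_eq, List.mem_map]
  constructor
  · rintro ⟨i, -, rfl⟩
    exact ⟨i, by simp⟩
  · rintro ⟨z, rfl⟩
    have h2 := Q.two_lt s a
    have hp : (Q.next s ^ (Q.length s a : ℤ)) a = a := by rw [zpow_natCast, Q.pow_length]
    have h0 : 0 ≤ z % Q.length s a := Int.emod_nonneg _ (by omega)
    have h1 : z % Q.length s a < Q.length s a := Int.emod_lt_of_pos _ (by omega)
    refine ⟨(z % Q.length s a).toNat, by simp; omega, ?_⟩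
    conv_rhs => rw [← Int.emod_add_mul_ediv z (Q.length s a), zpow_add, Equiv.Perm.mul_apply,
      zpow_mul, Equiv.Perm.zpow_apply_eq_self_of_apply_eq_self hp]
    rw [← zpow_natCast, Int.toNat_of_nonneg h0]

/-- On a contractible `|Q|`, a function on the arrows with values in a group whose products along
the cycles are trivial is the derivative of a function on the vertices. -/
theorem exists_vertex_potential [ContractibleSpace Q.Realization] {G : Type*} [Group G]
    (g : Quiver.Total V → G) (hg : ∀ s a, ((Q.cyc s a).map g).prod = 1) :
    ∃ D : V → G, ∀ x l y, IsPath x l y → D y = D x * (l.map g).prod := by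
  have hk : ∀ s, ∃ k : Quiver.Total V → G, ∀ a, k (Q.next s a) = k a * g a := fun s =>
    exists_perm_potential (Q.next s) (fun a => by have := Q.two_lt_length s a; omega) g
      fun a => by simpa [cyc_eq, length, Function.comp_def] using hg s a
  choose k hk using hk
  obtain ⟨u, hu⟩ := Q.exists_potential_of_contractible (fun _ => g) g 1 (by simp)
    (fun s a => (k s a)⁻¹) (fun s a => by simp [hk])
  classical
  let D : V → G := fun x => if h : ∃ a : Quiver.Total V, a.left = x then u h.choose else 1
  have hD : ∀ a, D a.left = u a := fun a => by
    have h : ∃ b : Quiver.Total V, b.left = a.left := ⟨a, rfl⟩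
    simp only [D, dif_pos h]
    exact Q.eq_of_left_eq u (fun b => by rw [hu, hu]) h.choose_spec
  refine ⟨D, fun x l y h => ?_⟩
  induction l generalizing x with
  | nil => obtain rfl := h; simp
  | cons e l ih =>
    obtain ⟨rfl, h⟩ := h
    rw [ih _ h, hD, ← Q.left_next true, hD, hu, List.map_cons, List.prod_cons, mul_assoc]

theorem exists_vertex_addPotential [ContractibleSpace Q.Realization] {G : Type*} [AddGroup G]
    (g : Quiver.Total V → G) (hg : ∀ s a, ((Q.cyc s a).map g).sum = 0) :
    ∃ D : V → G, ∀ x l y, IsPath x l y → D y = D x + (l.map g).sum := by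
  have key : ∀ l : List (Quiver.Total V),
      (l.map fun a => Multiplicative.ofAdd (g a)).prod = .ofAdd (l.map g).sum := fun l => by
    induction l with
    | nil => rfl
    | cons a l ih => simp [ih]
  obtain ⟨D, hD⟩ := Q.exists_vertex_potential (fun a => Multiplicative.ofAdd (g a))
    (fun s a => by rw [key, hg]; rfl)
  exact ⟨fun x => (D x).toAdd, fun x l y h => by
    have := hD x l y h
    rw [key] at this
    exact congrArg Multiplicative.toAdd this⟩

/-- The arrows that enter a vertex. -/
noncomputable def ins (x : V) : Finset (Quiver.Total V) := (Q.locallyFinite x).toFinset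

@[simp] theorem mem_ins {x : V} {a : Quiver.Total V} : a ∈ Q.ins x ↔ a.right = x := by
  simp [ins]

/-- Both permutations `next s` map the arrows entering `x` bijectively to the arrows leaving `x`. -/
theorem sum_ins_next {M : Type*} [AddCommMonoid M] (f : Quiver.Total V → M) (s s' : Bool) (x : V) :
    ∑ a ∈ Q.ins x, f (Q.next s a) = ∑ a ∈ Q.ins x, f (Q.next s' a) := by
  refine Finset.sum_bij' (fun a _ => (Q.next s').symm (Q.next s a))
    (fun a _ => (Q.next s).symm (Q.next s' a)) ?_ ?_ ?_ ?_ ?_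
  · intro a ha; simpa [left_symm, left_next] using ha
  · intro a ha; simpa [left_symm, left_next] using ha
  · intro a ha; simp
  · intro a ha; simp
  · intro a ha; simp

/-- The orbit of `a` under the rotation around its head consists of all the arrows that enter it. -/
theorem sum_link {M : Type*} [AddCommMonoid M] (f : Quiver.Total V → M) (a : Quiver.Total V) :
    0 < Function.minimalPeriod ((Q.next false)⁻¹ * Q.next true) a ∧
    ((List.range (Function.minimalPeriod ((Q.next false)⁻¹ * Q.next true) a)).map fun i =>
      f ((((Q.next false)⁻¹ * Q.next true) ^ i) a)).sum = ∑ b ∈ Q.ins a.right, f b := by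
  classical
  set ρ := (Q.next false)⁻¹ * Q.next true with hρ
  have hr : ∀ b, (ρ b).right = b.right := fun b => by
    change ((Q.next false).symm (Q.next true b)).right = _
    rw [left_symm, left_next]
  have hr' : ∀ n : ℕ, ((ρ ^ n) a).right = a.right := fun n => by
    induction n with
    | zero => rfl
    | succ n ih => rw [pow_succ', Equiv.Perm.mul_apply, hr, ih]
  have hpos : 0 < Function.minimalPeriod ρ a := by
    rw [Function.minimalPeriod_pos_iff_mem_periodicPts]
    have : ¬ Function.Injective fun n : ℕ => (⟨(ρ ^ n) a, hr' n⟩ :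
        {b : Quiver.Total V | b.right = a.right}) := by
      have := (Q.locallyFinite a.right).to_subtype
      exact not_injective_infinite_finite _
    simp only [Function.Injective, not_forall] at this
    obtain ⟨i, j, h, hij⟩ := this
    replace h : (ρ ^ i) a = (ρ ^ j) a := congrArg Subtype.val h
    wlog hlt : i < j generalizing i j
    · exact this j i (fun e => hij e.symm) h.symm
        (by omega)
    refine ⟨j - i, by omega, ?_⟩
    rw [Function.IsPeriodicPt, Function.IsFixedPt, ← Equiv.Perm.coe_pow]
    have h3 : ρ ^ j = ρ ^ i * ρ ^ (j - i) := by rw [← pow_add]; congr 1; omega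
    rw [h3, Equiv.Perm.mul_apply] at h
    exact ((ρ ^ i).injective h).symm
  refine ⟨hpos, ?_⟩
  have hnd : ((List.range (Function.minimalPeriod ρ a)).map fun i => (ρ ^ i) a).Nodup := by
    refine List.Nodup.map_on ?_ List.nodup_range
    intro i hi j hj h
    rw [Equiv.Perm.coe_pow, Equiv.Perm.coe_pow] at h
    exact Function.iterate_injOn_Iio_minimalPeriod (List.mem_range.1 hi) (List.mem_range.1 hj) h
  have : Q.ins a.right =
      ((List.range (Function.minimalPeriod ρ a)).map fun i => (ρ ^ i) a).toFinset := by
    ext b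
    simp only [mem_ins, List.mem_toFinset, List.mem_map, List.mem_range]
    constructor
    · intro h
      have hp : (ρ ^ (Function.minimalPeriod ρ a : ℤ)) a = a := by
        rw [zpow_natCast, Equiv.Perm.coe_pow]; exact Function.isPeriodicPt_minimalPeriod _ _
      obtain ⟨z, hz⟩ := Q.link_connected a b h.symm
      have h0 : 0 ≤ z % Function.minimalPeriod ρ a := Int.emod_nonneg _ (by omega)
      have h1 : z % Function.minimalPeriod ρ a < Function.minimalPeriod ρ a :=
        Int.emod_lt_of_pos _ (by omega)
      refine ⟨(z % Function.minimalPeriod ρ a).toNat, by omega, ?_⟩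
      rw [← hz, ← zpow_natCast, Int.toNat_of_nonneg h0]
      conv_rhs => rw [← Int.emod_add_mul_ediv z (Function.minimalPeriod ρ a), zpow_add,
        Equiv.Perm.mul_apply, zpow_mul, Equiv.Perm.zpow_apply_eq_self_of_apply_eq_self hp]
    · rintro ⟨i, -, rfl⟩
      exact hr' i
  rw [this, List.sum_toFinset _ hnd, List.map_map]
  rfl

/-- On a contractible `|Q|`, a function on the corners of the polygons whose sums along the cycles
and around the vertices vanish is the derivative of a function on the arrows. -/
theorem exists_arrow_potential [ContractibleSpace Q.Realization] (m : Bool → Quiver.Total V → ℤ)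
    (hm : ∀ s a, ((Q.cyc s a).map (m s)).sum = 0)
    (hm' : ∀ x, ∑ a ∈ Q.ins x, (m true a - m false a) = 0) :
    ∃ u : Quiver.Total V → ℤ, ∀ s a, u (Q.next s a) = u a + m s a := by
  have key : ∀ (l : List ℕ) (f : ℕ → ℤ),
      (l.map fun a => Multiplicative.ofAdd (f a)).prod = .ofAdd (l.map f).sum := fun l f => by
    induction l with
    | nil => rfl
    | cons a l ih => simp [ih]
  have hk : ∀ s, ∃ k : Quiver.Total V → Multiplicative ℤ, ∀ a,
      k (Q.next s a) = k a * .ofAdd (m s a) := fun s =>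
    exists_perm_potential (Q.next s) (fun a => by have := Q.two_lt_length s a; omega) _
      fun a => by
        rw [key]
        have := hm s a
        rw [cyc_eq, List.map_map] at this
        exact congrArg Multiplicative.ofAdd this
  choose k hk using hk
  set ρ := (Q.next false)⁻¹ * Q.next true with hρ
  obtain ⟨κ, hκ⟩ := exists_perm_potential ρ (fun a => (Q.sum_link (M := ℤ) 0 a).1)
    (fun a => Multiplicative.ofAdd (m false (ρ a) - m true a)) fun a => by
      rw [key, (Q.sum_link (fun b => m false (ρ b) - m true b) a).2, Finset.sum_sub_distrib]
      have h1 : ∑ b ∈ Q.ins a.right, m false (ρ b) = ∑ b ∈ Q.ins a.right, m false b := by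
        have := Q.sum_ins_next (fun b => m false ((Q.next false).symm b)) true false a.right
        simp only [Equiv.symm_apply_apply] at this
        exact this
      have h2 := hm' a.right
      rw [Finset.sum_sub_distrib] at h2
      rw [h1, ← neg_sub, h2, neg_zero]
      rfl
  obtain ⟨u, hu⟩ := Q.exists_potential_of_contractible (fun s a => Multiplicative.ofAdd (m s a)) κ
    (fun b => κ ((Q.next true).symm b) * (Multiplicative.ofAdd (m true ((Q.next true).symm b)))⁻¹)
    (fun s a => by
      cases s
      · -- the arrow entering the same vertex across the corner `next false a`
        have e : a = ρ ((Q.next true).symm (Q.next false a)) := by simp [hρ]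
        have := hκ ((Q.next true).symm (Q.next false a))
        rw [← e] at this
        rw [this, ofAdd_sub]
        simp [mul_comm, mul_left_comm, div_eq_mul_inv]
      · simp)
    (fun s a => (k s a)⁻¹) (fun s a => by simp [hk])
  exact ⟨fun a => (u a).toAdd, fun s a => congrArg Multiplicative.toAdd (hu s a)⟩

/-! ### Chains -/

/-- The chain of a path: the multiplicities of the arrows. -/
noncomputable def mult (l : List (Quiver.Total V)) : Quiver.Total V →₀ ℤ :=
  (l.map fun a => Finsupp.single a 1).sum

@[simp] theorem mult_nil : mult ([] : List (Quiver.Total V)) = 0 := rfl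

@[simp] theorem mult_cons (a : Quiver.Total V) (l : List (Quiver.Total V)) :
    mult (a :: l) = Finsupp.single a 1 + mult l := by simp [mult]

@[simp] theorem mult_append (l l' : List (Quiver.Total V)) :
    mult (l ++ l') = mult l + mult l' := by simp [mult]

theorem mult_nonneg (l : List (Quiver.Total V)) (a : Quiver.Total V) : 0 ≤ mult l a := by
  classical
  induction l with
  | nil => simp
  | cons b l ih => rw [mult_cons, Finsupp.add_apply, Finsupp.single_apply]; split_ifs <;> omega

theorem mult_eq_zero {l : List (Quiver.Total V)} {a : Quiver.Total V} :
    mult l a = 0 ↔ a ∉ l := by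
  classical
  induction l with
  | nil => simp
  | cons b l ih =>
    have := mult_nonneg l a
    rw [mult_cons, Finsupp.add_apply, Finsupp.single_apply, List.mem_cons, not_or, ← ih]
    split_ifs with h
    · simp [h]; omega
    · simp [Ne.symm h]

theorem mult_eq_one {l : List (Quiver.Total V)} (hl : l.Nodup) {a : Quiver.Total V} (h : a ∈ l) :
    mult l a = 1 := by
  classical
  induction l with
  | nil => simp at h
  | cons b l ih =>
    rw [mult_cons, Finsupp.add_apply, Finsupp.single_apply]
    obtain ⟨hb, hl⟩ := List.nodup_cons.1 hl
    split_ifs with hab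
    · subst hab
      rw [mult_eq_zero.2 hb, add_zero]
    · rw [zero_add, ih hl ((List.mem_cons.1 h).resolve_left (Ne.symm hab))]

theorem mult_cyc_next (s s' : Bool) (a e : Quiver.Total V) (h : s = s') :
    mult (Q.cyc s a) (Q.next s' e) = mult (Q.cyc s a) e := by
  subst h
  have : Q.next s e ∈ Q.cyc s a ↔ e ∈ Q.cyc s a := by
    rw [mem_cyc, mem_cyc, Equiv.Perm.sameCycle_apply_right]
  by_cases he : e ∈ Q.cyc s a
  · rw [mult_eq_one (Q.nodup_cyc s a) he, mult_eq_one (Q.nodup_cyc s a) (this.2 he)]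
  · rw [mult_eq_zero.2 he, mult_eq_zero.2 (this.not.2 he)]

/-- On a contractible `|Q|`, the difference of two parallel paths is a boundary: it is the sum of
finitely many polygons, with multiplicities `E true` for the positive ones and `-E false` for the
negative ones. -/
theorem exists_boundary [ContractibleSpace Q.Realization] {x y : V} {p q : List (Quiver.Total V)}
    (hp : IsPath x p y) (hq : IsPath x q y) :
    ∃ E : Bool → Quiver.Total V →₀ ℤ, (∀ s a, E s (Q.next s a) = E s a) ∧
      ∀ a, mult p a - mult q a = E true a - E false a := by
  let N : AddSubgroup (Quiver.Total V →₀ ℤ) :=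
    .closure {c | ∃ s a, c = mult (Q.cyc s a)}
  have key : ∀ l : List (Quiver.Total V), (l.map fun a =>
      QuotientAddGroup.mk' N (Finsupp.single a 1)).sum = QuotientAddGroup.mk' N (mult l) :=
    fun l => by
    rw [mult, map_list_sum, List.map_map]; rfl
  obtain ⟨D, hD⟩ := Q.exists_vertex_addPotential
    (fun a => QuotientAddGroup.mk' N (Finsupp.single a 1)) (fun s a => by
      rw [key]
      exact (QuotientAddGroup.eq_zero_iff _).2 (AddSubgroup.subset_closure ⟨s, a, rfl⟩))
  have h : QuotientAddGroup.mk' N (mult p - mult q) = 0 := by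
    rw [map_sub, sub_eq_zero, ← key, ← key]
    exact add_left_cancel ((hD _ _ _ hp).symm.trans (hD _ _ _ hq))
  have hN : mult p - mult q ∈ N := (QuotientAddGroup.eq_zero_iff _).1 h
  suffices H : ∃ E : Bool → Quiver.Total V →₀ ℤ, (∀ s a, E s (Q.next s a) = E s a) ∧
      mult p - mult q = E true - E false by
    obtain ⟨E, h1, h2⟩ := H
    exact ⟨E, h1, fun a => by rw [← Finsupp.sub_apply, h2, Finsupp.sub_apply]⟩
  generalize mult p - mult q = c at hN
  induction hN using AddSubgroup.closure_induction with
  | mem c hc =>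
    obtain ⟨s, a, rfl⟩ := hc
    cases s
    · refine ⟨fun s => bif s then 0 else - mult (Q.cyc false a), fun s e => ?_, by simp⟩
      cases s <;> simp [mult_cyc_next]
    · refine ⟨fun s => bif s then mult (Q.cyc true a) else 0, fun s e => ?_, by simp⟩
      cases s <;> simp [mult_cyc_next]
  | zero => exact ⟨0, by simp, by simp⟩
  | add c d _ _ hc hd =>
    obtain ⟨E, h1, h2⟩ := hc
    obtain ⟨F, h3, h4⟩ := hd
    exact ⟨E + F, fun s a => by simp [h1, h3], by rw [h2, h4]; simp; abel⟩
  | neg c _ hc =>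
    obtain ⟨E, h1, h2⟩ := hc
    exact ⟨-E, fun s a => by simp [h1], by rw [h2]; simp; abel⟩

/-- A function on the polygons is constant if it takes the same value on the two polygons at each
arrow. -/
theorem eq_of_next_eq (Q : QuiverPolyhedron V) {X : Type*} {f : Quiver.Total V → X}
    (hf : ∀ s a, f (Q.next s a) = f a) (a b : Quiver.Total V) : f a = f b := by
  obtain ⟨l, hl⟩ := Q.exists_isPath a.right b.left
  induction l generalizing a with
  | nil =>
    rw [← hf true a]
    exact Q.eq_of_left_eq f (fun c => by rw [hf, hf]) ((Q.left_next true a).trans hl)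
  | cons e l ih =>
    rw [← ih e hl.2, ← hf true a]
    exact Q.eq_of_left_eq f (fun c => by rw [hf, hf]) ((Q.left_next true a).trans hl.1.symm)

theorem nonempty_total [hQ : ContractibleSpace Q.Realization] : Nonempty (Quiver.Total V) := by
  obtain ⟨x⟩ := (inferInstance : Nonempty Q.Realization)
  obtain ⟨⟨⟨s, a⟩, x⟩, -⟩ := Quot.exists_rep x
  exact ⟨a⟩

/-! ### A contractible surface has infinitely many polygons -/

section Infinite

open scoped unitInterval

/-- Stokes' formula modulo 2 on the square grid, for a function on the horizontal edges (`h`) and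
vertical edges (`v`). -/
theorem sum_grid (n : ℕ) (h v : ℕ → ℕ → ZMod 2) :
    ∑ i ∈ Finset.range n, ∑ j ∈ Finset.range n,
      ((h i j + h i (j + 1)) + (v i j + v (i + 1) j)) =
    (∑ i ∈ Finset.range n, (h i 0 + h i n)) + ∑ j ∈ Finset.range n, (v 0 j + v n j) := by
  have key : ∀ f : ℕ → ZMod 2, ∑ i ∈ Finset.range n, (f i + f (i + 1)) = f 0 + f n := fun f => by
    have := Finset.sum_range_sub f n
    simp only [CharTwo.sub_eq_add] at this
    rw [add_comm (f 0), ← this]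
    exact Finset.sum_congr rfl fun i _ => add_comm _ _
  simp only [Finset.sum_add_distrib]
  rw [← Finset.sum_add_distrib, Finset.sum_comm (f := fun i j => v i j),
    Finset.sum_comm (f := fun i j => v (i + 1) j), ← Finset.sum_add_distrib]
  simp only [← Finset.sum_add_distrib, key]

/-- Whether three labels are distinct, modulo 2. -/
def rainbow (i j k : Fin 3) : ZMod 2 := if i ≠ j ∧ j ≠ k ∧ i ≠ k then 1 else 0

theorem rainbow_cocycle : ∀ i j k l : Fin 3,
    rainbow j k l + rainbow i k l + rainbow i j l + rainbow i j k = 0 := by decide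

/-- Whether two labels are `0` and `1`, modulo 2. -/
def door (i j : Fin 3) : ZMod 2 := if (i = 0 ∧ j = 1) ∨ (i = 1 ∧ j = 0) then 1 else 0

theorem rainbow_eq_door : ∀ i j k : Fin 3,
    rainbow i j k = door j k + door i k + door i j := by decide

open Classical in
/-- The function on triples of points that counts the triples of distinct labels in `K`. -/
noncomputable def labelCount {X : Type*} (lab : X → Fin 3) (K : Set X) (x y z : X) : ZMod 2 :=
  if x ∈ K ∧ y ∈ K ∧ z ∈ K then rainbow (lab x) (lab y) (lab z) else 0

theorem labelCount_cocycle_of_mem {X : Type*} {lab : X → Fin 3} {K : Set X} {x y z w : X}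
    (hx : x ∈ K) (hy : y ∈ K) (hz : z ∈ K) (hw : w ∈ K) :
    labelCount lab K y z w + labelCount lab K x z w + labelCount lab K x y w +
      labelCount lab K x y z = 0 := by
  simp only [labelCount, hx, hy, hz, hw, and_self, if_true, rainbow_cocycle]

theorem labelCount_eq_zero {X : Type*} {lab : X → Fin 3} {K : Set X} {x y z : X} (i : Fin 3)
    (hx : x ∈ K → lab x ≠ i) (hy : y ∈ K → lab y ≠ i) (hz : z ∈ K → lab z ≠ i) :
    labelCount lab K x y z = 0 := by
  rw [labelCount]
  split_ifs with h
  · have key : ∀ i a b c : Fin 3, a ≠ i → b ≠ i → c ≠ i → rainbow a b c = 0 := by decide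
    exact key i _ _ _ (hx h.1) (hy h.2.1) (hz h.2.2)
  · rfl

theorem labelCount_self_left {X : Type*} (lab : X → Fin 3) (K : Set X) (x y : X) :
    labelCount lab K x x y = 0 := by
  simp [labelCount, rainbow]

theorem labelCount_self_right {X : Type*} (lab : X → Fin 3) (K : Set X) (x y : X) :
    labelCount lab K x y y = 0 := by
  simp [labelCount, rainbow]

/-- The parametrization of the triangle by the unit square that contracts one of its sides. -/
def squareParam (z : I × I) : stdSimplex ℝ (Fin 3) :=
  ⟨![1 - z.1, z.1 * (1 - z.2), z.1 * z.2], by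
    have h1 := z.1.2
    have h2 := z.2.2
    refine ⟨fun i => ?_, ?_⟩
    · fin_cases i
      · simpa using h1.2
      · exact mul_nonneg h1.1 (sub_nonneg.2 h2.2)
      · exact mul_nonneg h1.1 h2.1
    · simp only [Fin.sum_univ_three, Matrix.cons_val]
      ring⟩

theorem continuous_squareParam : Continuous squareParam := by
  refine Continuous.subtype_mk (continuous_pi fun i => ?_) _
  fin_cases i
  · simp; fun_prop
  · simp; fun_prop
  · simp; fun_prop

open Classical in
/-- The function on `|Q|` that is `w` times the product of the barycentric coordinates on the
triangle `τ`, and `0` on the other triangles. -/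
noncomputable def bump (τ : Bool × Quiver.Total V) (w : stdSimplex ℝ (Fin 3) → ℝ) :
    Q.Realization → ℝ :=
  Quot.lift (fun z => if z.1 = τ then z.2.1 0 * z.2.1 1 * z.2.1 2 * w z.2 else 0) (by
    rintro _ _ (⟨s, a, x, y, hx, hy, h1, h2⟩ | ⟨a, x, hx⟩)
    · simp [hx, hy]
    · simp [hx])

theorem continuous_bump (τ : Bool × Quiver.Total V) {w : stdSimplex ℝ (Fin 3) → ℝ}
    (hw : Continuous w) : Continuous (Q.bump τ w) := by
  have hc : ∀ i : Fin 3, Continuous fun x : stdSimplex ℝ (Fin 3) => x.1 i := fun i =>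
    (continuous_apply i).comp continuous_subtype_val
  refine continuous_quot_lift _ (continuous_sigma fun i => ?_)
  by_cases h : i = τ
  · simp only [h, if_true]
    exact (((hc 0).mul (hc 1)).mul (hc 2)).mul hw
  · simp only [h, if_false]
    exact continuous_const

theorem bump_tri (s : Bool) (a : Quiver.Total V) (w : stdSimplex ℝ (Fin 3) → ℝ)
    (x : stdSimplex ℝ (Fin 3)) :
    Q.bump (s, a) w (Q.tri s a x) = x.1 0 * x.1 1 * x.1 2 * w x := if_pos rfl

theorem bump_tri_of_ne {τ : Bool × Quiver.Total V} {s : Bool} {a : Quiver.Total V}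
    (h : (s, a) ≠ τ) (w : stdSimplex ℝ (Fin 3) → ℝ) (x : stdSimplex ℝ (Fin 3)) :
    Q.bump τ w (Q.tri s a x) = 0 := if_neg h

/-- The prism operator of a sequence of maps `X → X`. -/
def prism {X : Type*} (φ : X → X → X → ZMod 2) (H : ℕ → X → X) (n : ℕ) (x y : X) : ZMod 2 :=
  ∑ k ∈ Finset.range n, (φ (H k x) (H k y) (H (k + 1) y) + φ (H k x) (H (k + 1) x) (H (k + 1) y))

theorem add_eq_prism {X : Type*} (φ : X → X → X → ZMod 2) (H : ℕ → X → X) (n : ℕ) {x y z : X}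
    (h : ∀ k < n, ∀ p q r t, p ∈ ({H k x, H k y, H k z, H (k + 1) x, H (k + 1) y, H (k + 1) z} :
      Set X) → q ∈ ({H k x, H k y, H k z, H (k + 1) x, H (k + 1) y, H (k + 1) z} : Set X) →
      r ∈ ({H k x, H k y, H k z, H (k + 1) x, H (k + 1) y, H (k + 1) z} : Set X) →
      t ∈ ({H k x, H k y, H k z, H (k + 1) x, H (k + 1) y, H (k + 1) z} : Set X) →
      φ q r t + φ p r t + φ p q t + φ p q r = 0) :
    φ (H 0 x) (H 0 y) (H 0 z) + φ (H n x) (H n y) (H n z) =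
      prism φ H n y z + prism φ H n x z + prism φ H n x y := by
  have two : (2 : ZMod 2) = 0 := by decide
  induction n with
  | zero =>
    simp only [prism, Finset.range_zero, Finset.sum_empty]
    linear_combination φ (H 0 x) (H 0 y) (H 0 z) * two
  | succ n ih =>
    have ih := ih fun k hk => h k (by omega)
    have h := h n (by omega)
    have h1 := h (H n x) (H n y) (H n z) (H (n + 1) z) (by simp) (by simp) (by simp) (by simp)
    have h2 := h (H n x) (H n y) (H (n + 1) y) (H (n + 1) z) (by simp) (by simp) (by simp) (by simp)
    have h3 := h (H n x) (H (n + 1) x) (H (n + 1) y) (H (n + 1) z) (by simp) (by simp) (by simp)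
      (by simp)
    simp only [prism, Finset.sum_range_succ] at ih ⊢
    linear_combination ih + h1 + h2 + h3 - two * (φ (H n x) (H n y) (H n z) +
      φ (H n x) (H n y) (H (n + 1) z) + φ (H n x) (H (n + 1) y) (H (n + 1) z) +
      φ (H n y) (H n z) (H (n + 1) z) + φ (H n y) (H (n + 1) y) (H (n + 1) z) +
      φ (H n x) (H n z) (H (n + 1) z) + φ (H n x) (H (n + 1) x) (H (n + 1) z) +
      φ (H n x) (H n y) (H (n + 1) y) + φ (H n x) (H (n + 1) x) (H (n + 1) y))

/-- The `i`-th point of the subdivision of the unit interval into `n` parts (the last one if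
`i > n`). -/
noncomputable def gridPoint (n i : ℕ) : I := Set.projIcc 0 1 zero_le_one (i / n : ℝ)

theorem gridPoint_zero (n : ℕ) : gridPoint n 0 = 0 := by
  simp [gridPoint, Set.projIcc_left]

theorem gridPoint_self {n : ℕ} (hn : 0 < n) : gridPoint n n = 1 := by
  have : (n : ℝ) ≠ 0 := by positivity
  simp [gridPoint, div_self this]

theorem dist_gridPoint_le {n i j : ℕ} (h : i = j ∨ i = j + 1) :
    dist (gridPoint n i) (gridPoint n j) ≤ 1 / n := by
  refine ((LipschitzWith.projIcc (zero_le_one (α := ℝ))).dist_le_mul _ _).trans ?_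
  rw [NNReal.coe_one, one_mul, Real.dist_eq, ← sub_div, abs_div, Nat.abs_cast]
  gcongr
  rcases h with rfl | rfl <;> simp

/-- The label of a point of the triangle. -/
noncomputable def cornerLabel (x : stdSimplex ℝ (Fin 3)) : Fin 3 :=
  if 1 / 3 < x.1 0 then 0 else if 1 / 3 < x.1 1 then 1 else 2

theorem sum_rainbow_grid {n : ℕ} (hn : 0 < n) :
    ∑ i ∈ Finset.range n, ∑ j ∈ Finset.range n,
      (rainbow (cornerLabel (squareParam (gridPoint n i, gridPoint n j)))
        (cornerLabel (squareParam (gridPoint n (i + 1), gridPoint n j)))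
        (cornerLabel (squareParam (gridPoint n (i + 1), gridPoint n (j + 1)))) +
      rainbow (cornerLabel (squareParam (gridPoint n i, gridPoint n j)))
        (cornerLabel (squareParam (gridPoint n i, gridPoint n (j + 1))))
        (cornerLabel (squareParam (gridPoint n (i + 1), gridPoint n (j + 1))))) = 1 := by
  have two : (2 : ZMod 2) = 0 := by decide
  set P : ℕ → ℕ → Fin 3 := fun i j => cornerLabel (squareParam (gridPoint n i, gridPoint n j))
    with hP
  have hcell := sum_grid n (fun i j => door (P i j) (P (i + 1) j))
    (fun i j => door (P i j) (P i (j + 1)))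
  have e : ∀ i j, rainbow (P i j) (P (i + 1) j) (P (i + 1) (j + 1)) +
      rainbow (P i j) (P i (j + 1)) (P (i + 1) (j + 1)) =
      (door (P i j) (P (i + 1) j) + door (P i (j + 1)) (P (i + 1) (j + 1))) +
      (door (P i j) (P i (j + 1)) + door (P (i + 1) j) (P (i + 1) (j + 1))) := fun i j => by
    rw [rainbow_eq_door, rainbow_eq_door]
    linear_combination door (P i j) (P (i + 1) (j + 1)) * two
  change ∑ i ∈ Finset.range n, ∑ j ∈ Finset.range n,
    (rainbow (P i j) (P (i + 1) j) (P (i + 1) (j + 1)) +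
      rainbow (P i j) (P i (j + 1)) (P (i + 1) (j + 1))) = 1
  simp only [e, hcell]
  -- the only doors on the boundary are on the side `v = 0`
  have d02 : ∀ k l : Fin 3, k ≠ 1 → l ≠ 1 → door k l = 0 := by decide
  have d12 : ∀ k l : Fin 3, k ≠ 0 → l ≠ 0 → door k l = 0 := by decide
  have d01 : ∀ k l : Fin 3, k ≠ 2 → l ≠ 2 →
    door k l = (if l = 1 then 1 else 0) - (if k = 1 then 1 else 0) := by decide
  have hn1 : ∀ i, P i n ≠ 1 := fun i => by
    simp only [hP, cornerLabel, squareParam, gridPoint_self hn]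
    norm_num
    split_ifs <;> decide
  have hn2 : ∀ j, P n j ≠ 0 := fun j => by
    simp only [hP, cornerLabel, squareParam, gridPoint_self hn]
    norm_num
    split_ifs <;> decide
  have hn3 : ∀ j, P 0 j = 0 := fun j => by
    simp only [hP, cornerLabel, squareParam, gridPoint_zero]
    norm_num
  have hn4 : ∀ i, P i 0 ≠ 2 := fun i => by
    simp only [hP, cornerLabel, squareParam, gridPoint_zero]
    simp only [Matrix.cons_val, Set.Icc.coe_zero, sub_zero, mul_one]
    split_ifs with h1 h2
    · decide
    · decide
    · exact absurd (not_lt.1 h1) (by linarith [not_lt.1 h2])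
  have hn5 : P n 0 = 1 := by
    have h1 := hn2 0
    have h2 := hn4 n
    omega
  have z1 : ∀ i, door (P i n) (P (i + 1) n) = 0 := fun i => d02 _ _ (hn1 _) (hn1 _)
  have z2 : ∀ j, door (P n j) (P n (j + 1)) = 0 := fun i => d12 _ _ (hn2 _) (hn2 _)
  have z3 : ∀ j, door (P 0 j) (P 0 (j + 1)) = 0 := fun i => by rw [hn3, hn3]; decide
  simp only [z1, z2, z3, add_zero, Finset.sum_const_zero]
  rw [Finset.sum_congr rfl fun i _ => d01 _ _ (hn4 i) (hn4 (i + 1)),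
    Finset.sum_range_sub (fun i => if P i 0 = 1 then (1 : ZMod 2) else 0), hn5, hn3]
  decide

theorem le_mul_of_rainbow {S : Set (stdSimplex ℝ (Fin 3))}
    (hS : ∀ p ∈ S, ∀ q ∈ S, ∀ i : Fin 3, i ≠ 2 → |p.1 i - q.1 i| ≤ 2 / 100)
    {x y z : stdSimplex ℝ (Fin 3)} (hx : x ∈ S) (hy : y ∈ S) (hz : z ∈ S)
    (h : rainbow (cornerLabel x) (cornerLabel y) (cornerLabel z) ≠ 0)
    {p : stdSimplex ℝ (Fin 3)} (hp : p ∈ S) : 1 / 100 ≤ p.1 0 * p.1 1 * p.1 2 := by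
  have l0 : ∀ x, cornerLabel x = 0 → 1 / 3 < x.1 0 := fun x h => by
    by_contra h'
    rw [cornerLabel, if_neg h'] at h
    split_ifs at h <;> simp at h
  have l1 : ∀ x, cornerLabel x = 1 → x.1 0 ≤ 1 / 3 ∧ 1 / 3 < x.1 1 := fun x h => by
    rw [cornerLabel] at h
    split_ifs at h with h1 h2
    · simp at h
    · exact ⟨not_lt.1 h1, h2⟩
    · simp at h
  have l2 : ∀ x, cornerLabel x = 2 → x.1 0 ≤ 1 / 3 ∧ x.1 1 ≤ 1 / 3 := fun x h => by
    rw [cornerLabel] at h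
    split_ifs at h with h1 h2
    · simp at h
    · simp at h
    · exact ⟨not_lt.1 h1, not_lt.1 h2⟩
  have hr : ∀ i j k : Fin 3, rainbow i j k ≠ 0 → (i = 0 ∨ j = 0 ∨ k = 0) ∧
    (i = 1 ∨ j = 1 ∨ k = 1) ∧ (i = 2 ∨ j = 2 ∨ k = 2) := by decide
  obtain ⟨h0, h1, h2⟩ := hr _ _ _ h
  have hex : ∀ i, (cornerLabel x = i ∨ cornerLabel y = i ∨ cornerLabel z = i) →
      ∃ q ∈ S, cornerLabel q = i := by
    rintro i (h | h | h)
    exacts [⟨x, hx, h⟩, ⟨y, hy, h⟩, ⟨z, hz, h⟩]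
  obtain ⟨q0, hq0, e0⟩ := hex _ h0
  obtain ⟨q1, hq1, e1⟩ := hex _ h1
  obtain ⟨q2, hq2, e2⟩ := hex _ h2
  have e0 := l0 _ e0
  obtain ⟨e1, e1'⟩ := l1 _ e1
  obtain ⟨-, e2⟩ := l2 _ e2
  have hs := p.2.2
  rw [Fin.sum_univ_three] at hs
  have a0 := abs_le.1 (hS p hp q0 hq0 0 (by decide))
  have a1 := abs_le.1 (hS p hp q1 hq1 0 (by decide))
  have b1 := abs_le.1 (hS p hp q1 hq1 1 (by decide))
  have b2 := abs_le.1 (hS p hp q2 hq2 1 (by decide))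
  change p.1 0 + p.1 1 + p.1 2 = 1 at hs
  generalize p.1 0 = u at *
  generalize p.1 1 = v at *
  have hw : p.1 2 = 1 - u - v := by linarith
  rw [hw]
  have h1 : 8 / 100 ≤ u * v :=
    calc (8 / 100 : ℝ) ≤ (29 / 100) * (29 / 100) := by norm_num
      _ ≤ u * v := by apply mul_le_mul <;> linarith
  calc (1 / 100 : ℝ) ≤ (8 / 100) * (25 / 100) := by norm_num
    _ ≤ u * v * (1 - u - v) := by apply mul_le_mul <;> linarith

theorem abs_squareParam_sub_le {n i j i' j' : ℕ} (hn : 100 ≤ n)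
    (hi : i = i' ∨ i = i' + 1 ∨ i' = i + 1)
    (hj : j = j' ∨ j = j' + 1 ∨ j' = j + 1) (k : Fin 3) (hk : k ≠ 2) :
    |(squareParam (gridPoint n i, gridPoint n j)).1 k -
      (squareParam (gridPoint n i', gridPoint n j')).1 k| ≤ 2 / 100 := by
  have key : ∀ {i i' : ℕ}, (i = i' ∨ i = i' + 1 ∨ i' = i + 1) →
      |(gridPoint n i : ℝ) - gridPoint n i'| ≤ 1 / 100 := by
    intro i i' h
    have hn' : (1 : ℝ) / n ≤ 1 / 100 := by gcongr; exact_mod_cast hn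
    rw [← Real.dist_eq, ← Subtype.dist_eq]
    rcases h with h | h | h
    · exact (dist_gridPoint_le (.inl h)).trans hn'
    · exact (dist_gridPoint_le (.inr h)).trans hn'
    · rw [dist_comm]
      exact (dist_gridPoint_le (.inr h)).trans hn'
  have h1 := abs_le.1 (key hi)
  have h2 := abs_le.1 (key hj)
  have u1 := (gridPoint n i).2
  have v1 := (gridPoint n j').2
  obtain ⟨u0, u1⟩ := u1
  obtain ⟨v0, v1⟩ := v1
  fin_cases k
  · simp only [squareParam, Fin.zero_eta, Matrix.cons_val_zero]
    exact abs_le.2 ⟨by linarith, by linarith⟩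
  · simp only [squareParam, Fin.mk_one, Matrix.cons_val_one, Matrix.cons_val_zero]
    -- `u (1 - v) - u' (1 - v') = (u - u') (1 - v') - u (v - v')`
    have e1 : |((gridPoint n i : ℝ) - gridPoint n i') * (1 - gridPoint n j')| ≤ 1 / 100 * 1 := by
      rw [abs_mul]
      exact mul_le_mul (key hi) (abs_le.2 ⟨by linarith, by linarith⟩) (abs_nonneg _) (by norm_num)
    have e2 : |(gridPoint n i : ℝ) * (gridPoint n j - gridPoint n j')| ≤ 1 * (1 / 100) := by
      rw [abs_mul]
      exact mul_le_mul (abs_le.2 ⟨by linarith, by linarith⟩) (key hj) (abs_nonneg _) (by norm_num)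
    have e1 := abs_le.1 e1
    have e2 := abs_le.1 e2
    exact abs_le.2 ⟨by linarith, by linarith⟩
  · exact absurd rfl hk

open Classical in
/-- A contractible `|Q|` consists of infinitely many triangles: a closed surface has a nonzero
class in its second cohomology modulo 2, which is constructed here in the manner of Alexander and
Spanier. One triangle is cut into three labelled regions that meet at its barycentre, and `φ` counts
the triples of points near the barycentre with distinct labels. A contraction makes `φ` the
coboundary of a function `ψ` on pairs of close points. If there are finitely many triangles, the
sum of `φ` over fine subdivisions of all of them vanishes, as every side occurs twice; but it
is the number of subdivision triangles with distinct labels, which is odd by Sperner's lemma. -/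
theorem infinite_total [ContractibleSpace Q.Realization] : Infinite (Quiver.Total V) := by
  by_contra hinf
  have hfin : Finite (Quiver.Total V) := not_infinite_iff_finite.1 hinf
  have := Fintype.ofFinite (Quiver.Total V)
  obtain ⟨a₀⟩ := Q.nonempty_total
  have hsum : ∀ x : stdSimplex ℝ (Fin 3), x.1 0 + x.1 1 + x.1 2 = 1 := fun x => by
    have := x.2.2
    rwa [Fin.sum_univ_three] at this
  have hc : ∀ i : Fin 3, Continuous fun x : stdSimplex ℝ (Fin 3) => x.1 i := fun i =>
    (continuous_apply i).comp continuous_subtype_val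
  -- labels near the barycenter of one triangle
  set w := Q.bump (true, a₀) (fun _ => 1) with hw
  set b₀ := Q.bump (true, a₀) (fun x => x.1 0) with hb₀
  set b₁ := Q.bump (true, a₀) (fun x => x.1 1) with hb₁
  have cw : Continuous w := Q.continuous_bump _ continuous_const
  have cb₀ : Continuous b₀ := Q.continuous_bump _ (hc 0)
  have cb₁ : Continuous b₁ := Q.continuous_bump _ (hc 1)
  let K : Set Q.Realization := {x | 1 / 100 ≤ w x}
  let lab : Q.Realization → Fin 3 := fun x =>
    if w x / 3 < b₀ x then 0 else if w x / 3 < b₁ x then 1 else 2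
  let R : Fin 3 → Set Q.Realization :=
    ![{x | w x / 3 ≤ b₀ x}, {x | w x / 3 ≤ b₁ x}, {x | b₀ x ≤ w x / 3 ∧ b₁ x ≤ w x / 3}]
  have hlab : ∀ x, x ∈ R (lab x) := by
    intro x
    by_cases h0 : w x / 3 < b₀ x
    · simp only [lab, h0, if_true]
      exact h0.le
    · by_cases h1 : w x / 3 < b₁ x
      · simp only [lab, h0, h1, if_true, if_false]
        exact h1.le
      · simp only [lab, h0, h1, if_false]
        exact ⟨not_lt.1 h0, not_lt.1 h1⟩
  have hR : ∀ i, IsClosed (R i) := by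
    intro i
    fin_cases i
    · exact isClosed_le (cw.div_const 3) cb₀
    · exact isClosed_le (cw.div_const 3) cb₁
    · exact (isClosed_le cb₀ (cw.div_const 3)).inter (isClosed_le cb₁ (cw.div_const 3))
  let φ := labelCount lab K
  -- open sets on which `φ` is a cocycle
  let U : Option (Fin 3) → Set Q.Realization := fun o =>
    o.elim {x | 1 / 100 < w x} fun i => {x | w x < 1 / 100} ∪ (R i)ᶜ
  have hUo : ∀ o, IsOpen (U o) := by
    rintro (_ | i)
    · exact isOpen_lt continuous_const cw
    · exact (isOpen_lt cw continuous_const).union (hR i).isOpen_compl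
  have hUφ : ∀ o, ∀ p ∈ U o, ∀ q ∈ U o, ∀ r ∈ U o, ∀ t ∈ U o,
      φ q r t + φ p r t + φ p q t + φ p q r = 0 := by
    rintro (_ | i) p hp q hq r hr t ht
    · have key : ∀ x ∈ U none, x ∈ K := fun x hx => le_of_lt (show 1 / 100 < w x from hx)
      exact labelCount_cocycle_of_mem (key _ hp) (key _ hq) (key _ hr) (key _ ht)
    · have key : ∀ x ∈ U (some i), x ∈ K → lab x ≠ i := by
        rintro x (h | h) hK rfl
        · exact absurd (show 1 / 100 ≤ w x from hK) (not_le.2 h)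
        · exact h (hlab x)
      simp only [φ]
      rw [labelCount_eq_zero i (key _ hq) (key _ hr) (key _ ht),
        labelCount_eq_zero i (key _ hp) (key _ hr) (key _ ht),
        labelCount_eq_zero i (key _ hp) (key _ hq) (key _ ht),
        labelCount_eq_zero i (key _ hp) (key _ hq) (key _ hr)]
      decide
  have hUc : ∀ x, ∃ o, x ∈ U o := by
    intro x
    by_contra! h
    have h1 : w x ≤ 1 / 100 := not_lt.1 (h none)
    have h2 : ∀ i, 1 / 100 ≤ w x ∧ x ∈ R i := fun i => by
      have := h (some i)
      simp only [U, Option.elim, Set.mem_union, Set.mem_compl_iff, not_or, not_not] at this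
      exact ⟨not_lt.1 this.1, this.2⟩
    obtain ⟨⟨⟨s, a⟩, y⟩, rfl⟩ := Quot.exists_rep x
    change w (Q.tri s a y) ≤ 1 / 100 at h1
    have h3 : 1 / 100 ≤ w (Q.tri s a y) := (h2 0).1
    have r0 : w (Q.tri s a y) / 3 ≤ b₀ (Q.tri s a y) := (h2 0).2
    have r1 : w (Q.tri s a y) / 3 ≤ b₁ (Q.tri s a y) := (h2 1).2
    have r2 : b₀ (Q.tri s a y) ≤ w (Q.tri s a y) / 3 ∧ b₁ (Q.tri s a y) ≤ w (Q.tri s a y) / 3 :=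
      (h2 2).2
    by_cases hτ : (s, a) = (true, a₀)
    · obtain ⟨rfl, rfl⟩ := Prod.mk.inj hτ
      simp only [hw, hb₀, hb₁, bump_tri] at h1 h3 r0 r1 r2
      have hpos : 0 < y.1 0 * y.1 1 * y.1 2 := by linarith
      have e0 : y.1 0 = 1 / 3 := by
        refine mul_left_cancel₀ hpos.ne' ?_
        linarith [r2.1]
      have e1 : y.1 1 = 1 / 3 := by
        refine mul_left_cancel₀ hpos.ne' ?_
        linarith [r2.2]
      have e2 : y.1 2 = 1 / 3 := by linarith [hsum y]
      rw [e0, e1, e2] at h1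
      norm_num at h1
    · rw [hw, bump_tri_of_ne _ hτ] at h3
      norm_num at h3
  obtain ⟨x₀, ⟨H⟩⟩ := (contractible_iff_id_nullhomotopic Q.Realization).1 ‹_›
  -- a subdivision that is fine enough
  have hn : ∃ n : ℕ, 100 ≤ n ∧ ∀ τ : Bool × Quiver.Total V, ∀ z : (I × I) × I, ∃ o,
      ∀ z', dist z' z ≤ 1 / n → H (z'.2, Q.tri τ.1 τ.2 (squareParam z'.1)) ∈ U o := by
    have h1 : ∀ τ : Bool × Quiver.Total V, ∀ᶠ n : ℕ in Filter.atTop, ∀ z : (I × I) × I, ∃ o,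
        ∀ z', dist z' z ≤ 1 / n → H (z'.2, Q.tri τ.1 τ.2 (squareParam z'.1)) ∈ U o := by
      intro τ
      have hF : Continuous fun z : (I × I) × I => H (z.2, Q.tri τ.1 τ.2 (squareParam z.1)) := by
        have := continuous_squareParam
        fun_prop
      obtain ⟨δ, hδ, h⟩ := lebesgue_number_lemma_of_metric
        (isCompact_univ (X := (I × I) × I))
        (c := fun o => {z : (I × I) × I | H (z.2, Q.tri τ.1 τ.2 (squareParam z.1)) ∈ U o})
        (fun o => (hUo o).preimage hF) (fun z _ => Set.mem_iUnion.2 (hUc _))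
      filter_upwards [(tendsto_one_div_atTop_nhds_zero_nat (𝕜 := ℝ)).eventually_lt_const hδ]
        with n hn z
      obtain ⟨o, ho⟩ := h z trivial
      exact ⟨o, fun z' hz' => ho (lt_of_le_of_lt hz' hn)⟩
    have h2 := (Filter.eventually_all.2 h1).and (Filter.eventually_ge_atTop 100)
    obtain ⟨n, h3, h4⟩ := h2.exists
    exact ⟨n, h4, h3⟩
  obtain ⟨n, hn100, hn⟩ := hn
  have hn0 : 0 < n := by omega
  let P : Bool → Quiver.Total V → ℕ → ℕ → Q.Realization := fun s a i j =>
    Q.tri s a (squareParam (gridPoint n i, gridPoint n j))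
  -- `ψ` is a primitive of `φ` on the cells of the subdivision
  let Hn : ℕ → Q.Realization → Q.Realization := fun k x => H (gridPoint n k, x)
  let ψ := prism φ Hn n
  have hcell : ∀ s a i j (i₁ j₁ i₂ j₂ i₃ j₃ : ℕ), (i₁ = i ∨ i₁ = i + 1) → (j₁ = j ∨ j₁ = j + 1) →
      (i₂ = i ∨ i₂ = i + 1) → (j₂ = j ∨ j₂ = j + 1) → (i₃ = i ∨ i₃ = i + 1) →
      (j₃ = j ∨ j₃ = j + 1) → φ (P s a i₁ j₁) (P s a i₂ j₂) (P s a i₃ j₃) =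
      ψ (P s a i₂ j₂) (P s a i₃ j₃) + ψ (P s a i₁ j₁) (P s a i₃ j₃) +
        ψ (P s a i₁ j₁) (P s a i₂ j₂) := by
    intro s a i j i₁ j₁ i₂ j₂ i₃ j₃ hi₁ hj₁ hi₂ hj₂ hi₃ hj₃
    rw [← add_eq_prism φ Hn n]
    · have e0 : ∀ x, Hn 0 x = x := fun x => by simp [Hn, gridPoint_zero]
      have e1 : ∀ x, Hn n x = x₀ := fun x => by simp [Hn, gridPoint_self hn0]
      simp only [e0, e1, φ, labelCount_self_left, add_zero]
    · intro k hk p q r t hp hq hr ht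
      obtain ⟨o, ho⟩ := hn (s, a) ((gridPoint n i, gridPoint n j), gridPoint n k)
      have key : ∀ i' j' k', (i' = i ∨ i' = i + 1) → (j' = j ∨ j' = j + 1) →
          (k' = k ∨ k' = k + 1) → Hn k' (P s a i' j') ∈ U o := by
        intro i' j' k' hi hj hk
        refine ho ((gridPoint n i', gridPoint n j'), gridPoint n k') ?_
        rw [Prod.dist_eq, Prod.dist_eq]
        exact max_le (max_le (dist_gridPoint_le hi) (dist_gridPoint_le hj)) (dist_gridPoint_le hk)
      have hall : ∀ p ∈ ({Hn k (P s a i₁ j₁), Hn k (P s a i₂ j₂), Hn k (P s a i₃ j₃),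
          Hn (k + 1) (P s a i₁ j₁), Hn (k + 1) (P s a i₂ j₂), Hn (k + 1) (P s a i₃ j₃)} :
          Set Q.Realization), p ∈ U o := by
        rintro p (rfl | rfl | rfl | rfl | rfl | rfl)
        · exact key _ _ _ hi₁ hj₁ (.inl rfl)
        · exact key _ _ _ hi₂ hj₂ (.inl rfl)
        · exact key _ _ _ hi₃ hj₃ (.inl rfl)
        · exact key _ _ _ hi₁ hj₁ (.inr rfl)
        · exact key _ _ _ hi₂ hj₂ (.inr rfl)
        · exact key _ _ _ hi₃ hj₃ (.inr rfl)
      exact hUφ o _ (hall _ hp) _ (hall _ hq) _ (hall _ hr) _ (hall _ ht)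
  -- the sum over a subdivided triangle, by Stokes' formula, is the sum of `ψ` over its sides
  let S : Bool → Quiver.Total V → ZMod 2 := fun s a =>
    ∑ i ∈ Finset.range n, ∑ j ∈ Finset.range n,
      (φ (P s a i j) (P s a (i + 1) j) (P s a (i + 1) (j + 1)) +
        φ (P s a i j) (P s a i (j + 1)) (P s a (i + 1) (j + 1)))
  let h : Bool → Quiver.Total V → ℕ → ℕ → ZMod 2 := fun s a i j => ψ (P s a i j) (P s a (i + 1) j)
  have two : (2 : ZMod 2) = 0 := by decide
  have hself : ∀ x, ψ x x = 0 := fun x => by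
    simp only [ψ, prism, φ, labelCount_self_left, labelCount_self_right, add_zero,
      Finset.sum_const_zero]
  have hspoke : ∀ s a j, P s a n j = P s (Q.next s a) j n := by
    intro s a j
    refine Quot.sound (.spoke s a _ _ ?_ ?_ ?_ ?_) <;>
      simp [squareParam, gridPoint_self hn0]
  have hS : ∀ s a, S s a = ∑ i ∈ Finset.range n, h s a i 0 +
      (∑ i ∈ Finset.range n, h s a i n + ∑ i ∈ Finset.range n, h s (Q.next s a) i n) := by
    intro s a
    have e : ∀ i j, φ (P s a i j) (P s a (i + 1) j) (P s a (i + 1) (j + 1)) +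
        φ (P s a i j) (P s a i (j + 1)) (P s a (i + 1) (j + 1)) =
        (h s a i j + h s a i (j + 1)) + (ψ (P s a i j) (P s a i (j + 1)) +
          ψ (P s a (i + 1) j) (P s a (i + 1) (j + 1))) := fun i j => by
      rw [hcell s a i j, hcell s a i j]
      · linear_combination ψ (P s a i j) (P s a (i + 1) (j + 1)) * two
      all_goals simp
    simp only [S, e]
    rw [sum_grid n (h s a) (fun i j => ψ (P s a i j) (P s a i (j + 1)))]
    have e0 : ∀ j, P s a 0 j = P s a 0 (j + 1) := fun j => by
      simp only [P]
      congr 1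
      ext k
      fin_cases k <;> simp [squareParam, gridPoint_zero]
    have e1 : ∀ j, ψ (P s a 0 j) (P s a 0 (j + 1)) = 0 := fun j => by rw [← e0, hself]
    simp only [e1, zero_add, Finset.sum_add_distrib, hspoke, h]
    ring
  have hedge : ∀ a i, h true a i 0 = h false a i 0 := by
    intro a i
    have e : ∀ i, P true a i 0 = P false a i 0 := fun i => by
      refine Quot.sound (.edge a _ ?_)
      simp [squareParam, gridPoint_zero]
    simp only [h, e]
  have htotal : ∑ a, S true a + ∑ a, S false a = 0 := by
    simp only [hS, Finset.sum_add_distrib, hedge]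
    have e : ∀ s, ∑ a, ∑ i ∈ Finset.range n, h s (Q.next s a) i n =
      ∑ a, ∑ i ∈ Finset.range n, h s a i n := fun s =>
        Equiv.sum_comp (Q.next s) fun a => ∑ i ∈ Finset.range n, h s a i n
    rw [e, e]
    linear_combination (∑ a, ∑ i ∈ Finset.range n, h true a i n +
      ∑ a, ∑ i ∈ Finset.range n, h false a i n + ∑ a, ∑ i ∈ Finset.range n, h false a i 0) * two
  -- only the triangle of the labels contributes
  have hS0 : ∀ s a, (s, a) ≠ (true, a₀) → S s a = 0 := by
    intro s a hne
    have : ∀ i j i' j' i'' j'', φ (P s a i j) (P s a i' j') (P s a i'' j'') = 0 := by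
      intro i j i' j' i'' j''
      refine if_neg fun hK => ?_
      have : (1 : ℝ) / 100 ≤ w (P s a i j) := hK.1
      rw [hw, bump_tri_of_ne _ hne] at this
      norm_num at this
    simp only [S, this, add_zero, Finset.sum_const_zero]
  have hS1 : S true a₀ = 1 := by
    rw [← sum_rainbow_grid hn0]
    have hwP : ∀ x, w (Q.tri true a₀ x) = x.1 0 * x.1 1 * x.1 2 := fun x => by
      rw [hw, bump_tri, mul_one]
    have hl : ∀ x, Q.tri true a₀ x ∈ K → lab (Q.tri true a₀ x) = cornerLabel x := by
      intro x hx
      have hx : 1 / 100 ≤ w (Q.tri true a₀ x) := hx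
      have key : ∀ i, w (Q.tri true a₀ x) / 3 < x.1 0 * x.1 1 * x.1 2 * x.1 i ↔ 1 / 3 < x.1 i := by
        intro i
        rw [hwP] at hx ⊢
        rw [div_eq_mul_one_div, mul_lt_mul_iff_right₀ (by linarith)]
      simp only [lab, cornerLabel, hb₀, hb₁, bump_tri, key]
    have hphi : ∀ i j (i₁ j₁ i₂ j₂ i₃ j₃ : ℕ), (i₁ = i ∨ i₁ = i + 1) → (j₁ = j ∨ j₁ = j + 1) →
        (i₂ = i ∨ i₂ = i + 1) → (j₂ = j ∨ j₂ = j + 1) → (i₃ = i ∨ i₃ = i + 1) →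
        (j₃ = j ∨ j₃ = j + 1) → φ (P true a₀ i₁ j₁) (P true a₀ i₂ j₂) (P true a₀ i₃ j₃) =
        rainbow (cornerLabel (squareParam (gridPoint n i₁, gridPoint n j₁)))
          (cornerLabel (squareParam (gridPoint n i₂, gridPoint n j₂)))
          (cornerLabel (squareParam (gridPoint n i₃, gridPoint n j₃))) := by
      intro i j i₁ j₁ i₂ j₂ i₃ j₃ hi₁ hj₁ hi₂ hj₂ hi₃ hj₃
      by_cases hK : P true a₀ i₁ j₁ ∈ K ∧ P true a₀ i₂ j₂ ∈ K ∧ P true a₀ i₃ j₃ ∈ K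
      · simp only [φ, labelCount, if_pos hK]
        rw [hl _ hK.1, hl _ hK.2.1, hl _ hK.2.2]
      · simp only [φ, labelCount, if_neg hK]
        by_contra hne
        have key : ∀ i' j', (i' = i ∨ i' = i + 1) → (j' = j ∨ j' = j + 1) →
            P true a₀ i' j' ∈ K := by
          intro i' j' hi' hj'
          have := le_mul_of_rainbow (S := {p | ∃ i' j', (i' = i ∨ i' = i + 1) ∧
            (j' = j ∨ j' = j + 1) ∧ p = squareParam (gridPoint n i', gridPoint n j')}) (by
              rintro _ ⟨i₁, j₁, hi₁, hj₁, rfl⟩ _ ⟨i₂, j₂, hi₂, hj₂, rfl⟩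
              exact abs_squareParam_sub_le hn100 (by omega) (by omega))
            ⟨_, _, hi₁, hj₁, rfl⟩ ⟨_, _, hi₂, hj₂, rfl⟩ ⟨_, _, hi₃, hj₃, rfl⟩ (Ne.symm hne)
            ⟨_, _, hi', hj', rfl⟩
          rwa [← hwP] at this
        exact hK ⟨key _ _ hi₁ hj₁, key _ _ hi₂ hj₂, key _ _ hi₃ hj₃⟩
    simp only [S]
    refine Finset.sum_congr rfl fun i _ => Finset.sum_congr rfl fun j _ => ?_
    rw [hphi i j, hphi i j]
    all_goals simp
  rw [Finset.sum_eq_single a₀ (fun a _ h => hS0 true a fun e => h (congrArg Prod.snd e))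
    (by simp), hS1, Finset.sum_eq_zero fun a _ => hS0 false a (by simp)] at htotal
  exact absurd htotal (by decide)

end Infinite

/-! ### Strands -/

/-- One step along a zigzag path, as a permutation of the arrows with a sign: the sign is the one of
the next cycle to be followed. -/
def strand : Equiv.Perm (Quiver.Total V × Bool) where
  toFun σ := (Q.next σ.2 σ.1, !σ.2)
  invFun σ := ((Q.next (!σ.2)).symm σ.1, !σ.2)
  left_inv σ := by simp
  right_inv σ := by simp

theorem strand_apply (a : Quiver.Total V) (s : Bool) : Q.strand (a, s) = (Q.next s a, !s) := rfl

theorem strand_pow_succ (n : ℕ) (σ : Quiver.Total V × Bool) :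
    (Q.strand ^ (n + 1)) σ = Q.strand ((Q.strand ^ n) σ) := by
  rw [pow_succ', Equiv.Perm.mul_apply]

theorem strand_pow_succ' (n : ℕ) (σ : Quiver.Total V × Bool) :
    (Q.strand ^ (n + 1)) σ = (Q.strand ^ n) (Q.strand σ) := by
  rw [pow_succ, Equiv.Perm.mul_apply]

theorem strand_pow_add (m n : ℕ) (σ : Quiver.Total V × Bool) :
    (Q.strand ^ (m + n)) σ = (Q.strand ^ m) ((Q.strand ^ n) σ) := by
  rw [pow_add, Equiv.Perm.mul_apply]

theorem ray_eq (s : Bool) (a : Quiver.Total V) (n : ℕ) :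
    Q.ray s a n = ((Q.strand ^ n) (a, s)).1 := by
  induction n generalizing s a with
  | zero => rfl
  | succ n ih => rw [strand_pow_succ', ray, ih]; rfl

theorem snd_strand_pow_two_mul (n : ℕ) (σ : Quiver.Total V × Bool) :
    ((Q.strand ^ (2 * n)) σ).2 = σ.2 := by
  induction n with
  | zero => rfl
  | succ n ih =>
    rw [mul_add, mul_one, strand_pow_succ, strand_pow_succ]
    change (!!((Q.strand ^ (2 * n)) σ).2) = σ.2
    rw [ih, Bool.not_not]

theorem isPath_strand (σ : Quiver.Total V × Bool) (n : ℕ) :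
    IsPath σ.1.left ((List.range n).map fun i => ((Q.strand ^ i) σ).1)
      ((Q.strand ^ n) σ).1.left := by
  induction n with
  | zero => rfl
  | succ n ih =>
    rw [List.range_succ, List.map_append]
    refine ih.append ⟨rfl, ?_⟩
    rw [strand_pow_succ]
    exact (Q.left_next _ _).symm

/-- The zig ray and the zag ray of an arrow `a` only meet in `a`. -/
def RaysDisjoint : Prop := ∀ (a : Quiver.Total V) (s : Bool) (i j : ℕ), 0 < i → 0 < j →
  ((Q.strand ^ i) (a, s)).1 ≠ ((Q.strand ^ j) (a, !s)).1

theorem raysDisjoint_iff : Q.RaysDisjoint ↔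
    ∀ (a : Quiver.Total V) (i j : ℕ), 0 < i → 0 < j → Q.ray true a i ≠ Q.ray false a j := by
  simp only [ray_eq]
  constructor
  · exact fun h a i j hi hj => h a true i j hi hj
  · rintro h a (_ | _) i j hi hj
    · exact (h a j i hj hi).symm
    · exact h a i j hi hj

/-! ### Sums along cycles -/

theorem sum_map_sub {X : Type*} (l : List X) (f g : X → ℤ) :
    (l.map fun x => f x - g x).sum = (l.map f).sum - (l.map g).sum := by
  induction l with
  | nil => rfl
  | cons x l ih => simp only [List.map_cons, List.sum_cons, ih]; ring

theorem sum_cyc_next {M : Type*} [AddCommMonoid M] (f : Quiver.Total V → M) (s : Bool)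
    (a : Quiver.Total V) :
    ((Q.cyc s a).map fun x => f (Q.next s x)).sum = ((Q.cyc s a).map f).sum := by
  have h := Q.two_lt s a
  obtain ⟨n, hn⟩ := Nat.exists_eq_add_of_lt h
  have e := Q.pow_length s a
  rw [cyc_eq, List.map_map, List.map_map, hn, List.range_succ_eq_map, ← List.range_succ_eq_map]
  conv_lhs => rw [List.range_succ]
  conv_rhs => rw [List.range_succ_eq_map]
  simp only [List.map_append, List.map_cons, List.map_nil, List.sum_append, List.sum_cons,
    List.sum_nil, add_zero, List.map_map, Function.comp_def, ← Equiv.Perm.mul_apply, ← pow_succ']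
  rw [hn] at e
  rw [e, add_comm]
  rfl

open Classical in
theorem sum_cyc_ite (s : Bool) (a b : Quiver.Total V) :
    ((Q.cyc s a).map fun x => if x = b then (1 : ℤ) else 0).sum =
      if b ∈ Q.cyc s a then 1 else 0 := by
  have key : ∀ l : List (Quiver.Total V),
      (l.map fun x => if x = b then (1 : ℤ) else 0).sum = mult l b := fun l => by
    induction l with
    | nil => rfl
    | cons c l ih => rw [List.map_cons, List.sum_cons, ih, mult_cons, Finsupp.add_apply,
        Finsupp.single_apply]
  rw [key]
  split_ifs with h
  · exact mult_eq_one (Q.nodup_cyc s a) h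
  · exact mult_eq_zero.2 h

theorem isPath_range_left (s : Bool) (a : Quiver.Total V) (n : ℕ) :
    IsPath a.left ((List.range n).map fun i => (Q.next s ^ i) a) ((Q.next s ^ n) a).left := by
  induction n with
  | zero => rfl
  | succ n ih =>
    rw [List.range_succ, List.map_append]
    refine ih.append ⟨rfl, ?_⟩
    rw [pow_succ', Equiv.Perm.mul_apply, Q.left_next]
    rfl

theorem pow_next_inj (s : Bool) (a : Quiver.Total V) {i j : ℕ} (hi : i < Q.length s a)
    (hj : j < Q.length s a) (h : (Q.next s ^ i) a = (Q.next s ^ j) a) : i = j := by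
  rw [Equiv.Perm.coe_pow, Equiv.Perm.coe_pow] at h
  exact Function.iterate_injOn_Iio_minimalPeriod hi hj h

/-! ### Crossing numbers with a ray -/

section Rays

open Classical

/-- The indicator function of the ray starting at `σ`. -/
noncomputable def onRay (σ τ : Quiver.Total V × Bool) : ℤ :=
  if ∃ i : ℕ, (Q.strand ^ i) σ = τ then 1 else 0

theorem onRay_strand {σ : Quiver.Total V × Bool} (h : ∀ i : ℕ, (Q.strand ^ (i + 1)) σ ≠ σ)
    (τ : Quiver.Total V × Bool) :
    Q.onRay σ (Q.strand τ) = Q.onRay σ τ + if Q.strand τ = σ then 1 else 0 := by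
  by_cases hτ : Q.strand τ = σ
  · have h1 : ¬ ∃ i : ℕ, (Q.strand ^ i) σ = τ := by
      rintro ⟨i, hi⟩
      exact h i (by rw [strand_pow_succ, hi, hτ])
    rw [onRay, onRay, if_pos ⟨0, hτ.symm⟩, if_neg h1, if_pos hτ, zero_add]
  · have h1 : (∃ i : ℕ, (Q.strand ^ i) σ = Q.strand τ) ↔ ∃ i : ℕ, (Q.strand ^ i) σ = τ := by
      constructor
      · rintro ⟨_ | i, hi⟩
        · exact absurd hi.symm hτ
        · exact ⟨i, Q.strand.injective (by rw [← strand_pow_succ, hi])⟩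
      · rintro ⟨i, hi⟩
        exact ⟨i + 1, by rw [strand_pow_succ, hi]⟩
    simp only [onRay, h1, hτ, if_false, add_zero]

/-- The signed number of passages of the ray starting at `σ` through the arrow `x`. -/
noncomputable def rayDiff (s : Bool) (σ : Quiver.Total V × Bool) (x : Quiver.Total V) : ℤ :=
  Q.onRay σ (x, s) - Q.onRay σ (x, !s)

theorem rayDiff_not (s : Bool) (σ : Quiver.Total V × Bool) (x : Quiver.Total V) :
    Q.rayDiff (!s) σ x = - Q.rayDiff s σ x := by
  rw [rayDiff, rayDiff, Bool.not_not, neg_sub]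

theorem rayDiff_next {σ : Quiver.Total V × Bool} (h : ∀ i : ℕ, (Q.strand ^ (i + 1)) σ ≠ σ)
    (s : Bool) (x : Quiver.Total V) :
    Q.rayDiff s σ (Q.next s x) = Q.onRay σ (Q.next s x, s) - Q.onRay σ (x, s) -
      if (Q.next s x, !s) = σ then 1 else 0 := by
  have := Q.onRay_strand h (x, s)
  rw [strand_apply] at this
  rw [rayDiff, this]
  ring

/-- A ray that passes through a polygon enters and leaves it, so only its starting point contributes
to the sum along a cycle. -/
theorem sum_cyc_rayDiff {σ : Quiver.Total V × Bool} (h : ∀ i : ℕ, (Q.strand ^ (i + 1)) σ ≠ σ)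
    (s : Bool) (a : Quiver.Total V) :
    ((Q.cyc s a).map (Q.rayDiff s σ)).sum = - if σ.2 = !s ∧ σ.1 ∈ Q.cyc s a then 1 else 0 := by
  rw [← sum_cyc_next]
  simp only [Q.rayDiff_next h]
  rw [sum_map_sub, sum_map_sub, Q.sum_cyc_next (fun x => Q.onRay σ (x, s)), sub_self, zero_sub,
    Q.sum_cyc_next (fun x => if (x, !s) = σ then (1 : ℤ) else 0)]
  congr 1
  by_cases hs : σ.2 = !s
  · rw [← hs]
    simp only [true_and, ← Q.sum_cyc_ite s a σ.1]
    congr 1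
    refine List.map_congr_left fun x _ => ?_
    simp [Prod.ext_iff]
  · simp [Prod.ext_iff, hs, Ne.symm hs]

theorem rayDiff_eq_zero {s : Bool} {σ : Quiver.Total V × Bool} {x : Quiver.Total V}
    (h : ∀ i : ℕ, ((Q.strand ^ i) σ).1 ≠ x) : Q.rayDiff s σ x = 0 := by
  have : ∀ t, Q.onRay σ (x, t) = 0 := fun t => if_neg (by
    rintro ⟨i, hi⟩
    exact h i (by rw [hi]))
  rw [rayDiff, this, this, sub_zero]

theorem onRay_pow (σ : Quiver.Total V × Bool) (i : ℕ) : Q.onRay σ ((Q.strand ^ i) σ) = 1 :=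
  if_pos ⟨i, rfl⟩

variable {Q}

theorem RaysDisjoint.pow_ne_flip (hZ : Q.RaysDisjoint) (a : Quiver.Total V) (s : Bool) (n : ℕ) :
    (Q.strand ^ n) (a, s) ≠ (a, !s) := by
  intro h
  refine hZ a s (n + 1) 1 (by omega) (by omega) ?_
  rw [strand_pow_succ, h]
  rfl

theorem RaysDisjoint.eq_of_fst_eq (hZ : Q.RaysDisjoint) {σ : Quiver.Total V × Bool} {n : ℕ}
    (h : ((Q.strand ^ n) σ).1 = σ.1) : (Q.strand ^ n) σ = σ := by
  obtain ⟨a, s⟩ := σ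
  by_contra hne
  refine hZ.pow_ne_flip a s n (Prod.ext h ?_)
  have : ((Q.strand ^ n) (a, s)).2 ≠ s := fun h' => hne (Prod.ext h h')
  cases s <;> simpa using this

/-- The function `rayDiff` of the ray that starts at the head of `e`, minus the one of the ray that
starts at `e`, with the two rays joined at the corner from `e` to `next s e`, has vanishing sums
along closed paths. -/
theorem sum_join_eq_zero [ContractibleSpace Q.Realization] {e : Quiver.Total V} {s : Bool}
    (h1 : ∀ i : ℕ, (Q.strand ^ (i + 1)) (Q.next s e, s) ≠ (Q.next s e, s))
    (h2 : ∀ i : ℕ, (Q.strand ^ (i + 1)) (e, !s) ≠ (e, !s)) {x : V} {l : List (Quiver.Total V)}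
    (hl : IsPath x l x) :
    (l.map fun x => Q.rayDiff s (Q.next s e, s) x - Q.rayDiff s (e, !s) x -
      if x = Q.next s e then 1 else 0).sum = 0 := by
  obtain ⟨D, hD⟩ := Q.exists_vertex_addPotential (fun x => Q.rayDiff s (Q.next s e, s) x -
    Q.rayDiff s (e, !s) x - if x = Q.next s e then (1 : ℤ) else 0) (by
      intro t a
      rw [sum_map_sub, sum_map_sub, sum_cyc_ite]
      by_cases hts : t = s
      · subst hts
        rw [Q.sum_cyc_rayDiff h1, Q.sum_cyc_rayDiff h2]
        have : Q.next t e ∈ Q.cyc t a ↔ e ∈ Q.cyc t a := by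
          rw [mem_cyc, mem_cyc, Equiv.Perm.sameCycle_apply_right]
        simp [this]
      · obtain rfl : t = !s := by cases s <;> cases t <;> simp_all
        have e1 : ∀ σ x, Q.rayDiff s σ x = - Q.rayDiff (!s) σ x := fun σ x => by
          rw [rayDiff_not, neg_neg]
        have e2 : ∀ σ, ((Q.cyc (!s) a).map (Q.rayDiff s σ)).sum =
            - ((Q.cyc (!s) a).map (Q.rayDiff (!s) σ)).sum := fun σ => by
          rw [List.sum_neg, List.map_map]
          congr 1
          exact List.map_congr_left fun x _ => e1 σ x
        rw [e2, e2, Q.sum_cyc_rayDiff h1, Q.sum_cyc_rayDiff h2]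
        simp)
  have := hD x l x hl
  linarith

/-- If rays are disjoint, there are no closed strands. Otherwise take a shortest one, starting at
`a`. The zag ray of `a` and the ray of `next s a` away from the strand do not meet the strand again,
so joined at the corner between `a` and `next s a` they form a curve that crosses the strand exactly
once, in contradiction to `sum_join_eq_zero`. -/
theorem RaysDisjoint.strand_pow_ne [ContractibleSpace Q.Realization] (hZ : Q.RaysDisjoint)
    (σ : Quiver.Total V × Bool) {n : ℕ} (hn : 0 < n) : (Q.strand ^ n) σ ≠ σ := by
  intro hcl
  have hex : ∃ n, 0 < n ∧ (Q.strand ^ n) σ = σ := ⟨n, hn, hcl⟩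
  clear hn hcl
  obtain ⟨hn, hcl⟩ := Nat.find_spec hex
  have hmin : ∀ k, 0 < k → (Q.strand ^ k) σ = σ → Nat.find hex ≤ k := fun k h h' =>
    Nat.find_min' hex ⟨h, h'⟩
  generalize Nat.find hex = n at *
  clear hex
  obtain ⟨a, s⟩ := σ
  have hn2 : 2 ≤ n := by
    by_contra h
    obtain rfl : n = 1 := by omega
    have := congrArg Prod.snd hcl
    simp [strand] at this
  have hz1 : ∀ i, (Q.strand ^ i) (Q.next s a, !s) = (Q.strand ^ (i + 1)) (a, s) := fun i => by
    rw [strand_pow_succ']; rfl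
  -- the ray of `a` and the ray of `next s a` in the other directions do not meet the strand
  have r2 : ∀ i k, 0 < k → ((Q.strand ^ (i + 1)) (a, !s)).1 ≠ ((Q.strand ^ k) (a, s)).1 :=
    fun i k hk => (hZ a s k (i + 1) hk (by omega)).symm
  have r1 : ∀ i k, 1 < k → ((Q.strand ^ (i + 1)) (Q.next s a, s)).1 ≠
      ((Q.strand ^ k) (a, s)).1 := fun i k hk => by
    have := hZ (Q.next s a) s (i + 1) (k - 1) (by omega) (by omega)
    rwa [hz1, Nat.sub_add_cancel (by omega)] at this
  have hper : ∀ k, (Q.strand ^ (n + k)) (a, s) = (Q.strand ^ k) (a, s) := fun k => by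
    rw [add_comm, strand_pow_add, hcl]
  have r2' : ∀ i k, ((Q.strand ^ (i + 1)) (a, !s)).1 ≠ ((Q.strand ^ k) (a, s)).1 :=
    fun i k => by rw [← hper]; exact r2 i _ (by omega)
  have r1' : ∀ i k, ((Q.strand ^ (i + 1)) (Q.next s a, s)).1 ≠ ((Q.strand ^ k) (a, s)).1 :=
    fun i k => by rw [← hper]; exact r1 i _ (by omega)
  have hdist : ∀ k l, k < n → l < n → ((Q.strand ^ k) (a, s)).1 = ((Q.strand ^ l) (a, s)).1 →
      k = l := by
    intro k l hk hl h
    wlog hkl : k ≤ l generalizing k l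
    · exact (this l k hl hk h.symm (by omega)).symm
    obtain ⟨d, rfl⟩ := Nat.exists_eq_add_of_le hkl
    have h1 := hZ.eq_of_fst_eq (σ := (Q.strand ^ k) (a, s)) (n := d) (by
      rw [← strand_pow_add, add_comm, ← h])
    rw [← strand_pow_add, add_comm, strand_pow_add] at h1
    have h2 := (Q.strand ^ k).injective h1
    by_contra hd
    have := hmin d (by omega) h2
    omega
  have hsum := sum_join_eq_zero (e := a) (s := s) (fun i h => r1' i 1 (by rw [h]; rfl))
    (fun i h => r2' i 0 (by rw [h]; rfl)) (x := a.left) (l := (List.range n).map fun i =>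
      ((Q.strand ^ i) (a, s)).1) (by
        have := Q.isPath_strand (a, s) n
        rwa [hcl] at this)
  have hval : ∀ k ∈ List.range n, (Q.rayDiff s (Q.next s a, s) ((Q.strand ^ k) (a, s)).1 -
      Q.rayDiff s (a, !s) ((Q.strand ^ k) (a, s)).1 -
      if ((Q.strand ^ k) (a, s)).1 = Q.next s a then 1 else 0) = if k = 0 then 1 else 0 := by
    intro k hk
    have hk := List.mem_range.1 hk
    have e2 : Q.rayDiff s (a, !s) ((Q.strand ^ k) (a, s)).1 = if k = 0 then -1 else 0 := by
      split_ifs with h0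
      · subst h0
        have i1 : Q.onRay (a, !s) (a, !s) = 1 := Q.onRay_pow _ 0
        have i2 : Q.onRay (a, !s) (a, s) = 0 := if_neg (by
          rintro ⟨i, hi⟩
          have := hZ.pow_ne_flip a (!s) i
          rw [Bool.not_not] at this
          exact this hi)
        change Q.onRay (a, !s) (a, s) - Q.onRay (a, !s) (a, !s) = -1
        rw [i1, i2]; rfl
      · refine Q.rayDiff_eq_zero ?_
        rintro (_ | i)
        · exact fun h => h0 (hdist 0 k (by omega) hk h).symm
        · exact r2' i k
    have e1 : Q.rayDiff s (Q.next s a, s) ((Q.strand ^ k) (a, s)).1 = if k = 1 then 1 else 0 := by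
      split_ifs with h0
      · subst h0
        have i1 : Q.onRay (Q.next s a, s) (Q.next s a, s) = 1 := Q.onRay_pow _ 0
        have i2 : Q.onRay (Q.next s a, s) (Q.next s a, !s) = 0 := if_neg (by
          rintro ⟨i, hi⟩
          exact hZ.pow_ne_flip _ s i hi)
        change Q.onRay (Q.next s a, s) (Q.next s a, s) -
          Q.onRay (Q.next s a, s) (Q.next s a, !s) = 1
        rw [i1, i2]; rfl
      · refine Q.rayDiff_eq_zero ?_
        rintro (_ | i)
        · exact fun h => h0 (hdist 1 k (by omega) hk h).symm
        · exact r1' i k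
    have e3 : ((Q.strand ^ k) (a, s)).1 = Q.next s a ↔ k = 1 :=
      ⟨fun h => hdist k 1 hk (by omega) h, fun h => by rw [h]; rfl⟩
    rw [e1, e2]
    simp only [e3]
    split_ifs <;> omega
  simp only [List.map_map, Function.comp_def] at hsum
  rw [List.map_congr_left (g := fun k => if k = 0 then (1 : ℤ) else 0) hval] at hsum
  obtain ⟨m, rfl⟩ := Nat.exists_eq_add_of_le' hn
  rw [List.range_succ_eq_map] at hsum
  simp [Function.comp_def] at hsum

theorem RaysDisjoint.strand_fst_inj [ContractibleSpace Q.Realization] (hZ : Q.RaysDisjoint)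
    (σ : Quiver.Total V × Bool) {i j : ℕ} (h : ((Q.strand ^ i) σ).1 = ((Q.strand ^ j) σ).1) :
    i = j := by
  wlog hij : i ≤ j generalizing i j
  · exact (this h.symm (by omega)).symm
  obtain ⟨d, rfl⟩ := Nat.exists_eq_add_of_le hij
  by_contra hd
  rw [add_comm, strand_pow_add] at h
  exact hZ.strand_pow_ne _ (n := d) (by omega) (hZ.eq_of_fst_eq h.symm)

/-- If rays are disjoint, a ray leaves the first polygon that it passes through for ever. Otherwise,
the strand from `next s e` until its return, closed up along the polygon, crosses the curve of
`sum_join_eq_zero` exactly once. -/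
theorem RaysDisjoint.strand_not_mem_cyc [ContractibleSpace Q.Realization] (hZ : Q.RaysDisjoint)
    (e : Quiver.Total V) (s : Bool) {M : ℕ} (hM : 2 ≤ M) :
    ((Q.strand ^ M) (e, s)).1 ∉ Q.cyc s e := by
  intro hmem
  have hL := Q.two_lt s e
  have hk : ∃ k, 2 ≤ k ∧ k ≤ Q.length s e ∧ ((Q.strand ^ M) (e, s)).1 = (Q.next s ^ k) e := by
    rw [cyc_eq, List.mem_map] at hmem
    obtain ⟨k, hk, hke⟩ := hmem
    rw [List.mem_range] at hk
    rcases k with _ | _ | k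
    · exact ⟨_, hL.le, le_rfl, by rw [← hke, Q.pow_length]; rfl⟩
    · have := hZ.strand_fst_inj (e, s) (i := M) (j := 1) hke.symm
      omega
    · exact ⟨k + 2, by omega, by omega, hke.symm⟩
  obtain ⟨k, hk2, hkL, hk⟩ := hk
  have hz1 : ∀ i, (Q.strand ^ i) (Q.next s e, !s) = (Q.strand ^ (i + 1)) (e, s) := fun i => by
    rw [strand_pow_succ']; rfl
  have r2 : ∀ i j, 0 < j → ((Q.strand ^ i) (e, !s)).1 ≠ ((Q.strand ^ j) (e, s)).1 := by
    rintro (_ | i) j hj h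
    · have := hZ.strand_fst_inj (e, s) (i := 0) (j := j) h
      omega
    · exact hZ e s j (i + 1) hj (by omega) h.symm
  have r1 : ∀ i j, 0 < j → ((Q.strand ^ (i + 1)) (Q.next s e, s)).1 ≠
      ((Q.strand ^ j) (e, s)).1 := by
    intro i j hj h
    obtain ⟨j, rfl⟩ := Nat.exists_eq_add_of_lt hj
    rw [zero_add, ← hz1] at h
    rcases j with _ | j
    · have := hZ.strand_fst_inj (Q.next s e, s) (i := i + 1) (j := 0) h
      omega
    · exact hZ (Q.next s e) s (i + 1) (j + 1) (by omega) (by omega) h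
  -- the closed path: from `next s e` along the strand, and then along the polygon up to `e`
  have hpath : IsPath (Q.next s e).left (((List.range (M - 1)).map fun i =>
      ((Q.strand ^ i) (Q.next s e, !s)).1) ++ ((List.range (Q.length s e - k + 1)).map fun i =>
        (Q.next s ^ i) ((Q.next s ^ k) e))) (Q.next s e).left := by
    have p1 := Q.isPath_strand (Q.next s e, !s) (M - 1)
    have p2 := Q.isPath_range_left s ((Q.next s ^ k) e) (Q.length s e - k + 1)
    rw [hz1, Nat.sub_add_cancel (by omega), hk] at p1
    rw [← Equiv.Perm.mul_apply, ← pow_add,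
      show Q.length s e - k + 1 + k = 1 + Q.length s e by omega, pow_add, Equiv.Perm.mul_apply,
      Q.pow_length, pow_one] at p2
    exact p1.append p2
  have hsum := sum_join_eq_zero (e := e) (s := s) (fun i => hZ.strand_pow_ne _ (by omega))
    (fun i => hZ.strand_pow_ne _ (by omega)) hpath
  rw [List.map_append, List.sum_append] at hsum
  have hs1 : ∀ i ∈ List.range (M - 1),
      (Q.rayDiff s (Q.next s e, s) ((Q.strand ^ i) (Q.next s e, !s)).1 -
      Q.rayDiff s (e, !s) ((Q.strand ^ i) (Q.next s e, !s)).1 -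
      if ((Q.strand ^ i) (Q.next s e, !s)).1 = Q.next s e then 1 else 0) = 0 := by
    intro i _
    have e2 : Q.rayDiff s (e, !s) ((Q.strand ^ i) (Q.next s e, !s)).1 = 0 :=
      Q.rayDiff_eq_zero fun j => by rw [hz1]; exact r2 j _ (by omega)
    have e1 : Q.rayDiff s (Q.next s e, s) ((Q.strand ^ i) (Q.next s e, !s)).1 =
        if i = 0 then 1 else 0 := by
      split_ifs with h0
      · subst h0
        have i1 : Q.onRay (Q.next s e, s) (Q.next s e, s) = 1 := Q.onRay_pow _ 0
        have i2 : Q.onRay (Q.next s e, s) (Q.next s e, !s) = 0 := if_neg (by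
          rintro ⟨i, hi⟩
          exact hZ.pow_ne_flip _ s i hi)
        change Q.onRay (Q.next s e, s) (Q.next s e, s) -
          Q.onRay (Q.next s e, s) (Q.next s e, !s) = 1
        rw [i1, i2]; rfl
      · refine Q.rayDiff_eq_zero ?_
        rintro (_ | j)
        · exact fun h => h0 (hZ.strand_fst_inj (Q.next s e, !s) (i := 0) (j := i) h).symm
        · rw [hz1]
          exact r1 j _ (by omega)
    have e3 : ((Q.strand ^ i) (Q.next s e, !s)).1 = Q.next s e ↔ i = 0 :=
      ⟨fun h => hZ.strand_fst_inj (Q.next s e, !s) (i := i) (j := 0) h, fun h => by rw [h]; rfl⟩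
    rw [e1, e2]
    simp only [e3]
    split_ifs <;> omega
  simp only [List.map_map, Function.comp_def] at hsum
  rw [List.map_congr_left (g := fun _ => (0 : ℤ)) hs1] at hsum
  simp only [List.map_const', List.sum_replicate, smul_zero, zero_add] at hsum
  -- the contribution of the polygon
  set K : ℕ → ℤ := fun i => Q.onRay (Q.next s e, s) ((Q.next s ^ i) e, s) -
    Q.onRay (e, !s) ((Q.next s ^ i) e, s) with hK
  have hs2 : ∀ i ∈ List.range (Q.length s e - k + 1),
      (Q.rayDiff s (Q.next s e, s) ((Q.next s ^ i) ((Q.next s ^ k) e)) -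
      Q.rayDiff s (e, !s) ((Q.next s ^ i) ((Q.next s ^ k) e)) -
      if (Q.next s ^ i) ((Q.next s ^ k) e) = Q.next s e then 1 else 0) =
      K (i + k) - K (i + k - 1) + if i = Q.length s e - k then 1 else 0 := by
    intro i hi
    rw [List.mem_range] at hi
    obtain ⟨m, hm⟩ : ∃ m, i + k = m + 1 := ⟨i + k - 1, by omega⟩
    rw [← Equiv.Perm.mul_apply, ← pow_add, hm, Nat.add_sub_cancel, pow_succ',
      Equiv.Perm.mul_apply, Q.rayDiff_next (fun i => hZ.strand_pow_ne _ (by omega)),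
      Q.rayDiff_next (fun i => hZ.strand_pow_ne _ (by omega))]
    have h3 : ¬ Q.next s ((Q.next s ^ m) e) = Q.next s e := by
      intro h
      have := Q.pow_next_inj s e (i := m) (j := 0) (by omega) (by omega) ((Q.next s).injective h)
      omega
    have h4 : Q.next s ((Q.next s ^ m) e) = e ↔ i = Q.length s e - k := by
      rw [← Equiv.Perm.mul_apply, ← pow_succ']
      constructor
      · intro h
        by_contra hne
        have := Q.pow_next_inj s e (i := m + 1) (j := 0) (by omega) (by omega) h
        omega
      · intro h
        rw [show m + 1 = Q.length s e by omega, Q.pow_length]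
    have h5 : ((Q.next s ((Q.next s ^ m) e), !s) = (Q.next s e, s)) = False := by simp
    have h6 : ((Q.next s ((Q.next s ^ m) e), !s) = (e, !s)) = (i = Q.length s e - k) := by
      rw [← h4]; simp
    simp only [hK, h3, h5, h6, if_false, pow_succ', Equiv.Perm.mul_apply]
    ring
  have hK0 : K (k - 1) = 0 := by
    obtain ⟨m, hm⟩ : ∃ m, k = m + 1 := ⟨k - 1, by omega⟩
    have e' : (Q.strand ((Q.next s ^ (k - 1)) e, s)).1 = ((Q.strand ^ M) (e, s)).1 := by
      rw [hk, hm, strand_apply, Nat.add_sub_cancel, pow_succ', Equiv.Perm.mul_apply]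
    have i1 : Q.onRay (Q.next s e, s) ((Q.next s ^ (k - 1)) e, s) = 0 := if_neg (by
      rintro ⟨i, hi⟩
      refine r1 i M (by omega) ?_
      rw [strand_pow_succ, hi, e'])
    have i2 : Q.onRay (e, !s) ((Q.next s ^ (k - 1)) e, s) = 0 := if_neg (by
      rintro ⟨i, hi⟩
      refine r2 (i + 1) M (by omega) ?_
      rw [strand_pow_succ, hi, e'])
    simp only [hK, i1, i2, sub_zero]
  have hKL : K (Q.length s e) = 0 := by
    have i1 : Q.onRay (Q.next s e, s) (e, s) = 0 := if_neg (by
      rintro ⟨i, hi⟩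
      refine r1 i 1 (by omega) ?_
      rw [strand_pow_succ, hi, pow_one])
    have i2 : Q.onRay (e, !s) (e, s) = 0 := if_neg (by
      rintro ⟨i, hi⟩
      have := hZ.pow_ne_flip e (!s) i
      rw [Bool.not_not] at this
      exact this hi)
    simp only [hK, Q.pow_length, i1, i2, sub_zero]
  have htel : ∀ n, ((List.range n).map fun i => K (i + k) - K (i + k - 1)).sum =
      K (n + k - 1) - K (k - 1) := by
    intro n
    induction n with
    | zero => simp
    | succ n ih =>
      rw [List.range_succ, List.map_append, List.sum_append, ih]
      simp only [List.map_cons, List.map_nil, List.sum_cons, List.sum_nil, add_zero]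
      rw [show n + 1 + k - 1 = n + k by omega]
      ring
  rw [List.map_congr_left (g := fun i => K (i + k) - K (i + k - 1) +
    if i = Q.length s e - k then 1 else 0) hs2, List.sum_map_add, htel,
    show Q.length s e - k + 1 + k - 1 = Q.length s e by omega, hK0, hKL, List.range_succ,
    List.map_append, List.sum_append] at hsum
  rw [List.map_congr_left (g := fun _ => (0 : ℤ)) (fun i hi => if_neg (by
    rw [List.mem_range] at hi; omega))] at hsum
  simp at hsum

end Rays

/-! ### The degree of a path with respect to a vertex -/

section Wedge

open Classical

theorem onRay_eq_add {σ : Quiver.Total V × Bool} (h : ∀ i : ℕ, (Q.strand ^ (i + 1)) σ ≠ σ)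
    (τ : Quiver.Total V × Bool) :
    Q.onRay σ τ = (if τ = σ then 1 else 0) + Q.onRay (Q.strand σ) τ := by
  by_cases hτ : τ = σ
  · subst hτ
    have h1 : ¬ ∃ i : ℕ, (Q.strand ^ i) (Q.strand τ) = τ := by
      rintro ⟨i, hi⟩
      exact h i (by rw [strand_pow_succ', hi])
    rw [onRay, onRay, if_pos ⟨0, rfl⟩, if_pos rfl, if_neg h1, add_zero]
  · have h1 : (∃ i : ℕ, (Q.strand ^ i) σ = τ) ↔ ∃ i : ℕ, (Q.strand ^ i) (Q.strand σ) = τ := by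
      constructor
      · rintro ⟨_ | i, hi⟩
        · exact absurd hi.symm hτ
        · exact ⟨i, by rw [← strand_pow_succ', hi]⟩
      · rintro ⟨i, hi⟩
        exact ⟨i + 1, by rw [strand_pow_succ', hi]⟩
    rw [if_neg hτ, zero_add, onRay, onRay]
    simp only [h1]

/-- The derivative of the indicator function of the region between the zig ray and the zag ray
of `a`. -/
noncomputable def wedgeDiff (a x : Quiver.Total V) : ℤ :=
  Q.rayDiff true (a, true) x - Q.rayDiff true (a, false) x - if x = a then 1 else 0

theorem wedgeDiff_eq (s : Bool) (a x : Quiver.Total V) : Q.wedgeDiff a x =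
    Q.rayDiff s (a, s) x - Q.rayDiff s (a, !s) x - if x = a then 1 else 0 := by
  cases s
  · have : ∀ σ, Q.rayDiff false σ x = - Q.rayDiff true σ x := fun σ => Q.rayDiff_not true σ x
    rw [wedgeDiff, this, this]
    simp only [Bool.not_false]
    ring
  · rfl

variable {Q}

theorem RaysDisjoint.rayDiff_pow [ContractibleSpace Q.Realization] (hZ : Q.RaysDisjoint)
    (s : Bool) (a : Quiver.Total V) (k : ℕ) :
    Q.rayDiff s (a, s) ((Q.strand ^ k) (a, s)).1 = (-1) ^ k := by
  have i1 := Q.onRay_pow (a, s) k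
  set τ := (Q.strand ^ k) (a, s) with hτ
  have i2 : Q.onRay (a, s) (τ.1, !τ.2) = 0 := if_neg (by
    rintro ⟨i, hi⟩
    have : i = k := hZ.strand_fst_inj (a, s) (by rw [hi])
    subst this
    have := congrArg Prod.snd hi
    simp [← hτ] at this)
  have h2 : Q.rayDiff τ.2 (a, s) τ.1 = 1 := by
    rw [rayDiff, i2]
    change Q.onRay (a, s) τ - 0 = 1
    rw [i1, sub_zero]
  rcases Nat.even_or_odd' k with ⟨m, rfl | rfl⟩
  · have : τ.2 = s := Q.snd_strand_pow_two_mul m (a, s)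
    rw [this] at h2
    rw [h2, pow_mul]
    simp
  · have : τ.2 = !s := by
      rw [hτ, strand_pow_succ]
      change (!((Q.strand ^ (2 * m)) (a, s)).2) = !s
      rw [snd_strand_pow_two_mul]
    rw [this, rayDiff_not] at h2
    rw [pow_succ, pow_mul]
    simp
    omega

theorem RaysDisjoint.wedgeDiff_pow [ContractibleSpace Q.Realization] (hZ : Q.RaysDisjoint)
    (s : Bool) (a : Quiver.Total V) (k : ℕ) :
    Q.wedgeDiff a ((Q.strand ^ k) (a, s)).1 = (-1) ^ k := by
  rw [Q.wedgeDiff_eq s, hZ.rayDiff_pow]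
  rcases k with _ | k
  · have h1 := hZ.rayDiff_pow (!s) a 0
    change Q.rayDiff (!s) (a, !s) a = _ at h1
    rw [rayDiff_not, pow_zero] at h1
    change (-1) ^ 0 - Q.rayDiff s (a, !s) a - (if a = a then 1 else 0) = _
    simp
    omega
  · have h1 : Q.rayDiff s (a, !s) ((Q.strand ^ (k + 1)) (a, s)).1 = 0 := by
      refine Q.rayDiff_eq_zero ?_
      rintro (_ | i) h
      · have := hZ.strand_fst_inj (a, s) (i := 0) (j := k + 1) h
        omega
      · exact hZ a s (k + 1) (i + 1) (by omega) (by omega) h.symm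
    have h2 : ((Q.strand ^ (k + 1)) (a, s)).1 ≠ a := fun h => by
      have := hZ.strand_fst_inj (a, s) (i := 0) (j := k + 1) h.symm
      omega
    rw [h1, if_neg h2]
    simp

theorem wedgeDiff_eq_zero {a x : Quiver.Total V}
    (h : ∀ s k, ((Q.strand ^ k) (a, s)).1 ≠ x) : Q.wedgeDiff a x = 0 := by
  rw [wedgeDiff, Q.rayDiff_eq_zero (h true), Q.rayDiff_eq_zero (h false),
    if_neg (fun e => h true 0 e.symm)]
  rfl

theorem RaysDisjoint.sum_cyc_wedgeDiff [ContractibleSpace Q.Realization] (hZ : Q.RaysDisjoint)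
    (s : Bool) (a b : Quiver.Total V) : ((Q.cyc s b).map (Q.wedgeDiff a)).sum = 0 := by
  have hnr : ∀ σ, ∀ i : ℕ, (Q.strand ^ (i + 1)) σ ≠ σ := fun σ i => hZ.strand_pow_ne σ (by omega)
  have : Q.wedgeDiff a = fun x =>
      Q.rayDiff s (a, s) x - Q.rayDiff s (a, !s) x - if x = a then 1 else 0 :=
    funext fun x => Q.wedgeDiff_eq s a x
  rw [this, sum_map_sub, sum_map_sub, sum_cyc_ite, Q.sum_cyc_rayDiff (hnr _),
    Q.sum_cyc_rayDiff (hnr _)]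
  simp

/-- For every arrow `a`, let `D a` be the indicator function of the region between the zig ray and
the zag ray of `a`, on the side of the head of `a`. The tails of the arrows in odd positions on the
rays are in the region, and every vertex is in the region of exactly one of the arrows of each
polygon. -/
theorem RaysDisjoint.exists_wedge [ContractibleSpace Q.Realization] (hZ : Q.RaysDisjoint) :
    ∃ D : Quiver.Total V → V → ℤ, (∀ a v, D a v = 0 ∨ D a v = 1) ∧
      (∀ a, D a a.left = 0) ∧
      (∀ s a k, D a ((Q.strand ^ (2 * k + 1)) (a, s)).1.left = 1) ∧
      ∀ v s a, ((Q.cyc s a).map fun b => D b v).sum = 1 := by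
  choose D₀ hD₀ using fun a => Q.exists_vertex_addPotential (Q.wedgeDiff a)
    (fun s b => hZ.sum_cyc_wedgeDiff s a b)
  let D : Quiver.Total V → V → ℤ := fun a v => D₀ a v - D₀ a a.left
  have hD : ∀ a e, D a e.right = D a e.left + Q.wedgeDiff a e := fun a e => by
    have := hD₀ a e.left [e] e.right ⟨rfl, rfl⟩
    simp only [List.map_cons, List.map_nil, List.sum_cons, List.sum_nil, add_zero] at this
    simp only [D, this]
    ring
  have hray : ∀ s a k, D a ((Q.strand ^ k) (a, s)).1.left = if Even k then 0 else 1 := by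
    intro s a k
    induction k with
    | zero => simp [D]
    | succ k ih =>
      have : ((Q.strand ^ (k + 1)) (a, s)).1.left = ((Q.strand ^ k) (a, s)).1.right := by
        rw [strand_pow_succ]
        exact Q.left_next _ _
      rw [this, hD, ih, hZ.wedgeDiff_pow]
      rcases Nat.even_or_odd k with h | h
      · have h' : ¬ Even (k + 1) := by rw [Nat.even_add_one]; simpa using h
        rw [if_pos h, if_neg h', h.neg_one_pow]; rfl
      · have h' : Even (k + 1) := by rw [Nat.even_add_one]; simpa using h
        rw [if_neg (Nat.not_even_iff_odd.2 h), if_pos h', h.neg_one_pow]; rfl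
  have hray' : ∀ s a k, D a ((Q.strand ^ k) (a, s)).1.right = if Even k then 1 else 0 := by
    intro s a k
    rw [hD, hray, hZ.wedgeDiff_pow]
    split_ifs with h
    · rw [h.neg_one_pow]; rfl
    · rw [(Nat.not_even_iff_odd.1 h).neg_one_pow]; rfl
  have h01 : ∀ a v, D a v = 0 ∨ D a v = 1 := by
    intro a v
    obtain ⟨l, hl⟩ := Q.exists_isPath a.left v
    have h0 : D a a.left = 0 ∨ D a a.left = 1 := by simp [D]
    generalize a.left = x at hl h0
    induction l generalizing x with
    | nil => obtain rfl := hl; exact h0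
    | cons e l ih =>
      obtain ⟨rfl, hl⟩ := hl
      refine ih _ hl ?_
      by_cases he : ∃ s k, ((Q.strand ^ k) (a, s)).1 = e
      · obtain ⟨s, k, rfl⟩ := he
        rw [hray']
        split_ifs <;> simp
      · rw [hD, wedgeDiff_eq_zero (by simpa using he), add_zero]
        exact h0
  refine ⟨D, h01, fun a => by simp [D], fun s a k => ?_, ?_⟩
  · rw [hray, if_neg (by simp)]
  -- on a polygon through `a`, only the head of `a` is in the region of `a`
  have hface : ∀ s a b, b ∈ Q.cyc s a → D a b.right = if a = b then 1 else 0 := by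
    intro s a b hb
    have hL := Q.two_lt s a
    rw [cyc_eq, List.mem_map] at hb
    obtain ⟨i, hi, rfl⟩ := hb
    rw [List.mem_range] at hi
    have hai : a = (Q.next s ^ i) a ↔ i = 0 :=
      ⟨fun h => (Q.pow_next_inj s a (i := 0) (by omega) hi h).symm, fun h => by rw [h]; rfl⟩
    simp only [hai]
    clear hai
    have h1 : D a ((Q.next s ^ 1) a).right = 0 := hray' s a 1
    induction i with
    | zero => exact hray' s a 0
    | succ i ih =>
      rw [if_neg (by omega)]
      rcases i with _ | i
      · exact h1
      · rw [hD, pow_succ', Equiv.Perm.mul_apply, Q.left_next, ih (by omega), if_neg (by omega),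
          zero_add, ← Equiv.Perm.mul_apply, ← pow_succ']
        refine wedgeDiff_eq_zero fun t k h => ?_
        have hmem : ∀ j, (Q.next s).SameCycle a ((Q.next s ^ j) a) := fun j => ⟨j, by simp⟩
        have hne : ∀ j < 2, (Q.next s ^ j) a ≠ (Q.next s ^ (i + 1 + 1)) a := fun j hj h => by
          have := Q.pow_next_inj s a (i := j) (by omega) hi h
          omega
        by_cases hts : t = s
        · subst hts
          rcases k with _ | _ | k
          · exact hne 0 (by omega) h
          · exact hne 1 (by omega) h
          · refine hZ.strand_not_mem_cyc a t (M := k + 2) (by omega) ?_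
            rw [mem_cyc, h]
            exact hmem _
        · obtain rfl : t = !s := by cases s <;> cases t <;> simp_all
          rcases k with _ | k
          · exact hne 0 (by omega) h
          · refine hZ.strand_not_mem_cyc ((Q.next s).symm a) s (M := k + 2) (by omega) ?_
            have e : Q.strand ((Q.next s).symm a, s) = (a, !s) := by simp [strand_apply]
            rw [strand_pow_succ', e, h, mem_cyc]
            exact Equiv.Perm.SameCycle.trans ⟨1, by simp⟩ (hmem _)
  have hnr : ∀ σ, ∀ i : ℕ, (Q.strand ^ (i + 1)) σ ≠ σ := fun σ i => hZ.strand_pow_ne σ (by omega)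
  have hc : ∀ s a e, ((Q.cyc s a).map fun b => Q.wedgeDiff b e).sum = 0 := by
    intro s a e
    have : ∀ b, Q.wedgeDiff b e = Q.rayDiff s (Q.next s b, !s) e - Q.rayDiff s (b, !s) e := by
      intro b
      rw [Q.wedgeDiff_eq s, rayDiff, Q.onRay_eq_add (hnr _), Q.onRay_eq_add (hnr _) (e, !s),
        strand_apply]
      simp only [Prod.mk.injEq, and_true, Bool.not_eq_eq_eq_not, Bool.eq_not_self, and_false,
        if_false]
      rw [rayDiff, rayDiff]
      ring
    simp only [this]
    rw [sum_map_sub, Q.sum_cyc_next (fun b => Q.rayDiff s (b, !s) e), sub_self]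
  intro v s a
  have hconst : ∀ l x y, IsPath x l y → ((Q.cyc s a).map fun b => D b y).sum =
      ((Q.cyc s a).map fun b => D b x).sum := by
    intro l
    induction l with
    | nil => intro x y h; obtain rfl := h; rfl
    | cons e l ih =>
      rintro x y ⟨rfl, h⟩
      rw [ih _ _ h]
      simp only [hD, List.sum_map_add, hc, add_zero]
  obtain ⟨l, hl⟩ := Q.exists_isPath a.right v
  rw [hconst _ _ _ hl]
  have : ∀ b ∈ Q.cyc s a, D b a.right = if b = a then 1 else 0 := fun b hb =>
    hface s b a (Q.mem_cyc.2 (Q.mem_cyc.1 hb).symm)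
  rw [List.map_congr_left this, sum_cyc_ite, if_pos]
  exact Q.mem_cyc.2 (Equiv.Perm.SameCycle.refl _ _)

end Wedge

/-! ### Comparison of parallel paths -/

/-- Up to equivalence, `p` is `q` followed by a power of the loop at its endpoint `y`. -/
def LoopGE (y : V) (p q : List (Quiver.Total V)) : Prop :=
  ∃ k : ℕ, Q.cls p = Q.cls q * Q.loop y ^ k

/-- Two paths with endpoint `y` are comparable if one is equivalent to the other one followed by a
power of the loop at `y`. -/
def Comparable (y : V) (p q : List (Quiver.Total V)) : Prop := Q.LoopGE y p q ∨ Q.LoopGE y q p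

variable {Q}

theorem LoopGE.refl {y : V} (p : List (Quiver.Total V)) : Q.LoopGE y p p := ⟨0, by simp⟩

theorem LoopGE.of_cls_eq {y : V} {p q : List (Quiver.Total V)} (h : Q.cls p = Q.cls q) :
    Q.LoopGE y p q := ⟨0, by simp [h]⟩

theorem LoopGE.trans {y : V} {p q r : List (Quiver.Total V)} (h : Q.LoopGE y p q)
    (h' : Q.LoopGE y q r) : Q.LoopGE y p r := by
  obtain ⟨k, hk⟩ := h
  obtain ⟨l, hl⟩ := h'
  exact ⟨l + k, by rw [hk, hl, mul_assoc, ← pow_add]⟩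

theorem LoopGE.append {z y : V} {p q p' q' : List (Quiver.Total V)} (h : Q.LoopGE z p q)
    (h' : Q.LoopGE y p' q') (hq : IsPath z q' y) : Q.LoopGE y (p ++ p') (q ++ q') := by
  obtain ⟨k, hk⟩ := h
  obtain ⟨l, hl⟩ := h'
  refine ⟨k + l, ?_⟩
  rw [cls_append, cls_append, hk, hl, pow_add, mul_assoc, ← mul_assoc (_ ^ k),
    Q.loop_pow_mul_cls hq]
  simp only [mul_assoc]

theorem Comparable.symm {y : V} {p q : List (Quiver.Total V)} (h : Q.Comparable y p q) :
    Q.Comparable y q p := Or.symm h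

theorem LoopGE.comparable {y : V} {p q r : List (Quiver.Total V)} (h : Q.LoopGE y p r)
    (h' : Q.LoopGE y q r) : Q.Comparable y p q := by
  obtain ⟨k, hk⟩ := h
  obtain ⟨l, hl⟩ := h'
  rcases le_total k l with hkl | hkl
  · obtain ⟨d, rfl⟩ := Nat.exists_eq_add_of_le hkl
    exact .inr ⟨d, by rw [hl, hk, mul_assoc, ← pow_add]⟩
  · obtain ⟨d, rfl⟩ := Nat.exists_eq_add_of_le hkl
    exact .inl ⟨d, by rw [hl, hk, mul_assoc, ← pow_add]⟩

theorem Comparable.append {z y : V} {p q p' q' : List (Quiver.Total V)}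
    (h : Q.Comparable z p q) (h' : Q.Comparable y p' q') (hp : IsPath z p' y)
    (hq : IsPath z q' y) : Q.Comparable y (p ++ p') (q ++ q') := by
  rcases h with h | h <;> rcases h' with h' | h'
  · exact .inl (h.append h' hq)
  · exact LoopGE.comparable (h.append (.refl p') hp) (LoopGE.append (.refl q) h' hp)
  · exact LoopGE.comparable (LoopGE.append (.refl p) h' hq) (h.append (.refl q') hq)
  · exact .inr (h.append h' hp)

/-- The degree of `exists_wedge` distinguishes a path from its products with powers of a loop, and
it is additive. So comparable paths are determined by their degrees, which can be cancelled. -/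
theorem RaysDisjoint.isCancellation_of_comparable [ContractibleSpace Q.Realization]
    (hZ : Q.RaysDisjoint) (h : ∀ x y p q, IsPath x p y → IsPath x q y → Q.Comparable y p q) :
    Q.IsCancellation := by
  have := Q.nonempty_total
  obtain ⟨D, -, -, -, hD⟩ := hZ.exists_wedge
  have key : ∀ {x y p q}, IsPath x p y → IsPath x q y →
      (p.map fun b => D b x).sum = (q.map fun b => D b x).sum → Q.cls p = Q.cls q := by
    intro x y p q hp hq hpq
    rcases h x y p q hp hq with ⟨k, hk⟩ | ⟨k, hk⟩
    · have := Q.sum_eq_add_of_cls_eq (hD x) hk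
      obtain rfl : k = 0 := by omega
      simpa using hk
    · have := Q.sum_eq_add_of_cls_eq (hD x) hk
      obtain rfl : k = 0 := by omega
      simpa using hk.symm
  have hw : ∀ v {p q : List (Quiver.Total V)}, Q.cls p = Q.cls q →
      (p.map fun b => D b v).sum = (q.map fun b => D b v).sum := fun v p q h => by
    have := Q.sum_eq_add_of_cls_eq (hD v) (p := p) (q := q) (y := v) (k := 0) (by simpa using h)
    simpa using this
  rw [isCancellation_iff]
  constructor
  · intro x y z p q r hp hq hr h
    refine key hp hq ?_
    have := hw x (p := p ++ r) (q := q ++ r) h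
    simpa using this
  · intro x y z p q r hp hq hr h
    refine key hp hq ?_
    have := hw y (p := r ++ p) (q := r ++ q) h
    simpa using this

/-! ### Ribbons -/

variable (Q)

/-- The path that runs back along the first `2 * m` steps of the strand of `σ`, on one of its
sides. -/
noncomputable def ribbon : ℕ → Quiver.Total V × Bool → List (Quiver.Total V)
  | 0, _ => []
  | m + 1, σ => ribbon m (Q.strand (Q.strand σ)) ++ Q.complement σ.2 σ.1

theorem isPath_ribbon (m : ℕ) (σ : Quiver.Total V × Bool) :
    IsPath ((Q.strand ^ (2 * m)) σ).1.left (Q.ribbon m σ) σ.1.left := by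
  induction m generalizing σ with
  | zero => rfl
  | succ m ih =>
    rw [mul_add, mul_one, strand_pow_succ', strand_pow_succ']
    refine (ih _).append ?_
    have := Q.isPath_complement σ.2 σ.1
    rwa [← Q.left_next (!σ.2)] at this

/-- The ribbons on the two sides of an even number of steps of a strand differ by their end
arrows. -/
theorem cls_ribbon_mul (m : ℕ) (σ : Quiver.Total V × Bool) :
    Q.cls (Q.ribbon m σ) * Q.cls [σ.1] =
      Q.cls [((Q.strand ^ (2 * m)) σ).1] * Q.cls (Q.ribbon m (Q.strand σ)) := by
  induction m generalizing σ with
  | zero => simp [ribbon]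
  | succ m ih =>
    have h1 : Q.cls (Q.complement σ.2 σ.1) * Q.cls [σ.1] =
        Q.cls [(Q.strand (Q.strand σ)).1] *
          Q.cls (Q.complement (Q.strand σ).2 (Q.strand σ).1) := by
      rw [← cls_append, ← derivative_next, ← cls_append, Q.cls_derivative σ.2 (!σ.2)]
      congr 1
      exact Q.derivative_eq_cons _ _
    rw [mul_add, mul_one, strand_pow_succ', strand_pow_succ', ribbon, ribbon, cls_append,
      cls_append, mul_assoc, h1, ← mul_assoc, ih, mul_assoc]

/-- The ribbons on the two sides of an odd number of steps of a strand: the outer one, closed up by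
the end arrows, is the inner one followed by a loop. -/
theorem cls_mul_ribbon_mul (m : ℕ) (σ : Quiver.Total V × Bool) :
    Q.cls [((Q.strand ^ (2 * m + 1)) σ).1] * Q.cls (Q.ribbon (m + 1) σ) * Q.cls [σ.1] =
      Q.cls (Q.ribbon m (Q.strand σ)) * Q.loop σ.1.right := by
  have h1 := Q.cls_ribbon_mul m (Q.strand σ)
  rw [ribbon, cls_append, strand_pow_succ', ← mul_assoc, ← h1, mul_assoc, mul_assoc,
    ← cls_append, ← derivative_next]
  congr 1
  change Q.cls [Q.next σ.2 σ.1] * _ = _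
  rw [cls_mul_derivative, left_next]

theorem mem_ribbon {m : ℕ} {σ : Quiver.Total V × Bool} {b : Quiver.Total V}
    (hb : b ∈ Q.ribbon m σ) : ∃ j < m, b ∈ Q.complement ((Q.strand ^ (2 * j)) σ).2
      ((Q.strand ^ (2 * j)) σ).1 := by
  induction m generalizing σ with
  | zero => simp [ribbon] at hb
  | succ m ih =>
    rw [ribbon, List.mem_append] at hb
    rcases hb with hb | hb
    · obtain ⟨j, hj, h⟩ := ih hb
      refine ⟨j + 1, by omega, ?_⟩
      rwa [mul_add, mul_one, strand_pow_succ', strand_pow_succ']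
    · exact ⟨0, by omega, hb⟩

theorem cyc_eq_complement (s : Bool) (a : Quiver.Total V) :
    Q.cyc s a = a :: Q.next s a :: Q.complement s a := by
  rw [cyc, derivative_eq_cons]

theorem mem_cyc_of_mem_complement {s : Bool} {a b : Quiver.Total V}
    (h : b ∈ Q.complement s a) : b ∈ Q.cyc s a := by
  rw [cyc_eq_complement]
  simp [h]

variable {Q}

/-- A ribbon has degree `0` with respect to its first vertex. -/
theorem sum_ribbon_eq_zero {D : Quiver.Total V → V → ℤ} (h01 : ∀ a v, D a v = 0 ∨ D a v = 1)
    (hray : ∀ s a k, D a ((Q.strand ^ (2 * k + 1)) (a, s)).1.left = 1)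
    (hD : ∀ v s a, ((Q.cyc s a).map fun b => D b v).sum = 1) (m : ℕ) (σ : Quiver.Total V × Bool) :
    ((Q.ribbon m σ).map fun b => D b ((Q.strand ^ (2 * m)) σ).1.left).sum = 0 := by
  have hnn : ∀ v (l : List (Quiver.Total V)), 0 ≤ (l.map fun b => D b v).sum := fun v l => by
    refine List.sum_nonneg fun z hz => ?_
    obtain ⟨b, -, rfl⟩ := List.mem_map.1 hz
    rcases h01 b v with h | h <;> simp [h]
  induction m generalizing σ with
  | zero => simp [ribbon]
  | succ m ih =>
    have h1 := hD ((Q.strand ^ (2 * (m + 1))) σ).1.left σ.2 σ.1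
    have h2 := ih (Q.strand (Q.strand σ))
    have h3 := hray (!σ.2) (Q.next σ.2 σ.1) m
    have h4 := hnn ((Q.strand ^ (2 * (m + 1))) σ).1.left (Q.complement σ.2 σ.1)
    have h5 := h01 σ.1 ((Q.strand ^ (2 * (m + 1))) σ).1.left
    rw [cyc_eq_complement] at h1
    rw [ribbon, List.map_append, List.sum_append]
    rw [mul_add, mul_one, strand_pow_succ', strand_pow_succ'] at *
    change D (Q.next σ.2 σ.1) ((Q.strand ^ (2 * m)) (Q.strand (Q.strand σ))).1.left = 1 at h3
    rw [h2, zero_add]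
    simp only [List.map_cons, List.sum_cons] at h1
    rw [h3] at h1
    omega

variable (Q)

/-! ### Rotation around a vertex -/

/-- The rotation around the vertices, acting on the arrows by their heads: the next incoming
arrow, across the corner of sign `s` and the following corner of sign `!s`. -/
def link (s : Bool) : Equiv.Perm (Quiver.Total V) := (Q.next (!s))⁻¹ * Q.next s

theorem link_apply (s : Bool) (a : Quiver.Total V) :
    Q.link s a = (Q.next (!s)).symm (Q.next s a) := rfl

theorem link_right (s : Bool) (a : Quiver.Total V) : (Q.link s a).right = a.right := by
  rw [link_apply, left_symm, left_next]

theorem link_pow_right (s : Bool) (a : Quiver.Total V) (n : ℕ) :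
    ((Q.link s ^ n) a).right = a.right := by
  induction n with
  | zero => rfl
  | succ n ih => rw [pow_succ', Equiv.Perm.mul_apply, link_right, ih]

theorem exists_link_pow (s : Bool) {a b : Quiver.Total V} (h : a.right = b.right) :
    ∃ n : ℕ, (Q.link s ^ n) a = b := by
  have key : ∀ a b : Quiver.Total V, a.right = b.right → ∃ n : ℕ, (Q.link true ^ n) a = b := by
    intro a b h
    have hp := (Q.sum_link (M := ℤ) 0 a).1
    set p := Function.minimalPeriod ((Q.next false)⁻¹ * Q.next true) a
    have hper : (Q.link true ^ p) a = a := by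
      rw [Equiv.Perm.coe_pow]; exact Function.isPeriodicPt_minimalPeriod _ _
    obtain ⟨z, hz⟩ := Q.link_connected a b h
    have h1 : ((Q.link true ^ p) ^ z.natAbs) a = a :=
      Equiv.Perm.pow_apply_eq_self_of_apply_eq_self hper _
    have h2 : 0 ≤ z + (p * z.natAbs : ℕ) := by
      have : z.natAbs ≤ p * z.natAbs := Nat.le_mul_of_pos_left _ hp
      omega
    obtain ⟨n, hn⟩ := Int.eq_ofNat_of_zero_le h2
    refine ⟨n, ?_⟩
    rw [← zpow_natCast, ← Int.ofNat_eq_natCast, Int.ofNat_eq_natCast, ← hn, zpow_add,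
      Equiv.Perm.mul_apply, zpow_natCast, pow_mul, h1]
    exact hz
  cases s
  · obtain ⟨n, hn⟩ := key b a h.symm
    refine ⟨n, ?_⟩
    have : Q.link false = (Q.link true)⁻¹ := by simp [link]
    rw [this, inv_pow, Equiv.Perm.inv_eq_iff_eq, hn]
  · exact key a b h

section Barrier

variable {Q} {X : Type*} {F : Bool → Quiver.Total V → X} {B : Set (Quiver.Total V)}

theorem eq_of_link_pow (hF : ∀ s a, F s (Q.next s a) = F s a) (hB : ∀ s, ∀ e ∉ B, F s e = F (!s) e)
    (s : Bool) (a : Quiver.Total V) (n : ℕ) (hout : ∀ j < n, Q.next s ((Q.link s ^ j) a) ∉ B)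
    (hin : ∀ j < n, (Q.link s ^ (j + 1)) a ∉ B) : F s ((Q.link s ^ n) a) = F s a := by
  induction n with
  | zero => rfl
  | succ n ih =>
    rw [hB s _ (hin n (by omega)), ← ih (fun j hj => hout j (by omega))
      (fun j hj => hin j (by omega)), ← hF s, hB s _ (hout n (by omega)), pow_succ',
      Equiv.Perm.mul_apply, link_apply, ← hF (!s), Equiv.apply_symm_apply]

/-- A function on the polygons that only jumps across the arrows of `B` takes the same values
before and after a vertex at which exactly one arrow of `B` enters and one leaves. -/
theorem eq_of_corner (hF : ∀ s a, F s (Q.next s a) = F s a) (hB : ∀ s, ∀ e ∉ B, F s e = F (!s) e)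
    {a b : Quiver.Total V} (hab : a.right = b.left) (hin : ∀ e ∈ B, e.right = a.right → e = a)
    (hout : ∀ e ∈ B, e.left = a.right → e = b) (s : Bool) : F s a = F s b := by
  classical
  have hex := Q.exists_link_pow s (a := a) (b := (Q.next s).symm b) (by rw [left_symm, hab])
  have hk := Nat.find_spec hex
  have hmin : ∀ j < Nat.find hex, (Q.link s ^ j) a ≠ (Q.next s).symm b := fun j hj =>
    Nat.find_min hex hj
  generalize Nat.find hex = k at *
  rw [← eq_of_link_pow hF hB s a k ?_ ?_, hk, ← hF s, Equiv.apply_symm_apply]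
  · intro j hj h
    have := hout _ h (by rw [left_next, link_pow_right])
    exact hmin j hj (by rw [← this, Equiv.symm_apply_apply])
  · intro j hj h
    have := hin _ h (by rw [link_pow_right])
    refine hmin (k - (j + 1)) (by omega) ?_
    rw [← hk]
    conv_lhs => rw [← this]
    rw [← Equiv.Perm.mul_apply, ← pow_add, Nat.sub_add_cancel (by omega)]

/-- A function on the polygons that only jumps across the arrows of `B` takes the same values
on the opposite sides of `b₁` and `b₂` if these are the only arrows of `B` that leave a vertex, and
no arrow of `B` enters it. -/
theorem eq_of_fork (hF : ∀ s a, F s (Q.next s a) = F s a) (hB : ∀ s, ∀ e ∉ B, F s e = F (!s) e)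
    {b₁ b₂ : Quiver.Total V} (hab : b₁.left = b₂.left) (hin : ∀ e ∈ B, e.right ≠ b₁.left)
    (hout : ∀ e ∈ B, e.left = b₁.left → e = b₁ ∨ e = b₂) (s : Bool) : F (!s) b₁ = F s b₂ := by
  classical
  set a := (Q.next (!s)).symm b₁ with ha
  have har : a.right = b₁.left := by rw [ha, left_symm]
  have hex := Q.exists_link_pow s (a := a) (b := (Q.next s).symm b₂) (har.trans
    (hab.trans (Q.left_symm s b₂).symm))
  have hk := Nat.find_spec hex
  have hmin : ∀ j < Nat.find hex, (Q.link s ^ j) a ≠ (Q.next s).symm b₂ := fun j hj =>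
    Nat.find_min hex hj
  generalize Nat.find hex = k at *
  have h1 : F (!s) b₁ = F s a := by
    rw [hB s _ (fun h => hin _ h har), ← hF (!s) a, ha, Equiv.apply_symm_apply]
  rw [h1, ← eq_of_link_pow hF hB s a k ?_ ?_, hk, ← hF s, Equiv.apply_symm_apply]
  · intro j hj h
    rcases hout _ h (by rw [left_next, link_pow_right, har]) with h2 | h2
    · refine hmin (k - (j + 1)) (by omega) ?_
      have : (Q.link s ^ (j + 1)) a = a := by
        rw [pow_succ', Equiv.Perm.mul_apply, link_apply, h2]
      rw [← hk]
      conv_lhs => rw [← this]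
      rw [← Equiv.Perm.mul_apply, ← pow_add, Nat.sub_add_cancel (by omega)]
    · exact hmin j hj (by rw [← h2, Equiv.symm_apply_apply])
  · intro j hj h
    exact hin _ h (by rw [link_pow_right, har])

end Barrier

/-! ### Minimal pairs of incomparable paths -/

/-- `p` and `q` are parallel paths with arrows in `B` that are not comparable, of minimal total
length. -/
structure IsMinPair (B : Set (Quiver.Total V)) (x y : V) (p q : List (Quiver.Total V)) : Prop where
  left : IsPath x p y
  right : IsPath x q y
  left_mem : ∀ e ∈ p, e ∈ B
  right_mem : ∀ e ∈ q, e ∈ B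
  not_comparable : ¬ Q.Comparable y p q
  min : ∀ x' y' p' q', IsPath x' p' y' → IsPath x' q' y' → (∀ e ∈ p', e ∈ B) → (∀ e ∈ q', e ∈ B) →
    p'.length + q'.length < p.length + q.length → Q.Comparable y' p' q'

/-- There are parallel paths with arrows in `B` that are not comparable. -/
def HasIncomparable (B : Set (Quiver.Total V)) : Prop :=
  ∃ x y p q, IsPath x p y ∧ IsPath x q y ∧ (∀ e ∈ p, e ∈ B) ∧ (∀ e ∈ q, e ∈ B) ∧
    ¬ Q.Comparable y p q

variable {Q}

theorem HasIncomparable.exists_isMinPair {B : Set (Quiver.Total V)} (h : Q.HasIncomparable B) :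
    ∃ x y p q, Q.IsMinPair B x y p q := by
  classical
  have hex : ∃ n x y p q, IsPath x p y ∧ IsPath x q y ∧ (∀ e ∈ p, e ∈ B) ∧ (∀ e ∈ q, e ∈ B) ∧
      ¬ Q.Comparable y p q ∧ p.length + q.length = n := by
    obtain ⟨x, y, p, q, h1, h2, h3, h4, h5⟩ := h
    exact ⟨_, x, y, p, q, h1, h2, h3, h4, h5, rfl⟩
  obtain ⟨x, y, p, q, h1, h2, h3, h4, h5, h6⟩ := Nat.find_spec hex
  refine ⟨x, y, p, q, h1, h2, h3, h4, h5, fun x' y' p' q' hp hq hpB hqB hlt => ?_⟩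
  by_contra hc
  exact Nat.find_min hex (h6 ▸ hlt) ⟨x', y', p', q', hp, hq, hpB, hqB, hc, rfl⟩

namespace IsMinPair

variable {B : Set (Quiver.Total V)} {x y : V} {p q : List (Quiver.Total V)}

theorem symm (h : Q.IsMinPair B x y p q) : Q.IsMinPair B x y q p where
  left := h.right
  right := h.left
  left_mem := h.right_mem
  right_mem := h.left_mem
  not_comparable h' := h.not_comparable h'.symm
  min x' y' p' q' h1 h2 h3 h4 h5 := (h.min x' y' q' p' h2 h1 h4 h3 (by omega)).symm

/-- The paths of a minimal pair only meet at their endpoints: otherwise both halves would be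
comparable. -/
theorem split (h : Q.IsMinPair B x y p q) {p₁ p₂ q₁ q₂ : List (Quiver.Total V)} {z : V}
    (hp : p = p₁ ++ p₂) (hq : q = q₁ ++ q₂) (hp₁ : IsPath x p₁ z) (hq₁ : IsPath x q₁ z) :
    (p₁ = [] ∧ q₁ = []) ∨ (p₂ = [] ∧ q₂ = []) := by
  by_contra! hne
  obtain ⟨z', hz1, hz2⟩ := isPath_append.1 (hp ▸ h.left)
  obtain ⟨z'', hz3, hz4⟩ := isPath_append.1 (hq ▸ h.right)
  obtain rfl := hz1.right_unique hp₁
  obtain rfl := hz3.right_unique hq₁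
  have hl1 : 0 < p₁.length + q₁.length := by
    by_contra hl
    exact hne.1 (List.length_eq_zero_iff.1 (by omega)) (List.length_eq_zero_iff.1 (by omega))
  have hl2 : 0 < p₂.length + q₂.length := by
    by_contra hl
    exact hne.2 (List.length_eq_zero_iff.1 (by omega)) (List.length_eq_zero_iff.1 (by omega))
  have hB := h.left_mem
  have hB' := h.right_mem
  have hmin := h.min
  have hnc := h.not_comparable
  subst hp hq
  simp only [List.mem_append, or_imp, forall_and, List.length_append] at hB hB' hmin
  exact hnc (Comparable.append (hmin _ _ _ _ hp₁ hq₁ hB.1 hB'.1 (by omega))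
    (hmin _ _ _ _ hz2 hz4 hB.2 hB'.2 (by omega)) hz2 hz4)

/-- A path of a minimal pair does not contain closed paths, unless it is closed itself and the other
path is empty: such a path would be a power of a loop,
and could be omitted. -/
theorem loop [ContractibleSpace Q.Realization] (h : Q.IsMinPair B x y p q)
    {p₁ r p₂ : List (Quiver.Total V)} {z : V} (hp : p = p₁ ++ (r ++ p₂)) (hp₁ : IsPath x p₁ z)
    (hr : IsPath z r z) : r = [] ∨ (q = [] ∧ p₁ = [] ∧ p₂ = []) := by
  have := Q.nonempty_total
  by_contra! hne
  obtain ⟨z', hz1, hz2⟩ := isPath_append.1 (hp ▸ h.left)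
  obtain rfl := hz1.right_unique hp₁
  obtain ⟨z'', hz3, hz4⟩ := isPath_append.1 hz2
  obtain rfl := hz3.right_unique hr
  have hl1 : 0 < r.length := List.length_pos_iff.2 hne.1
  have hl2 : 0 < q.length + p₁.length + p₂.length := by
    by_contra hl
    exact hne.2 (List.length_eq_zero_iff.1 (by omega)) (List.length_eq_zero_iff.1 (by omega))
      (List.length_eq_zero_iff.1 (by omega))
  have hB := h.left_mem
  have hmin := h.min
  have hnc := h.not_comparable
  have hq := h.right
  have hqB := h.right_mem
  clear h
  subst hp
  simp only [List.mem_append, or_imp, forall_and, List.length_append] at hB hmin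
  have h1 : ∃ k, Q.cls r = Q.loop z'' ^ k := by
    rcases hmin _ _ r [] hr rfl hB.2.1 (by simp) (by simp; omega) with ⟨k, hk⟩ | ⟨k, hk⟩
    · exact ⟨k, by simpa using hk⟩
    · obtain ⟨l, -, hl, -⟩ := Q.exists_isPath_loop_pow z'' k
      rw [← hl, ← cls_append] at hk
      have := Q.eq_nil_of_cls_eq_one hk.symm
      exact absurd (List.append_eq_nil_iff.1 this).1 hne.1
  obtain ⟨k, hk⟩ := h1
  have h2 : Q.LoopGE y (p₁ ++ (r ++ p₂)) (p₁ ++ p₂) :=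
    ⟨k, by simp only [cls_append]; rw [hk, Q.loop_pow_mul_cls hz4, mul_assoc]⟩
  rcases hmin _ _ (p₁ ++ p₂) q (hp₁.append hz4) hq (by
    simp only [List.mem_append, or_imp, forall_and]; exact ⟨hB.1, hB.2.2⟩) hqB (by
    simp only [List.length_append]; omega) with h3 | h3
  · exact hnc (.inl (h2.trans h3))
  · exact hnc (h2.comparable h3)

/-- A path of a minimal pair passes at most once through each vertex, apart from its endpoints if
it is closed. -/
theorem prefix_eq [ContractibleSpace Q.Realization] (h : Q.IsMinPair B x y p q)
    {u₁ u₂ w₁ w₂ : List (Quiver.Total V)} {z : V} (hu : p = u₁ ++ u₂) (hw : p = w₁ ++ w₂)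
    (hu₁ : IsPath x u₁ z) (hw₁ : IsPath x w₁ z) :
    u₁ = w₁ ∨ (q = [] ∧ ((u₁ = [] ∧ w₂ = []) ∨ (w₁ = [] ∧ u₂ = []))) := by
  rcases List.append_eq_append_iff.1 (hu.symm.trans hw) with ⟨r, h1, h2⟩ | ⟨r, h1, h2⟩
  · obtain ⟨z', hz1, hz2⟩ := isPath_append.1 (h1 ▸ hw₁)
    obtain rfl := hz1.right_unique hu₁
    rcases h.loop (h2 ▸ hu) hz1 hz2 with rfl | ⟨h3, h4, h5⟩
    · exact .inl (by simpa using h1.symm)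
    · exact .inr ⟨h3, .inl ⟨h4, h5⟩⟩
  · obtain ⟨z', hz1, hz2⟩ := isPath_append.1 (h1 ▸ hu₁)
    obtain rfl := hz1.right_unique hw₁
    rcases h.loop (h2 ▸ hw) hz1 hz2 with rfl | ⟨h3, h4, h5⟩
    · exact .inl (by simpa using h1)
    · exact .inr ⟨h3, .inr ⟨h4, h5⟩⟩

theorem disjoint (h : Q.IsMinPair B x y p q) {e : Quiver.Total V} (hp : e ∈ p) : e ∉ q := by
  intro hq
  obtain ⟨m₁, m₂, rfl⟩ := List.append_of_mem hp
  obtain ⟨n₁, n₂, rfl⟩ := List.append_of_mem hq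
  obtain ⟨z, hm, hm'⟩ := isPath_append.1 h.left
  obtain ⟨z', hn, hn'⟩ := isPath_append.1 h.right
  obtain rfl : e.left = z := hm'.1
  obtain rfl : e.left = z' := hn'.1
  rcases h.split rfl rfl hm hn with ⟨rfl, rfl⟩ | ⟨h1, -⟩
  · rcases h.split (p₁ := [e]) (q₁ := [e]) rfl rfl ⟨hm.symm, rfl⟩ ⟨hm.symm, rfl⟩ with
      ⟨h1, -⟩ | ⟨rfl, rfl⟩
    · simp at h1
    · exact h.not_comparable (.inl (.refl _))
  · simp at h1

theorem nodup [ContractibleSpace Q.Realization] (h : Q.IsMinPair B x y p q) : p.Nodup := by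
  have key : ∀ p : List (Quiver.Total V), (∀ m₁ e m₂ m₃, p ≠ m₁ ++ e :: (m₂ ++ e :: m₃)) →
      p.Nodup := by
    intro p
    induction p with
    | nil => simp
    | cons e p ih =>
      intro h
      refine List.nodup_cons.2 ⟨fun he => ?_, ih fun m₁ e' m₂ m₃ h' => h (e :: m₁) e' m₂ m₃ (by
        rw [h']; rfl)⟩
      obtain ⟨m₂, m₃, rfl⟩ := List.append_of_mem he
      exact h [] e m₂ m₃ rfl
  refine key p ?_
  rintro m₁ e m₂ m₃ rfl
  obtain ⟨z, hm, hm'⟩ := isPath_append.1 h.left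
  obtain rfl : e.left = z := hm'.1
  obtain ⟨z', hn, hn'⟩ := isPath_append.1 hm'.2
  obtain rfl : e.left = z' := hn'.1
  rcases h.loop (p₁ := m₁) (r := e :: m₂) (p₂ := e :: m₃) (by simp) hm ⟨rfl, hn⟩ with h | h
  · simp at h
  · simp at h

/-- At an interior vertex of a path of a minimal pair, no other arrows of the pair enter or
leave. -/
theorem corner [ContractibleSpace Q.Realization] (h : Q.IsMinPair B x y p q)
    {l₁ l₂ : List (Quiver.Total V)} {a b : Quiver.Total V} (hp : p = l₁ ++ a :: b :: l₂) :
    a.right = b.left ∧ (∀ e, e ∈ p ∨ e ∈ q → e.right = a.right → e = a) ∧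
      ∀ e, e ∈ p ∨ e ∈ q → e.left = a.right → e = b := by
  have hp' : p = (l₁ ++ [a]) ++ (b :: l₂) := by simp [hp]
  obtain ⟨z, hz1, hz2⟩ := isPath_append.1 (hp' ▸ h.left)
  obtain ⟨z', hz3, hz4⟩ := isPath_append.1 hz1
  obtain rfl : a.right = z := hz4.2
  refine ⟨hz2.1.symm, ?_, ?_⟩
  · rintro e (he | he) hr
    · obtain ⟨m₁, m₂, hm⟩ := List.append_of_mem he
      obtain ⟨z'', hz5, hz6⟩ := isPath_append.1 (hm ▸ h.left)
      rcases h.prefix_eq (w₁ := m₁ ++ [e]) (w₂ := m₂) hp' (by simp [hm]) hz1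
        (hz5.append ⟨hz6.1, hr⟩) with h1 | ⟨-, ⟨h1, -⟩ | ⟨h1, -⟩⟩
      · exact (List.singleton_injective (List.append_inj' h1 rfl).2).symm
      · simp at h1
      · simp at h1
    · obtain ⟨m₁, m₂, hm⟩ := List.append_of_mem he
      obtain ⟨z'', hz5, hz6⟩ := isPath_append.1 (hm ▸ h.right)
      rcases h.split (q₁ := m₁ ++ [e]) (q₂ := m₂) hp' (by simp [hm]) hz1
        (hz5.append ⟨hz6.1, hr⟩) with ⟨h1, -⟩ | ⟨h1, -⟩
      · simp at h1
      · simp at h1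
  · rintro e (he | he) hr
    · obtain ⟨m₁, m₂, hm⟩ := List.append_of_mem he
      obtain ⟨z'', hz5, hz6⟩ := isPath_append.1 (hm ▸ h.left)
      obtain rfl : e.left = z'' := hz6.1
      rcases h.prefix_eq hp' hm hz1 (hr ▸ hz5) with h1 | ⟨-, ⟨h1, -⟩ | ⟨-, h1⟩⟩
      · rw [hm, h1] at hp'
        exact (List.cons.inj (List.append_cancel_left hp')).1
      · simp at h1
      · simp at h1
    · obtain ⟨m₁, m₂, hm⟩ := List.append_of_mem he
      obtain ⟨z'', hz5, hz6⟩ := isPath_append.1 (hm ▸ h.right)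
      obtain rfl : e.left = z'' := hz6.1
      rcases h.split hp' hm hz1 (hr ▸ hz5) with ⟨h1, -⟩ | ⟨h1, -⟩
      · simp at h1
      · simp at h1

/-- At the first vertex of a minimal pair, only the first arrows leave, and no arrow enters. -/
theorem start [ContractibleSpace Q.Realization] {b : Quiver.Total V}
    (h : Q.IsMinPair B x y (b :: p) q) (hq : q ≠ []) {e : Quiver.Total V} (he : e ∈ b :: p) :
    e.right ≠ x ∧ (e.left = x → e = b) := by
  obtain ⟨m₁, m₂, hm⟩ := List.append_of_mem he
  obtain ⟨z, hz5, hz6⟩ := isPath_append.1 (hm ▸ h.left)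
  obtain rfl : e.left = z := hz6.1
  constructor
  · intro hr
    rcases h.prefix_eq (u₁ := []) (u₂ := b :: p) (w₁ := m₁ ++ [e]) (w₂ := m₂) rfl (by simp [hm])
      rfl (hz5.append ⟨rfl, hr⟩) with h1 | ⟨h1, -⟩
    · simp at h1
    · exact hq h1
  · intro hr
    rcases h.prefix_eq (u₁ := []) (u₂ := b :: p) rfl hm rfl (hr ▸ hz5) with h1 | ⟨h1, -⟩
    · rw [← h1] at hm
      exact (List.cons.inj hm).1.symm
    · exact absurd h1 hq

/-- A function on the polygons that only jumps across a minimal pair is constant along each side of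
its first path. -/
theorem eq_of_mem [ContractibleSpace Q.Realization] (h : Q.IsMinPair B x y p q) {X : Type*}
    {F : Bool → Quiver.Total V → X} (hF : ∀ s a, F s (Q.next s a) = F s a)
    (hB : ∀ s, ∀ e ∉ {e | e ∈ p ∨ e ∈ q}, F s e = F (!s) e) (s : Bool) {a b : Quiver.Total V}
    (ha : a ∈ p) (hb : b ∈ p) : F s a = F s b := by
  have key : ∀ p : List (Quiver.Total V), (∀ l₁ a b l₂, p = l₁ ++ a :: b :: l₂ → F s a = F s b) →
      ∀ a ∈ p, ∀ b ∈ p, F s a = F s b := by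
    intro p
    induction p with
    | nil => simp
    | cons c p ih =>
      intro h
      have ih := ih fun l₁ a b l₂ h' => h (c :: l₁) a b l₂ (by rw [h']; rfl)
      have hc : ∀ a ∈ p, F s c = F s a := by
        intro a ha
        cases p with
        | nil => simp at ha
        | cons d p => exact (h [] c d p rfl).trans (ih d (by simp) a ha)
      intro a ha b hb
      rcases List.mem_cons.1 ha with rfl | ha' <;> rcases List.mem_cons.1 hb with rfl | hb'
      · rfl
      · exact hc b hb'
      · exact (hc a ha').symm
      · exact ih a ha' b hb'
  refine key p (fun l₁ a b l₂ hp => ?_) a ha b hb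
  obtain ⟨h1, h2, h3⟩ := h.corner hp
  exact eq_of_corner hF hB h1 h2 h3 s

/-- A function on the polygons that only jumps across a minimal pair takes the same value on the
outer sides of the two paths. -/
theorem eq_of_mem_of_mem [ContractibleSpace Q.Realization] (h : Q.IsMinPair B x y p q)
    {X : Type*} {F : Bool → Quiver.Total V → X} (hF : ∀ s a, F s (Q.next s a) = F s a)
    (hB : ∀ s, ∀ e ∉ {e | e ∈ p ∨ e ∈ q}, F s e = F (!s) e) (s : Bool) {a b : Quiver.Total V}
    (ha : a ∈ p) (hb : b ∈ q) : F (!s) a = F s b := by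
  obtain _ | ⟨c, p⟩ := p
  · simp at ha
  obtain _ | ⟨d, q⟩ := q
  · simp at hb
  rw [h.eq_of_mem hF hB (!s) ha (b := c) (by simp),
    h.symm.eq_of_mem hF (fun s e he => hB s e fun h => he h.symm) s hb (b := d) (by simp)]
  have hc : c.left = x := h.left.1
  have hd : d.left = x := h.right.1
  refine eq_of_fork hF hB (hc.trans hd.symm) ?_ ?_ s
  · rintro e (he | he)
    · exact hc ▸ (h.start (by simp) he).1
    · exact hc ▸ (h.symm.start (by simp) he).1
  · rintro e (he | he) hr
    · exact .inl ((h.start (by simp) he).2 (hr.trans hc))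
    · exact .inr ((h.symm.start (by simp) he).2 (hr.trans hc))

end IsMinPair

variable (Q)

/-! ### Regions -/

/-- A finite set of polygons without holes: the only finite sum of polygons whose boundary consists
of arrows of polygons of `S` are those of polygons of `S`. The polygon of sign `s` through `a` is
represented by all the pairs `(s, b)` with `b` on it. -/
structure IsFull (S : Set (Bool × Quiver.Total V)) : Prop where
  finite : S.Finite
  next_mem : ∀ s a, (s, Q.next s a) ∈ S ↔ (s, a) ∈ S
  fill : ∀ E : Bool → Quiver.Total V →₀ ℤ, (∀ s a, E s (Q.next s a) = E s a) →
    (∀ a, (true, a) ∉ S → (false, a) ∉ S → E true a = E false a) → ∀ s a, (s, a) ∉ S → E s a = 0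

/-- The arrows of the polygons of `S`. -/
def closureArrows (S : Set (Bool × Quiver.Total V)) : Set (Quiver.Total V) :=
  {a | (true, a) ∈ S ∨ (false, a) ∈ S}

theorem mem_closureArrows {S : Set (Bool × Quiver.Total V)} {s : Bool} {a : Quiver.Total V}
    (h : (s, a) ∈ S) : a ∈ closureArrows S := by
  cases s
  · exact .inr h
  · exact .inl h

variable {Q}

theorem IsFull.mem_of_mem_cyc {S : Set (Bool × Quiver.Total V)} (h : Q.IsFull S) {s : Bool}
    {a b : Quiver.Total V} (hb : b ∈ Q.cyc s a) (ha : (s, a) ∈ S) : (s, b) ∈ S := by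
  rw [cyc_eq, List.mem_map] at hb
  obtain ⟨i, -, rfl⟩ := hb
  induction i with
  | zero => exact ha
  | succ i ih => rwa [pow_succ', Equiv.Perm.mul_apply, h.next_mem]

/-- A minimal pair of incomparable paths bounds a region `S` without holes. The polygons of sign `s`
at the arrows of the first path and the polygons of sign `!s` at the arrows of the second path are
in `S`, the opposite ones are not. -/
theorem IsMinPair.exists_region [ContractibleSpace Q.Realization] {B : Set (Quiver.Total V)}
    {x y : V} {p q : List (Quiver.Total V)} (h : Q.IsMinPair B x y p q) (hne : p ≠ []) :
    ∃ (S : Set (Bool × Quiver.Total V)) (s : Bool), Q.IsFull S ∧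
      (∀ e ∈ p, (s, e) ∈ S ∧ (!s, e) ∉ S) ∧ (∀ e ∈ q, (!s, e) ∈ S ∧ (s, e) ∉ S) ∧
      (∀ e, e ∉ p → e ∉ q → ((true, e) ∈ S ↔ (false, e) ∈ S)) ∧
      ∀ S', Q.IsFull S' → B ⊆ closureArrows S' → S ⊆ S' := by
  have hinf := Q.infinite_total
  obtain ⟨b, p', hbp⟩ := List.exists_cons_of_ne_nil hne
  have hb : b ∈ p := by simp [hbp]
  obtain ⟨E, hE, hEpq⟩ := Q.exists_boundary h.left h.right
  have hEp : ∀ e ∈ p, E true e - E false e = 1 := fun e he => by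
    rw [← hEpq, mult_eq_one h.nodup he, mult_eq_zero.2 (h.disjoint he), sub_zero]
  have hEq : ∀ e ∈ q, E true e - E false e = -1 := fun e he => by
    rw [← hEpq, mult_eq_one h.symm.nodup he, mult_eq_zero.2 (h.symm.disjoint he), zero_sub]
  have hE0 : ∀ e, e ∉ p → e ∉ q → E true e = E false e := fun e hp hq => by
    have := hEpq e
    rw [mult_eq_zero.2 hp, mult_eq_zero.2 hq] at this
    omega
  have hE0' : ∀ s, ∀ e ∉ {e | e ∈ p ∨ e ∈ q}, E s e = E (!s) e := fun s e he => by
    have he : ¬ (e ∈ p ∨ e ∈ q) := he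
    rw [not_or] at he
    have := hE0 e he.1 he.2
    cases s
    · exact this.symm
    · exact this
  set α := E true b with hα
  have hp1 : ∀ e ∈ p, E true e = α ∧ E false e = α - 1 := fun e he => by
    have h1 : E true e = α := h.eq_of_mem (F := fun s e => E s e) hE hE0' true he hb
    have h2 := hEp e he
    exact ⟨h1, by omega⟩
  have hq1 : ∀ e ∈ q, E true e = α - 1 ∧ E false e = α := fun e he => by
    have h1 : E true b = E false e :=
      h.eq_of_mem_of_mem (F := fun s e => E s e) hE hE0' false hb he
    have h2 := hEq e he
    exact ⟨by omega, by omega⟩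
  have hvals : ∀ e, E true e = α ∨ E true e = α - 1 := by
    have hiff : ∀ e, (E true e = α ∨ E true e = α - 1) ↔ (E false e = α ∨ E false e = α - 1) := by
      intro e
      by_cases hp : e ∈ p
      · simp [hp1 e hp]
      by_cases hq : e ∈ q
      · simp [hq1 e hq]
      rw [hE0 e hp hq]
    have hconst := fun e => Q.eq_of_next_eq (f := fun e => E true e = α ∨ E true e = α - 1)
      (fun s a => propext (by
        cases s
        · rw [hiff, hE, hiff]
        · rw [hE])) e b
    intro e
    exact cast (hconst e).symm (.inl rfl)
  have hα01 : α = 0 ∨ α = 1 := by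
    obtain ⟨e, he⟩ := Infinite.exists_notMem_finset (E true).support
    rw [Finsupp.notMem_support_iff] at he
    have := hvals e
    omega
  obtain ⟨s, hs⟩ : ∃ s : Bool, (s = true ∧ α = 1) ∨ (s = false ∧ α = 0) := by
    rcases hα01 with h | h
    · exact ⟨false, .inr ⟨rfl, h⟩⟩
    · exact ⟨true, .inl ⟨rfl, h⟩⟩
  classical
  let S : Set (Bool × Quiver.Total V) := {z | E z.1 z.2 ≠ 0}
  have hSp : ∀ e ∈ p, (s, e) ∈ S ∧ (!s, e) ∉ S := fun e he => by
    have := hp1 e he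
    rcases hs with ⟨rfl, h1⟩ | ⟨rfl, h1⟩ <;> simp [S, this, h1]
  have hSq : ∀ e ∈ q, (!s, e) ∈ S ∧ (s, e) ∉ S := fun e he => by
    have := hq1 e he
    rcases hs with ⟨rfl, h1⟩ | ⟨rfl, h1⟩ <;> simp [S, this, h1]
  have hS0 : ∀ e, e ∉ p → e ∉ q → ((true, e) ∈ S ↔ (false, e) ∈ S) := fun e hp hq => by
    simp [S, hE0 e hp hq]
  have hSn : ∀ s a, (s, Q.next s a) ∈ S ↔ (s, a) ∈ S := fun s a => by simp [S, hE]
  refine ⟨S, s, ⟨?_, hSn, ?_⟩, hSp, hSq, hS0, ?_⟩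
  · refine (Set.finite_univ.prod ((E true).support ∪ (E false).support).finite_toSet).subset ?_
    rintro ⟨t, e⟩ he
    refine ⟨trivial, ?_⟩
    cases t
    · simpa using .inr he
    · simpa using .inl he
  · -- outside `S`, the chain `E'` can only jump across `p` and `q`, so it is constant
    intro E' hE' hjump
    let β := E' (!s) b
    let F : Bool → Quiver.Total V → ℤ := fun t e => if (t, e) ∈ S then β else E' t e
    have hF : ∀ t a, F t (Q.next t a) = F t a := fun t a => by simp only [F, hSn, hE']
    have hF0 : ∀ e, e ∉ p → e ∉ q → F true e = F false e := by
      intro e hp hq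
      have := hS0 e hp hq
      by_cases h1 : (true, e) ∈ S
      · simp only [F, if_pos h1, if_pos (this.1 h1)]
      · have h2 := this.not.1 h1
        simp only [F, if_neg h1, if_neg h2]
        exact hjump e h1 h2
    have hF0' : ∀ t, ∀ e ∉ {e | e ∈ p ∨ e ∈ q}, F t e = F (!t) e := fun t e he => by
      have he : ¬ (e ∈ p ∨ e ∈ q) := he
      rw [not_or] at he
      have := hF0 e he.1 he.2
      cases t
      · exact this.symm
      · exact this
    have hFb : F (!s) b = β := if_neg (hSp b hb).2
    have hall : ∀ e, F true e = F false e := by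
      intro e
      have key : F s e = F (!s) e → F true e = F false e := by
        cases s
        · exact Eq.symm
        · exact id
      by_cases hp : e ∈ p
      · refine key ?_
        rw [h.eq_of_mem hF hF0' (!s) hp hb, hFb]
        exact if_pos (hSp e hp).1
      by_cases hq : e ∈ q
      · refine key ?_
        rw [← h.eq_of_mem_of_mem hF hF0' s hb hq, hFb]
        exact (if_pos (hSq e hq).1).symm
      exact hF0 e hp hq
    obtain ⟨e₀, he₀⟩ := Infinite.exists_notMem_finset ((E true).support ∪ (E' true).support)
    rw [Finset.mem_union, not_or, Finsupp.notMem_support_iff, Finsupp.notMem_support_iff] at he₀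
    have hFe₀ : F true e₀ = 0 := by
      simp [F, S, he₀.1, he₀.2]
    have hFz : ∀ t e, F t e = 0 := by
      intro t e
      have h1 : F true e = 0 := by
        rw [← hFe₀]
        refine Q.eq_of_next_eq (f := fun e => F true e) (fun t a => ?_) e e₀
        cases t
        · rw [hall, hF, hall]
        · exact hF true a
      cases t
      · rw [← hall, h1]
      · exact h1
    intro t e hte
    rw [← hFz t e]
    exact (if_neg hte).symm
  · rintro S' hS' hBS ⟨t, e⟩ hte
    by_contra hnot
    refine hte (hS'.fill E hE (fun a h1 h2 => hE0 a (fun hp => ?_) (fun hq => ?_)) t e hnot)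
    · rcases hBS (h.left_mem a hp) with h3 | h3
      · exact h1 h3
      · exact h2 h3
    · rcases hBS (h.right_mem a hq) with h3 | h3
      · exact h1 h3
      · exact h2 h3

/-! ### Disjoint rays imply cancellation -/

/-- If rays are disjoint, parallel paths are comparable: otherwise take a region without holes
that contains an incomparable pair, with a minimal number of polygons. A minimal incomparable pair
in this region is its boundary. The strand that enters the region at the first arrow of one of the
paths, followed backwards, leaves it at another boundary arrow. The ribbons along the strand cut the
region into smaller ones. -/
theorem RaysDisjoint.comparable [ContractibleSpace Q.Realization] (hZ : Q.RaysDisjoint)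
    {x y : V} {p q : List (Quiver.Total V)} (hp : IsPath x p y) (hq : IsPath x q y) :
    Q.Comparable y p q := by
  classical
  have hnt := Q.nonempty_total
  obtain ⟨D, h01, -, hray, hD⟩ := hZ.exists_wedge
  by_contra hcon
  -- an incomparable pair in `B` gives a region with incomparable pairs
  have hreg : ∀ B : Set (Quiver.Total V), Q.HasIncomparable B → ∃ x y p q S s,
      Q.IsMinPair B x y p q ∧ p ≠ [] ∧ Q.IsFull S ∧
      (∀ e ∈ p, (s, e) ∈ S ∧ (!s, e) ∉ S) ∧ (∀ e ∈ q, (!s, e) ∈ S ∧ (s, e) ∉ S) ∧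
      (∀ e, e ∉ p → e ∉ q → ((true, e) ∈ S ↔ (false, e) ∈ S)) ∧
      (∀ S', Q.IsFull S' → B ⊆ closureArrows S' → S ⊆ S') ∧
      Q.HasIncomparable (closureArrows S) := by
    intro B hB
    obtain ⟨x, y, p, q, h⟩ := hB.exists_isMinPair
    obtain ⟨x, y, p, q, h, hne⟩ : ∃ x y p q, Q.IsMinPair B x y p q ∧ p ≠ [] := by
      by_cases hp : p = []
      · refine ⟨x, y, q, p, h.symm, fun hq => h.not_comparable ?_⟩
        rw [hp, hq]
        exact .inl (.refl _)
      · exact ⟨x, y, p, q, h, hp⟩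
    obtain ⟨S, s, hS, h1, h2, h3, h4⟩ := h.exists_region hne
    exact ⟨x, y, p, q, S, s, h, hne, hS, h1, h2, h3, h4, x, y, p, q, h.left, h.right,
      fun e he => mem_closureArrows (h1 e he).1, fun e he => mem_closureArrows (h2 e he).1,
      h.not_comparable⟩
  have hex : ∃ n S, Q.IsFull S ∧ Q.HasIncomparable (closureArrows S) ∧ S.ncard = n := by
    obtain ⟨_, _, _, _, S, _, -, -, hS, -, -, -, -, h⟩ := hreg Set.univ
      ⟨x, y, p, q, hp, hq, by simp, by simp, hcon⟩
    exact ⟨_, S, hS, h, rfl⟩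
  clear hcon hp hq x y p q
  obtain ⟨S, hS, hSinc, hcard⟩ := Nat.find_spec hex
  have hmin : ∀ S', Q.IsFull S' → Q.HasIncomparable (closureArrows S') → S' ⊆ S → S' = S := by
    intro S' hS' hinc hsub
    refine Set.eq_of_subset_of_ncard_le hsub ?_ hS.finite
    rw [hcard]
    exact Nat.find_min' hex ⟨S', hS', hinc, rfl⟩
  clear hcard hex
  obtain ⟨x, y, p, q, S₁, s, h, hne, hS₁, hp, hq, hpq, hle, hinc⟩ := hreg _ hSinc
  obtain rfl := hmin S₁ hS₁ hinc (hle S hS (fun _ h => h))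
  -- pairs of paths in the region that avoid one arrow of its boundary are comparable
  have hsub : ∀ e, (e ∈ p ∨ e ∈ q) → ∀ x' y' p' q', IsPath x' p' y' → IsPath x' q' y' →
      (∀ a ∈ p', a ∈ closureArrows S₁ ∧ a ≠ e) → (∀ a ∈ q', a ∈ closureArrows S₁ ∧ a ≠ e) →
      Q.Comparable y' p' q' := by
    intro e he x' y' p' q' hp' hq' hp'S hq'S
    by_contra hnc
    obtain ⟨x₂, y₂, p₂, q₂, S₂, s₂, h₂, -, hS₂, -, -, hpq₂, hle₂, hinc₂⟩ :=
      hreg {a | a ∈ closureArrows S₁ ∧ a ≠ e} ⟨x', y', p', q', hp', hq', hp'S, hq'S, hnc⟩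
    obtain rfl := hmin S₂ hS₂ hinc₂ (hle₂ S₁ hS (fun _ h => h.1))
    have h3 := hpq₂ e (fun h => (h₂.left_mem e h).2 rfl) (fun h => (h₂.right_mem e h).2 rfl)
    have h4 : ∃ t, (t, e) ∈ S₂ ∧ (!t, e) ∉ S₂ := by
      rcases he with he | he
      · exact ⟨_, hp e he⟩
      · exact ⟨!s, by simpa using hq e he⟩
    obtain ⟨t, h4, h5⟩ := h4
    cases t
    · exact h5 (h3.2 h4)
    · exact h5 (h3.1 h4)
  clear hmin hreg hle
  obtain _ | ⟨b, p'⟩ := p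
  · exact hne rfl
  clear hne
  have hb := hp b (by simp)
  -- the strand through `b`, backwards
  let w : ℕ → Quiver.Total V × Bool := fun k => (Q.strand.symm ^ k) (b, !s)
  have hw1 : ∀ k, Q.strand (w (k + 1)) = w k := fun k => by
    simp only [w, pow_succ', Equiv.Perm.mul_apply, Equiv.apply_symm_apply]
  have hwj : ∀ j k, (Q.strand ^ j) (w (j + k)) = w k := by
    intro j k
    induction j with
    | zero => simp
    | succ j ih => rw [strand_pow_succ', show j + 1 + k = j + k + 1 by omega, hw1, ih]
  have hw0 : w 0 = (b, !s) := rfl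
  have hwmem : ∀ k, (∀ j, 0 < j → j ≤ k → (w j).1 ∉ b :: p' ∧ (w j).1 ∉ q) →
      ((w (k + 1)).2, (w (k + 1)).1) ∈ S₁ := by
    intro k
    have hstep : ∀ k, (!(w k).2, (w k).1) ∈ S₁ → ((w (k + 1)).2, (w (k + 1)).1) ∈ S₁ := by
      intro k hk
      rw [← hw1] at hk
      change (!!(w (k + 1)).2, Q.next (w (k + 1)).2 (w (k + 1)).1) ∈ S₁ at hk
      rwa [Bool.not_not, hS.next_mem] at hk
    induction k with
    | zero =>
      intro _
      refine hstep 0 ?_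
      rw [hw0, Bool.not_not]
      exact hb.1
    | succ k ih =>
      intro hk
      refine hstep (k + 1) ?_
      have h1 := ih fun j h0 hj => hk j h0 (by omega)
      have h2 := hk (k + 1) (by omega) le_rfl
      have h3 := hpq _ h2.1 h2.2
      cases h4 : (w (k + 1)).2
      · rw [h4] at h1
        exact h3.2 h1
      · rw [h4] at h1
        exact h3.1 h1
  have hwinj : ∀ i j, (w i).1 = (w j).1 → i = j := by
    intro i j hij
    wlog hlt : i ≤ j generalizing i j
    · exact (this j i hij.symm (by omega)).symm
    have := hwj (j - i) i
    rw [Nat.sub_add_cancel hlt] at this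
    have := hZ.strand_fst_inj (w j) (i := j - i) (j := 0) (by rw [this, hij]; rfl)
    omega
  -- it leaves the region
  have hhit : ∃ k, 0 < k ∧ ((w k).1 ∈ b :: p' ∨ (w k).1 ∈ q) := by
    by_contra! hno
    refine Set.infinite_of_injective_forall_mem (f := fun k => ((w (k + 1)).2, (w (k + 1)).1))
      (fun i j hij => ?_) (fun k => hwmem k fun j hj _ => hno j hj) hS.finite
    have := hwinj _ _ (congrArg Prod.snd hij)
    omega
  obtain ⟨hK0, hK⟩ := Nat.find_spec hhit
  have hKmin : ∀ k, 0 < k → k < Nat.find hhit → (w k).1 ∉ b :: p' ∧ (w k).1 ∉ q := by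
    intro k h0 hk
    have := Nat.find_min hhit hk
    simp only [h0, true_and, not_or] at this
    exact this
  generalize Nat.find hhit = K at *
  have hwK : ∀ k, 0 < k → k ≤ K → ((w k).2, (w k).1) ∈ S₁ := by
    intro k h0 hk
    obtain ⟨k, rfl⟩ := Nat.exists_eq_add_of_lt h0
    rw [zero_add] at *
    exact hwmem k fun j hj hjk => hKmin j hj (by omega)
  have hsign0 : ∀ m, (w (2 * m)).2 = !s := fun m => by
    have h1 := hwj (2 * m) 0
    rw [add_zero] at h1
    have h2 := Q.snd_strand_pow_two_mul m (w (2 * m))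
    rw [h1, hw0] at h2
    exact h2.symm
  have hsign1 : ∀ m, (w (2 * m + 1)).2 = s := fun m => by
    have h1 := hsign0 m
    rw [← hw1] at h1
    change (!(w (2 * m + 1)).2) = !s at h1
    simpa using h1
  -- the arrows of the polygons on the strand are in the region
  have hcompl : ∀ k c, 0 < k → k ≤ K → c ∈ Q.complement (w k).2 (w k).1 → ((w k).2, c) ∈ S₁ :=
    fun k c h0 hk hc => hS.mem_of_mem_cyc (Q.mem_cyc_of_mem_complement hc) (hwK k h0 hk)
  have hnn : ∀ v (l : List (Quiver.Total V)), 0 ≤ (l.map fun b => D b v).sum := fun v l => by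
    refine List.sum_nonneg fun z hz => ?_
    obtain ⟨b, -, rfl⟩ := List.mem_map.1 hz
    rcases h01 b v with h | h <;> simp [h]
  have hge : ∀ {y v} {p r : List (Quiver.Total V)}, (r.map fun b => D b v).sum = 0 →
      Q.Comparable y p r → Q.LoopGE y p r := by
    intro y v p r hr hc
    rcases hc with hc | ⟨k, hk⟩
    · exact hc
    · have h1 := Q.sum_eq_add_of_cls_eq (hD v) hk
      have h2 := hnn v p
      obtain rfl : k = 0 := by omega
      exact .of_cls_eq (by simpa using hk.symm)
  have hb0 : b.left = x := h.left.1
  have hp' : IsPath b.right p' y := h.left.2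
  have hnd := List.nodup_cons.1 h.nodup
  rcases Nat.even_or_odd' K with ⟨m, rfl | rfl⟩
  · -- the strand leaves the region through an arrow of `q`
    have hKS := hwK _ hK0 le_rfl
    rw [hsign0] at hKS
    have hzq : (w (2 * m)).1 ∈ q := hK.resolve_left fun h' => (hp _ h').2 hKS
    obtain ⟨q₁, q₂, hq12⟩ := List.append_of_mem hzq
    obtain ⟨z', hq₁, hq₂⟩ := isPath_append.1 (hq12 ▸ h.right)
    obtain rfl : (w (2 * m)).1.left = z' := hq₂.1
    have e1 : (Q.strand ^ (2 * m)) (w (2 * m)) = (b, !s) := hwj (2 * m) 0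
    have e2 : (Q.strand ^ (2 * m)) (Q.strand (w (2 * m))) = Q.strand (b, !s) := by
      rw [← strand_pow_succ', strand_pow_succ, e1]
    have hO : IsPath x (Q.ribbon m (w (2 * m))) (w (2 * m)).1.left := by
      have := Q.isPath_ribbon m (w (2 * m))
      rwa [e1, hb0] at this
    have hO' : IsPath b.right (Q.ribbon m (Q.strand (w (2 * m)))) (w (2 * m)).1.right := by
      have := Q.isPath_ribbon m (Q.strand (w (2 * m)))
      rw [e2] at this
      have e3 : (Q.strand (b, !s)).1.left = b.right := Q.left_next _ _
      have e4 : (Q.strand (w (2 * m))).1.left = (w (2 * m)).1.right := Q.left_next _ _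
      rwa [e3, e4] at this
    have hOmem : ∀ c ∈ Q.ribbon m (w (2 * m)), (!s, c) ∈ S₁ := by
      intro c hc
      obtain ⟨j, hj, hc⟩ := Q.mem_ribbon hc
      obtain ⟨d, rfl⟩ := Nat.exists_eq_add_of_lt hj
      rw [show 2 * (j + d + 1) = 2 * j + 2 * (d + 1) by ring, hwj] at hc
      have := hcompl _ c (by omega) (by omega) hc
      rwa [hsign0] at this
    have hOmem' : ∀ c ∈ Q.ribbon m (Q.strand (w (2 * m))), (s, c) ∈ S₁ := by
      intro c hc
      obtain ⟨j, hj, hc⟩ := Q.mem_ribbon hc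
      obtain ⟨d, rfl⟩ := Nat.exists_eq_add_of_lt hj
      rw [← strand_pow_succ', show 2 * (j + d + 1) = 2 * j + 1 + (2 * d + 1) by ring, hwj] at hc
      have := hcompl _ c (by omega) (by omega) hc
      rwa [hsign1] at this
    have hqmem : ∀ c ∈ q, c ∈ closureArrows S₁ := fun c hc => mem_closureArrows (hq c hc).1
    have c1 : Q.LoopGE (w (2 * m)).1.left q₁ (Q.ribbon m (w (2 * m))) := by
      refine hge (v := x) ?_ (hsub b (by simp) _ _ _ _ hq₁ hO (fun c hc => ?_) (fun c hc => ?_))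
      · have := sum_ribbon_eq_zero h01 hray hD m (w (2 * m))
        rwa [e1, hb0] at this
      · have hcq : c ∈ q := by simp [hq12, hc]
        exact ⟨hqmem c hcq, fun e => (e ▸ h.symm.disjoint hcq) (by simp)⟩
      · exact ⟨mem_closureArrows (hOmem c hc), fun e => hb.2 (e ▸ hOmem c hc)⟩
    have c2 : Q.Comparable y (Q.ribbon m (Q.strand (w (2 * m))) ++ q₂) p' := by
      refine hsub (w (2 * m)).1 (.inr hzq) _ _ _ _ (hO'.append hq₂.2) hp' (fun c hc => ?_)
        (fun c hc => ?_)
      · rcases List.mem_append.1 hc with hc | hc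
        · exact ⟨mem_closureArrows (hOmem' c hc), fun e => (hq _ hzq).2 (e ▸ hOmem' c hc)⟩
        · have hcq : c ∈ q := by simp [hq12, hc]
          refine ⟨hqmem c hcq, fun e => ?_⟩
          have := h.symm.nodup
          rw [hq12] at this
          exact (List.nodup_cons.1 (List.nodup_append.1 this).2.1).1 (e ▸ hc)
      · have hcp : c ∈ b :: p' := by simp [hc]
        exact ⟨mem_closureArrows (hp c hcp).1, fun e => h.disjoint hcp (e ▸ hzq)⟩
    have c3 : Q.LoopGE y q ([b] ++ (Q.ribbon m (Q.strand (w (2 * m))) ++ q₂)) := by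
      have h1 := LoopGE.append c1 (LoopGE.refl ((w (2 * m)).1 :: q₂)) hq₂
      rw [← hq12] at h1
      refine h1.trans (.of_cls_eq ?_)
      have h2 := Q.cls_ribbon_mul m (w (2 * m))
      rw [e1] at h2
      rw [cls_append, cls_cons, ← mul_assoc, h2, cls_append, cls_append, mul_assoc]
    have c4 : Q.Comparable y ([b] ++ (Q.ribbon m (Q.strand (w (2 * m))) ++ q₂)) ([b] ++ p') :=
      Comparable.append (.inl (.refl _)) c2 (hO'.append hq₂.2) hp'
    refine h.not_comparable ?_
    change Q.Comparable y ([b] ++ p') q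
    rcases c4 with c4 | c4
    · exact .inr (c3.trans c4)
    · exact c4.comparable c3
  · -- the strand leaves the region through an arrow of `p`
    have hKS := hwK _ hK0 le_rfl
    rw [hsign1] at hKS
    have hzp : (w (2 * m + 1)).1 ∈ b :: p' := hK.resolve_right fun h' => (hq _ h').2 hKS
    have hzb : (w (2 * m + 1)).1 ≠ b := fun e => by
      have := hwinj (2 * m + 1) 0 e
      omega
    have hzp' := (List.mem_cons.1 hzp).resolve_left hzb
    obtain ⟨p₁, p₂, rfl⟩ := List.append_of_mem hzp'
    obtain ⟨z', hp₁, hp₂⟩ := isPath_append.1 hp'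
    obtain rfl : (w (2 * m + 1)).1.left = z' := hp₂.1
    have e1 : (Q.strand ^ (2 * m + 1)) (w (2 * m + 1)) = (b, !s) := hwj (2 * m + 1) 0
    have e2 : (Q.strand ^ (2 * (m + 1))) (w (2 * m + 1)) = Q.strand (b, !s) := by
      rw [show 2 * (m + 1) = 2 * m + 1 + 1 by ring, strand_pow_succ, e1]
    have e3 : (Q.strand ^ (2 * m)) (Q.strand (w (2 * m + 1))) = (b, !s) := by
      rw [← strand_pow_succ', e1]
    have e4 : (Q.strand (b, !s)).1.left = b.right := Q.left_next _ _
    have hL : IsPath b.right (Q.ribbon (m + 1) (w (2 * m + 1))) (w (2 * m + 1)).1.left := by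
      have := Q.isPath_ribbon (m + 1) (w (2 * m + 1))
      rwa [e2, e4] at this
    have hO : IsPath x (Q.ribbon m (Q.strand (w (2 * m + 1)))) (w (2 * m + 1)).1.right := by
      have := Q.isPath_ribbon m (Q.strand (w (2 * m + 1)))
      have e5 : (Q.strand (w (2 * m + 1))).1.left = (w (2 * m + 1)).1.right := Q.left_next _ _
      rwa [e3, e5, hb0] at this
    have hLmem : ∀ c ∈ Q.ribbon (m + 1) (w (2 * m + 1)), (s, c) ∈ S₁ ∧ c ≠ b := by
      intro c hc
      obtain ⟨j, hj, hc⟩ := Q.mem_ribbon hc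
      obtain ⟨d, rfl⟩ : ∃ d, m = j + d := ⟨m - j, by omega⟩
      rw [show 2 * (j + d) + 1 = 2 * j + (2 * d + 1) by ring, hwj] at hc
      refine ⟨?_, ?_⟩
      · have := hcompl _ c (by omega) (by omega) hc
        rwa [hsign1] at this
      · rintro rfl
        have h5 : (Q.strand ^ (2 * d + 1)) (w (2 * d + 1)) = (c, !s) := hwj (2 * d + 1) 0
        rcases d with _ | d
        · have h6 := Q.nodup_cyc (w 1).2 (w 1).1
          rw [cyc_eq_complement] at h6
          refine (List.nodup_cons.1 (List.nodup_cons.1 h6).2).1 ?_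
          have h7 : Q.next (w 1).2 (w 1).1 = c := congrArg Prod.fst h5
          rw [h7]
          exact hc
        · refine hZ.strand_not_mem_cyc (w (2 * (d + 1) + 1)).1 (w (2 * (d + 1) + 1)).2
            (M := 2 * (d + 1) + 1) (by omega) ?_
          have h7 := congrArg Prod.fst h5
          change ((Q.strand ^ (2 * (d + 1) + 1)) (w (2 * (d + 1) + 1))).1 ∈ _
          rw [h7]
          exact Q.mem_cyc_of_mem_complement hc
    have hOmem : ∀ c ∈ Q.ribbon m (Q.strand (w (2 * m + 1))), (!s, c) ∈ S₁ := by
      intro c hc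
      obtain ⟨j, hj, hc⟩ := Q.mem_ribbon hc
      obtain ⟨d, rfl⟩ := Nat.exists_eq_add_of_lt hj
      rw [← strand_pow_succ', show 2 * (j + d + 1) + 1 = 2 * j + 1 + 2 * (d + 1) by ring, hwj] at hc
      have := hcompl _ c (by omega) (by omega) hc
      rwa [hsign0] at this
    have hpmem : ∀ c ∈ b :: (p₁ ++ (w (2 * m + 1)).1 :: p₂), c ∈ closureArrows S₁ :=
      fun c hc => mem_closureArrows (hp c hc).1
    have c1 : Q.LoopGE (w (2 * m + 1)).1.left p₁ (Q.ribbon (m + 1) (w (2 * m + 1))) := by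
      refine hge (v := b.right) ?_ (hsub b (by simp) _ _ _ _ hp₁ hL (fun c hc => ?_)
        (fun c hc => ?_))
      · have := sum_ribbon_eq_zero h01 hray hD (m + 1) (w (2 * m + 1))
        rwa [e2, e4] at this
      · exact ⟨hpmem c (by simp [hc]), fun e => hnd.1 (by simp [← e, hc])⟩
      · exact ⟨mem_closureArrows (hLmem c hc).1, (hLmem c hc).2⟩
    have c2 : Q.Comparable y (Q.ribbon m (Q.strand (w (2 * m + 1))) ++ p₂) q := by
      refine hsub b (by simp) _ _ _ _ (hO.append hp₂.2) h.right (fun c hc => ?_) (fun c hc => ?_)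
      · rcases List.mem_append.1 hc with hc | hc
        · exact ⟨mem_closureArrows (hOmem c hc), fun e => hb.2 (e ▸ hOmem c hc)⟩
        · exact ⟨hpmem c (by simp [hc]), fun e => hnd.1 (by simp [← e, hc])⟩
      · exact ⟨mem_closureArrows (hq c hc).1, fun e => h.disjoint (by simp) (e ▸ hc)⟩
    have c3 : Q.LoopGE y (b :: (p₁ ++ (w (2 * m + 1)).1 :: p₂))
        (Q.ribbon m (Q.strand (w (2 * m + 1))) ++ p₂) := by
      have h1 : Q.LoopGE y ([b] ++ (p₁ ++ (w (2 * m + 1)).1 :: p₂)) _ :=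
        LoopGE.append (z := b.right) (LoopGE.refl [b]) (LoopGE.append c1
          (LoopGE.refl ((w (2 * m + 1)).1 :: p₂)) hp₂) (hL.append hp₂)
      refine h1.trans ⟨1, ?_⟩
      have h2 := Q.cls_mul_ribbon_mul m (w (2 * m + 1))
      rw [e1] at h2
      rw [cls_append, cls_append, Q.cls_cons (w (2 * m + 1)).1 p₂, ← mul_assoc, ← mul_assoc, h2,
        mul_assoc, Q.loop_mul_cls hp₂.2, cls_append, pow_one, mul_assoc]
    refine h.not_comparable ?_
    rcases c2 with c2 | c2
    · exact .inl (c3.trans c2)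
    · exact c3.comparable c2

theorem RaysDisjoint.isCancellation [ContractibleSpace Q.Realization] (hZ : Q.RaysDisjoint) :
    Q.IsCancellation :=
  hZ.isCancellation_of_comparable fun _ _ _ _ hp hq => hZ.comparable hp hq

variable (Q)

/-! ### Weak equivalence of paths -/

/-- Two paths ending at `y` are weakly equivalent if they have the same class up to powers of the
loop at `y`. -/
def WeakEq (y : V) (p q : List (Quiver.Total V)) : Prop :=
  ∃ i j, Q.cls p * Q.loop y ^ i = Q.cls q * Q.loop y ^ j

variable {Q}

theorem WeakEq.refl (y : V) (p : List (Quiver.Total V)) : Q.WeakEq y p p := ⟨0, 0, rfl⟩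

theorem WeakEq.symm {y : V} {p q : List (Quiver.Total V)} (h : Q.WeakEq y p q) :
    Q.WeakEq y q p := let ⟨i, j, h⟩ := h; ⟨j, i, h.symm⟩

theorem WeakEq.trans {y : V} {p q r : List (Quiver.Total V)} (h : Q.WeakEq y p q)
    (h' : Q.WeakEq y q r) : Q.WeakEq y p r := by
  obtain ⟨i, j, h⟩ := h
  obtain ⟨k, l, h'⟩ := h'
  exact ⟨i + k, l + j, by
    rw [pow_add, ← mul_assoc, h, mul_assoc, ← pow_add, add_comm j, pow_add, ← mul_assoc, h',
      mul_assoc, ← pow_add]⟩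

theorem WeakEq.append_left {y : V} {p q : List (Quiver.Total V)} (h : Q.WeakEq y p q)
    (r : List (Quiver.Total V)) : Q.WeakEq y (r ++ p) (r ++ q) := by
  obtain ⟨i, j, h⟩ := h
  exact ⟨i, j, by rw [cls_append, cls_append, mul_assoc, mul_assoc, h]⟩

theorem WeakEq.append_right {y z : V} {p q r : List (Quiver.Total V)} (h : Q.WeakEq y p q)
    (hr : IsPath y r z) : Q.WeakEq z (p ++ r) (q ++ r) := by
  obtain ⟨i, j, h⟩ := h
  exact ⟨i, j, by
    rw [cls_append, cls_append, mul_assoc, mul_assoc, ← Q.loop_pow_mul_cls hr,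
      ← Q.loop_pow_mul_cls hr, ← mul_assoc, ← mul_assoc, h]⟩

variable (Q)

/-- The derivative by an arrow is a weak inverse of the arrow. -/
theorem exists_weak_inverse {x y : V} {l : List (Quiver.Total V)} (h : IsPath x l y) :
    ∃ l', IsPath y l' x ∧ Q.WeakEq x (l ++ l') [] ∧ Q.WeakEq y (l' ++ l) [] := by
  induction l generalizing x with
  | nil => exact ⟨[], h.symm, .refl _ _, .refl _ _⟩
  | cons e l ih =>
    obtain ⟨rfl, h⟩ := h
    obtain ⟨l', h', h1, h2⟩ := ih h
    have hd := Q.isPath_derivative true e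
    refine ⟨l' ++ Q.derivative true e, h'.append hd, ?_, ?_⟩
    · have : Q.WeakEq e.left ([e] ++ Q.derivative true e) [] :=
        ⟨0, 1, by rw [cls_append, Q.cls_mul_derivative]; simp⟩
      refine .trans ?_ this
      simpa using (h1.append_right hd).append_left [e]
    · have : Q.WeakEq e.right (Q.derivative true e ++ [e]) [] :=
        ⟨0, 1, by rw [cls_append, Q.derivative_mul_cls]; simp⟩
      refine .trans ?_ h2
      simpa using (this.append_right h).append_left l'

/-- Weak equivalence of the closed paths at `o`. -/
def weakSetoid (o : V) : Setoid {l : List (Quiver.Total V) // IsPath o l o} where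
  r p q := Q.WeakEq o p.1 q.1
  iseqv := ⟨fun _ => .refl _ _, .symm, .trans⟩

/-- The closed paths at `o` up to weak equivalence. They form a group under concatenation. -/
def WeakGroup (o : V) := Quotient (Q.weakSetoid o)

/-- The weak equivalence class of a closed path. -/
def WeakGroup.mk {o : V} {l : List (Quiver.Total V)} (h : IsPath o l o) : Q.WeakGroup o :=
  Quotient.mk (Q.weakSetoid o) ⟨l, h⟩

theorem WeakGroup.mk_eq_iff {o : V} {l l' : List (Quiver.Total V)} (h : IsPath o l o)
    (h' : IsPath o l' o) : WeakGroup.mk Q h = WeakGroup.mk Q h' ↔ Q.WeakEq o l l' :=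
  Quotient.eq (r := Q.weakSetoid o)

noncomputable instance (o : V) : Group (Q.WeakGroup o) :=
  letI : Mul (Q.WeakGroup o) := ⟨Quotient.map₂ (fun p q => ⟨p.1 ++ q.1, p.2.append q.2⟩)
    fun _ p' h q _ h' => (h.append_right q.2).trans (h'.append_left p'.1)⟩
  letI : One (Q.WeakGroup o) := ⟨WeakGroup.mk Q (l := []) rfl⟩
  letI : Inv (Q.WeakGroup o) := ⟨Quotient.map
    (fun p => ⟨(Q.exists_weak_inverse p.2).choose, (Q.exists_weak_inverse p.2).choose_spec.1⟩)
    fun p q h => by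
      obtain ⟨hp, hp1, hp2⟩ := (Q.exists_weak_inverse p.2).choose_spec
      obtain ⟨hq, hq1, hq2⟩ := (Q.exists_weak_inverse q.2).choose_spec
      have h1 := (hq1.append_left (Q.exists_weak_inverse p.2).choose).symm
      have h2 := ((h.append_left (Q.exists_weak_inverse p.2).choose).symm.trans hp2).append_right hq
      simp only [List.append_nil, List.append_assoc, List.nil_append] at h1 h2
      exact h1.trans h2⟩
  Group.ofLeftAxioms
    (by
      rintro ⟨p⟩ ⟨q⟩ ⟨r⟩
      exact congrArg (Quotient.mk _) (Subtype.ext (List.append_assoc _ _ _)))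
    (by rintro ⟨p⟩; rfl)
    (by
      rintro ⟨p⟩
      exact Quotient.sound (s := Q.weakSetoid o) (Q.exists_weak_inverse p.2).choose_spec.2.2)

theorem WeakGroup.mk_mul_mk {o : V} {l l' : List (Quiver.Total V)} (h : IsPath o l o)
    (h' : IsPath o l' o) : WeakGroup.mk Q h * WeakGroup.mk Q h' = WeakGroup.mk Q (h.append h') :=
  rfl

/-- On a contractible `|Q|`, parallel paths are weakly equivalent: the group of weak equivalence
classes of closed paths carries a flat connection, whose holonomy is trivial. -/
theorem weakEq_of_isPath [ContractibleSpace Q.Realization] {x y : V} {p q : List (Quiver.Total V)}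
    (hp : IsPath x p y) (hq : IsPath x q y) : Q.WeakEq y p q := by
  choose π hπ using fun z => Q.exists_isPath x z
  choose π' hπ' h1 h2 using fun z => Q.exists_weak_inverse (hπ z)
  have hg : ∀ {z z' l}, IsPath z l z' → IsPath x (π z ++ l ++ π' z') x :=
    fun h => ((hπ _).append h).append (hπ' _)
  let g : Quiver.Total V → Q.WeakGroup x := fun e =>
    WeakGroup.mk Q (hg (z := e.left) (l := [e]) ⟨rfl, rfl⟩)
  have key : ∀ {z z' l} (h : IsPath z l z'), (l.map g).prod = WeakGroup.mk Q (hg h) := by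
    intro z z' l h
    induction l generalizing z with
    | nil =>
      obtain rfl := h
      refine ((WeakGroup.mk_eq_iff Q _ _).2 ?_ : WeakGroup.mk Q (l := []) rfl = _)
      simpa using (h1 z).symm
    | cons e l ih =>
      obtain ⟨rfl, h⟩ := h
      rw [List.map_cons, List.prod_cons, ih h, WeakGroup.mk_mul_mk, WeakGroup.mk_eq_iff]
      have := ((h2 e.right).append_right (h.append (hπ' z'))).append_left (π e.left ++ [e])
      simpa using this
  obtain ⟨D, hD⟩ := Q.exists_vertex_potential g fun s a => by
    rw [key (Q.isPath_cyc s a)]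
    refine ((WeakGroup.mk_eq_iff Q _ _).2 ?_ : _ = WeakGroup.mk Q (l := []) rfl)
    have : Q.WeakEq a.left (Q.cyc s a) [] := ⟨0, 1, by rw [Q.cls_cyc_eq_loop]; simp⟩
    refine .trans ?_ (h1 a.left)
    simpa using (this.append_right (hπ' a.left)).append_left (π a.left)
  have h := mul_left_cancel ((hD _ _ _ hp).symm.trans (hD _ _ _ hq))
  rw [key hp, key hq, WeakGroup.mk_eq_iff] at h
  have hr : ∀ {l}, IsPath x l y → Q.WeakEq y (π' x ++ (π x ++ l ++ π' y) ++ π y) l := by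
    intro l hl
    have e1 := (h2 y).append_left (π' x ++ π x ++ l)
    have e2 := (h2 x).append_right hl
    simp only [List.append_assoc, List.append_nil, List.nil_append] at e1 e2 ⊢
    exact e1.trans e2
  exact (hr hp).symm.trans (((h.append_left (π' x)).append_right (hπ y)).trans (hr hq))

/-! ### Minimal paths -/

theorem two_le_length_derivative (s : Bool) (a : Quiver.Total V) :
    2 ≤ (Q.derivative s a).length := by
  have := Q.two_lt s a
  simp only [derivative, List.length_map, List.length_range]
  omega

theorem eq_singleton_of_cls_eq {e : Quiver.Total V} {l : List (Quiver.Total V)}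
    (h : Q.cls [e] = Q.cls l) : l = [e] := by
  have h := Q.reflTransGen_step_of_cls_eq h
  clear * - h
  induction h with
  | refl => rfl
  | tail _ hs ih =>
    obtain ⟨l, a, s, l', h2, -⟩ := hs
    have h3 := Q.two_le_length_derivative s a
    have h4 := congrArg List.length (ih.symm.trans h2)
    simp only [List.length_append, List.length_singleton] at h4
    omega

theorem cls_eq_of_step {p q : List (Quiver.Total V)} (h : Q.Step p q) : Q.cls p = Q.cls q := by
  obtain ⟨l, a, s, l', rfl, rfl⟩ := h
  simp only [cls_append, Q.cls_derivative s (!s)]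

theorem loop_pow_ne_one [Nonempty (Quiver.Total V)] (x : V) (n : ℕ) : Q.loop x ^ (n + 1) ≠ 1 := by
  intro h
  obtain ⟨a, rfl⟩ := Q.exists_left_eq x
  obtain ⟨l, -, hl, -⟩ := Q.exists_isPath_loop_pow a.left n
  rw [pow_succ', ← hl, ← Q.cls_cyc_eq_loop true, ← cls_append] at h
  simpa [cyc] using Q.eq_nil_of_cls_eq_one h

variable {Q}

theorem IsCancellation.mul_left_cancel (hC : Q.IsCancellation) {x y z : V}
    {r p q : List (Quiver.Total V)} (hr : IsPath x r y) (hp : IsPath y p z) (hq : IsPath y q z)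
    (h : Q.cls r * Q.cls p = Q.cls r * Q.cls q) : Q.cls p = Q.cls q :=
  (Q.isCancellation_iff.1 hC).2 x y z p q r hp hq hr h

theorem IsCancellation.mul_loop_pow_cancel [Nonempty (Quiver.Total V)] (hC : Q.IsCancellation)
    {x y : V} {p q : List (Quiver.Total V)} (hp : IsPath x p y) (hq : IsPath x q y) {n : ℕ}
    (h : Q.cls p * Q.loop y ^ n = Q.cls q * Q.loop y ^ n) : Q.cls p = Q.cls q := by
  obtain ⟨l, hl, hl', -⟩ := Q.exists_isPath_loop_pow y n
  exact (Q.isCancellation_iff.1 hC).1 x y y p q l hp hq hl (by rw [hl', h])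

/-- In the cancellation case, weakly equivalent paths are comparable. -/
theorem IsCancellation.comparable [ContractibleSpace Q.Realization] (hC : Q.IsCancellation)
    {x y : V} {p q : List (Quiver.Total V)} (hp : IsPath x p y) (hq : IsPath x q y) :
    Q.Comparable y p q := by
  have := Q.nonempty_total
  obtain ⟨i, j, h⟩ := Q.weakEq_of_isPath hp hq
  have key : ∀ {p q i j}, IsPath x p y → IsPath x q y → i ≤ j →
      Q.cls p * Q.loop y ^ i = Q.cls q * Q.loop y ^ j → Q.LoopGE y p q := by
    intro p q i j hp hq hij h
    obtain ⟨k, rfl⟩ := Nat.exists_eq_add_of_le hij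
    obtain ⟨l, hl, hl', -⟩ := Q.exists_isPath_loop_pow y k
    refine ⟨k, ?_⟩
    rw [← hl', ← cls_append]
    refine hC.mul_loop_pow_cancel hp (hq.append hl) (n := i) ?_
    rw [h, cls_append, hl', mul_assoc, ← pow_add, add_comm]
  rcases le_total i j with hij | hij
  · exact .inl (key hp hq hij h)
  · exact .inr (key hq hp hij h.symm)

variable (Q)

/-- A choice of a path from every vertex to `v` which is minimal in the sense that every path to
`v` is equivalent to it followed by a power of the loop at `v`. The weight of an arrow is the
exponent for the path that starts with this arrow. In the cancellation case these weights are the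
perfect matching of the corner at `v`. -/
structure MinimalPaths (v : V) where
  /-- The minimal path that starts at a given vertex. -/
  path : V → List (Quiver.Total V)
  /-- The weight of an arrow. -/
  weight : Quiver.Total V → ℕ
  isPath : ∀ x, IsPath x (path x) v
  path_self : path v = []
  cls_mul : ∀ e, Q.cls [e] * Q.cls (path e.right) = Q.cls (path e.left) * Q.loop v ^ weight e

variable {Q}

theorem IsCancellation.loop_pow_inj [Nonempty (Quiver.Total V)] (hC : Q.IsCancellation) {x y : V}
    {p : List (Quiver.Total V)} (hp : IsPath x p y) {m n : ℕ}
    (h : Q.cls p * Q.loop y ^ m = Q.cls p * Q.loop y ^ n) : m = n := by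
  wlog hmn : m < n generalizing m n
  · by_contra hne
    exact hne (this h.symm (by omega)).symm
  obtain ⟨k, rfl⟩ := Nat.exists_eq_add_of_lt hmn
  obtain ⟨l, hl, hl', -⟩ := Q.exists_isPath_loop_pow y (k + 1)
  refine absurd ?_ (Q.loop_pow_ne_one y k)
  rw [← hl', ← Q.cls_nil]
  refine hC.mul_left_cancel hp hl rfl ?_
  have h1 := hC.mul_loop_pow_cancel (n := m) (hp.append hl) hp (by
    rw [cls_append, hl', h, mul_assoc, ← pow_add]
    congr 2
    omega)
  rw [← cls_append, h1, cls_nil, mul_one]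

theorem IsCancellation.exists_minimalPaths [ContractibleSpace Q.Realization]
    (hC : Q.IsCancellation) (v : V) : Nonempty (Q.MinimalPaths v) := by
  have := Q.nonempty_total
  have hloop : ∀ l, IsPath v l v → ∃ d, Q.cls l = Q.loop v ^ d := by
    intro l hl
    rcases hC.comparable hl (q := []) rfl with ⟨k, hk⟩ | ⟨k, hk⟩
    · exact ⟨k, by simpa using hk⟩
    · obtain ⟨l', hl', hl'', -⟩ := Q.exists_isPath_loop_pow v k
      rw [← hl'', ← cls_append] at hk
      obtain ⟨rfl, -⟩ := List.append_eq_nil_iff.1 (Q.eq_nil_of_cls_eq_one hk.symm)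
      exact ⟨0, by simp⟩
  have hmin : ∀ x, ∃ μ, IsPath x μ v ∧
      ∀ p, IsPath x p v → ∃ k, Q.cls p = Q.cls μ * Q.loop v ^ k := by
    intro x
    -- closing the paths from `x` to `v` by a path `r`, their exponents become comparable
    obtain ⟨r, hr⟩ := Q.exists_isPath v x
    obtain ⟨p₀, hp₀⟩ := Q.exists_isPath x v
    have hne : ∃ d p, IsPath x p v ∧ Q.cls (r ++ p) = Q.loop v ^ d := by
      obtain ⟨d, hd⟩ := hloop _ (hr.append hp₀)
      exact ⟨d, p₀, hp₀, hd⟩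
    classical
    obtain ⟨μ, hμ, hμd⟩ := Nat.find_spec hne
    have hle := fun d hd => Nat.find_min' hne (m := d) hd
    generalize Nat.find hne = d₀ at hμd hle
    refine ⟨μ, hμ, fun p hp => ?_⟩
    rcases hC.comparable hp hμ with h | ⟨k, hk⟩
    · exact h
    · obtain ⟨d, hd⟩ := hloop _ (hr.append hp)
      have hle := hle d ⟨p, hp, hd⟩
      rw [cls_append, hk, ← mul_assoc, ← cls_append, hd, ← pow_add] at hμd
      have := hC.loop_pow_inj (x := v) (y := v) (p := []) rfl (by simpa using hμd)
      obtain rfl : k = 0 := by omega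
      exact ⟨0, by simp [hk]⟩
  choose μ hμ hμ' using hmin
  choose w hw using fun e : Quiver.Total V => hμ' e.left (e :: μ e.right) ⟨rfl, hμ _⟩
  refine ⟨⟨μ, w, hμ, ?_, fun e => by rw [← cls_cons, hw]⟩⟩
  obtain ⟨k, hk⟩ := hμ' v [] rfl
  obtain ⟨l', hl', hl'', -⟩ := Q.exists_isPath_loop_pow v k
  rw [← hl'', ← cls_append] at hk
  exact (List.append_eq_nil_iff.1 (Q.eq_nil_of_cls_eq_one hk.symm)).1

namespace MinimalPaths

variable {v : V} (M : Q.MinimalPaths v)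

theorem cls_mul_path {x y : V} {l : List (Quiver.Total V)} (h : IsPath x l y) :
    Q.cls l * Q.cls (M.path y) = Q.cls (M.path x) * Q.loop v ^ (l.map M.weight).sum := by
  induction l generalizing x with
  | nil => obtain rfl := h; simp
  | cons e l ih =>
    obtain ⟨rfl, h⟩ := h
    rw [cls_cons, mul_assoc, ih h, ← mul_assoc, M.cls_mul, mul_assoc, ← pow_add, List.map_cons,
      List.sum_cons]

theorem cls_eq {x : V} {l : List (Quiver.Total V)} (h : IsPath x l v) :
    Q.cls l = Q.cls (M.path x) * Q.loop v ^ (l.map M.weight).sum := by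
  simpa [M.path_self] using M.cls_mul_path h

theorem sum_path [Nonempty (Quiver.Total V)] (hC : Q.IsCancellation) (x : V) :
    ((M.path x).map M.weight).sum = 0 :=
  (hC.loop_pow_inj (M.isPath x) (m := 0) (by simpa using M.cls_eq (M.isPath x))).symm

theorem sum_cyc [Nonempty (Quiver.Total V)] (hC : Q.IsCancellation) (s : Bool)
    (a : Quiver.Total V) : ((Q.cyc s a).map M.weight).sum = 1 := by
  have h := M.cls_mul_path (Q.isPath_cyc s a)
  rw [Q.cls_cyc_eq_loop, Q.loop_mul_cls (M.isPath _)] at h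
  exact (hC.loop_pow_inj (M.isPath a.left) (m := 1) (by simpa using h)).symm

theorem weight_le_one [Nonempty (Quiver.Total V)] (hC : Q.IsCancellation) (a : Quiver.Total V) :
    M.weight a ≤ 1 := by
  have := M.sum_cyc hC true a
  rw [cyc, List.map_cons, List.sum_cons] at this
  omega

/-- Every cycle contains at most one arrow of weight `1`. -/
theorem eq_of_mem_cyc [Nonempty (Quiver.Total V)] (hC : Q.IsCancellation) {s : Bool}
    {a b : Quiver.Total V} (ha : M.weight a = 1) (hb : M.weight b = 1) (h : b ∈ Q.cyc s a) :
    b = a := by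
  have h1 := M.sum_cyc hC s a
  rw [cyc, List.map_cons, List.sum_cons, ha] at h1
  rcases List.mem_cons.1 h with h | h
  · exact h
  · have := List.single_le_sum (l := (Q.derivative s a).map M.weight) (fun _ _ => Nat.zero_le _)
      _ (List.mem_map_of_mem h)
    omega

theorem sum_derivative [Nonempty (Quiver.Total V)] (hC : Q.IsCancellation) (s : Bool)
    (a : Quiver.Total V) : M.weight a + ((Q.derivative s a).map M.weight).sum = 1 := by
  simpa [cyc] using M.sum_cyc hC s a

theorem weight_next [Nonempty (Quiver.Total V)] (hC : Q.IsCancellation) (s : Bool)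
    (a : Quiver.Total V) : M.weight a + M.weight (Q.next s a) ≤ 1 := by
  have := M.sum_derivative hC s a
  rw [derivative_eq_cons, List.map_cons, List.sum_cons] at this
  omega

theorem weight_eq_zero [Nonempty (Quiver.Total V)] {e : Quiver.Total V} (he : e.right = v) :
    M.weight e = 0 := by
  have h := M.cls_eq (l := [e]) ⟨rfl, he⟩
  simp only [List.map_cons, List.map_nil, List.sum_singleton] at h
  rcases Nat.eq_zero_or_eq_succ_pred (M.weight e) with h0 | h0
  · exact h0
  · rw [h0, pow_succ] at h
    obtain ⟨a, rfl⟩ := Q.exists_left_eq v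
    obtain ⟨l, -, hl, -⟩ := Q.exists_isPath_loop_pow a.left (M.weight e).pred
    rw [← hl, ← Q.cls_cyc_eq_loop true, ← cls_append, ← cls_append] at h
    have := congrArg List.length (Q.eq_singleton_of_cls_eq h)
    have h2 := Q.two_le_length_derivative true a
    simp only [List.length_append, cyc, List.length_cons] at this
    change _ = 0 + 1 at this
    omega

theorem weight_eq_one [Nonempty (Quiver.Total V)] (hC : Q.IsCancellation) {e : Quiver.Total V}
    (he : e.left = v) : M.weight e = 1 := by
  have h := M.cls_mul e
  have h1 := M.weight_le_one hC e
  rw [he, M.path_self, cls_nil, one_mul, ← cls_cons] at h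
  rcases Nat.le_one_iff_eq_zero_or_eq_one.1 h1 with h0 | h0
  · rw [h0, pow_zero] at h
    simpa using Q.eq_nil_of_cls_eq_one h
  · exact h0

/-- The paths of weight `0` to `v` are all equivalent to the chosen ones. -/
theorem cls_eq_iff [Nonempty (Quiver.Total V)] (hC : Q.IsCancellation) {x : V}
    {l : List (Quiver.Total V)} (h : IsPath x l v) :
    Q.cls l = Q.cls (M.path x) ↔ (l.map M.weight).sum = 0 := by
  rw [M.cls_eq h]
  constructor
  · intro h
    exact hC.loop_pow_inj (M.isPath x) (n := 0) (by simpa using h)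
  · intro h
    simp [h]

/-- A closed path of weight `0` is constant. -/
theorem eq_nil_of_sum_eq_zero [Nonempty (Quiver.Total V)] (hC : Q.IsCancellation) {x : V}
    {l : List (Quiver.Total V)} (h : IsPath x l x) (h0 : (l.map M.weight).sum = 0) : l = [] := by
  have h1 := M.cls_mul_path h
  rw [h0, pow_zero, mul_one] at h1
  exact Q.eq_nil_of_cls_eq_one
    ((Q.isCancellation_iff.1 hC).1 x x v l [] (M.path x) h rfl (M.isPath x) (by simpa using h1))

/-- Two arrows of weight `0` leaving the same vertex are linked by entering arrows of weight `1`: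
a minimal path starting with one of them is transformed into a minimal path starting with the other
one by replacing derivatives, and the first arrow only changes at the derivative by an arrow of
weight `1` that enters this vertex. -/
theorem mem_of_linked [Nonempty (Quiver.Total V)] (hC : Q.IsCancellation) {w : V}
    {T : Set (Quiver.Total V)} (hT : ∀ s a, a.right = w → M.weight a = 1 → Q.next s a ∈ T →
      Q.next (!s) a ∈ T) {c c' : Quiver.Total V} (hc : c.left = w) (hc' : c'.left = w)
    (h0 : M.weight c = 0) (h0' : M.weight c' = 0) (h : c ∈ T) : c' ∈ T := by
  have key : ∀ e : Quiver.Total V, e.left = w → M.weight e = 0 →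
      IsPath w (e :: M.path e.right) v ∧ ((e :: M.path e.right).map M.weight).sum = 0 :=
    fun e he h0 => ⟨⟨he, M.isPath _⟩, by rw [List.map_cons, List.sum_cons, h0, M.sum_path hC]⟩
  obtain ⟨h1, h2⟩ := key c hc h0
  obtain ⟨h1', h2'⟩ := key c' hc' h0'
  have h3 := Q.reflTransGen_step_of_cls_eq
    (((M.cls_eq_iff hC h1).2 h2).trans ((M.cls_eq_iff hC h1').2 h2').symm)
  suffices H : ∀ q, Relation.ReflTransGen Q.Step (c :: M.path c.right) q →
      IsPath w q v ∧ (q.map M.weight).sum = 0 ∧ ∃ e l, q = e :: l ∧ e ∈ T by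
    obtain ⟨-, -, e, l, he, heT⟩ := H _ h3
    rwa [(List.cons.inj he).1]
  intro q hq
  induction hq with
  | refl => exact ⟨h1, h2, _, _, rfl, h⟩
  | @tail p q _ hpq ih =>
    obtain ⟨hp, hp0, e, l₀, hpe, he⟩ := ih
    have hcls := Q.cls_eq_of_step hpq
    have hq := (Q.isPath_iff_of_cls_eq hcls w v).1 hp
    refine ⟨hq, (M.cls_eq_iff hC hq).1 (hcls.symm.trans ((M.cls_eq_iff hC hp).2 hp0)), ?_⟩
    obtain ⟨l, a, s, l', rfl, rfl⟩ := hpq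
    cases l with
    | cons b l =>
      obtain rfl := (List.cons.inj hpe).1
      exact ⟨b, _, rfl, he⟩
    | nil =>
      have h5 := M.sum_derivative hC s a
      simp only [List.nil_append, List.map_append, List.sum_append] at hp0
      rw [List.nil_append, derivative_eq_cons] at hpe hp
      obtain rfl := (List.cons.inj hpe).1
      refine ⟨Q.next (!s) a, Q.complement (!s) a ++ l', by
        rw [List.nil_append, derivative_eq_cons, List.cons_append], ?_⟩
      exact hT s a ((Q.left_next s a).symm.trans hp.1) (by omega) he

end MinimalPaths

/-! ### Arrows of weight one around a vertex -/

namespace MinimalPaths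

variable {v : V} (M : Q.MinimalPaths v)

/-- Two paths of weight `0` that start with an arrow `c` of weight `0` leaving `w` differ by a chain
of polygons that do not meet the polygons whose arrow of weight `1` enters `w`: a derivative in such
a path is not the one by an arrow entering `w`, since the path does not return to `w`. -/
theorem exists_boundary [Nonempty (Quiver.Total V)] (hC : Q.IsCancellation) {c : Quiver.Total V}
    (hc : M.weight c = 0) (hins : ∀ a : Quiver.Total V, a.right = c.left → M.weight a = 1)
    {p q : List (Quiver.Total V)} (hp : IsPath c.right p v) (hq : IsPath c.right q v)
    (hp0 : (p.map M.weight).sum = 0) (hq0 : (q.map M.weight).sum = 0) :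
    ∃ E : Bool → Quiver.Total V →₀ ℤ, (∀ s a, E s (Q.next s a) = E s a) ∧
      (mult p - mult q = E true - E false) ∧
      ∀ s a, a.right = c.left → E s a = 0 := by
  have h := Q.reflTransGen_step_of_cls_eq
    (((M.cls_eq_iff hC hp).2 hp0).trans ((M.cls_eq_iff hC hq).2 hq0).symm)
  suffices H : (IsPath c.right q v ∧ (q.map M.weight).sum = 0) ∧
      ∃ E : Bool → Quiver.Total V →₀ ℤ, (∀ s a, E s (Q.next s a) = E s a) ∧
      (mult p - mult q = E true - E false) ∧
      ∀ s a, a.right = c.left → E s a = 0 from H.2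
  clear hq hq0
  induction h with
  | refl => exact ⟨⟨hp, hp0⟩, 0, by simp, by simp, by simp⟩
  | @tail q r _ hqr ih =>
    obtain ⟨⟨hq, hq0⟩, E, hE, hpq, hE0⟩ := ih
    have hcls := Q.cls_eq_of_step hqr
    have hr := (Q.isPath_iff_of_cls_eq hcls _ v).1 hq
    refine ⟨⟨hr, (M.cls_eq_iff hC hr).1 (hcls.symm.trans ((M.cls_eq_iff hC hq).2 hq0))⟩, ?_⟩
    obtain ⟨l, a, s, l', rfl, rfl⟩ := hqr
    simp only [List.map_append, List.sum_append] at hq0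
    have hder := M.sum_derivative hC s a
    have ha : M.weight a = 1 := by omega
    have haw : a.right ≠ c.left := by
      intro haw
      rw [List.append_assoc] at hq
      obtain ⟨z, hz, hz'⟩ := isPath_append.1 hq
      rw [derivative_eq_cons] at hz'
      have hz1 : z = c.left := (hz'.1.symm.trans (Q.left_next s a)).trans haw
      subst hz1
      have := M.eq_nil_of_sum_eq_zero hC (l := c :: l) ⟨rfl, hz⟩ (by
        rw [List.map_cons, List.sum_cons]; omega)
      exact List.cons_ne_nil _ _ this
    have hcyc : ∀ t b, b.right = c.left → mult (Q.cyc t a) b = 0 := fun t b hb =>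
      mult_eq_zero.2 fun h => haw (M.eq_of_mem_cyc hC ha (hins b hb) h ▸ hb)
    have hder' : ∀ t, mult (Q.derivative t a) = mult (Q.cyc t a) - Finsupp.single a 1 := fun t => by
      rw [cyc, mult_cons, add_sub_cancel_left]
    cases s
    · refine ⟨fun t => E t - mult (Q.cyc t a), fun t b => ?_, ?_, fun t b hb => ?_⟩
      · simp [hE, Q.mult_cyc_next t t a b rfl]
      · simp only [mult_append, hder', Bool.not_false] at hpq ⊢
        rw [← sub_eq_zero] at hpq ⊢
        rw [← hpq]
        abel
      · simp [hE0 t b hb, hcyc t b hb]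
    · refine ⟨fun t => E t + mult (Q.cyc t a), fun t b => ?_, ?_, fun t b hb => ?_⟩
      · simp [hE, Q.mult_cyc_next t t a b rfl]
      · simp only [mult_append, hder', Bool.not_true] at hpq ⊢
        rw [← sub_eq_zero] at hpq ⊢
        rw [← hpq]
        abel
      · simp [hE0 t b hb, hcyc t b hb]

/-- The arrows that enter a vertex cannot all have weight `1`. Otherwise, going around the vertex,
the minimal paths starting with the successive arrows leaving it would sweep out a finite nonzero
chain of polygons with zero boundary, while there are infinitely many arrows. -/
theorem exists_weight_ne_one [ContractibleSpace Q.Realization] (hC : Q.IsCancellation) (w : V) :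
    ∃ a : Quiver.Total V, a.right = w ∧ M.weight a ≠ 1 := by
  classical
  have := Q.nonempty_total
  have := Q.infinite_total
  by_contra! hins
  have hout : ∀ c : Quiver.Total V, c.left = w → M.weight c = 0 := by
    rintro c rfl
    have h1 := hins _ (Q.left_symm true c)
    have h2 := M.weight_next hC true ((Q.next true).symm c)
    rw [Equiv.apply_symm_apply] at h2
    omega
  have hE : ∀ a : Quiver.Total V, ∃ E : Bool → Quiver.Total V →₀ ℤ, a.right = w →
      (∀ s a, E s (Q.next s a) = E s a) ∧
      (mult (Q.next true a :: M.path (Q.next true a).right) -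
        mult (Q.next false a :: M.path (Q.next false a).right) = E true - E false) ∧
      ∀ s b, b.right = w → E s b = if b = a then 1 else 0 := by
    intro a
    by_cases haw : a.right = w
    swap
    · exact ⟨0, fun h => absurd h haw⟩
    have hal : ∀ s, (Q.next s a).left = w := fun s => (Q.left_next s a).trans haw
    have ha := hins a haw
    -- both minimal paths are compared with the derivatives by `a`, continued minimally
    have hd : ∀ s, ∃ E : Bool → Quiver.Total V →₀ ℤ, (∀ s a, E s (Q.next s a) = E s a) ∧
        (mult (M.path (Q.next s a).right) - mult (Q.complement s a ++ M.path a.left) =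
          E true - E false) ∧ ∀ t b, b.right = (Q.next s a).left → E t b = 0 := fun s =>
      M.exists_boundary hC (hout _ (hal s)) (fun b hb => hins b (hb.trans (hal s))) (M.isPath _)
        ((Q.isPath_complement s a).append (M.isPath _)) (M.sum_path hC _) (by
          have := M.sum_derivative hC s a
          rw [derivative_eq_cons, List.map_cons, List.sum_cons] at this
          rw [List.map_append, List.sum_append, M.sum_path hC]
          omega)
    choose E hE1 hE2 hE3 using hd
    refine ⟨fun t => E true t - E false t + mult (Q.cyc t a), fun _ => ⟨fun s b => ?_, ?_, ?_⟩⟩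
    · simp [hE1, Q.mult_cyc_next s s a b rfl]
    · have h1 := hE2 true
      have h2 := hE2 false
      rw [sub_eq_iff_eq_add] at h1 h2
      simp only [mult_cons, h1, h2, cyc, derivative_eq_cons, mult_append]
      abel
    · intro s b hb
      simp only [Finsupp.add_apply, Finsupp.sub_apply, hE3 _ s b (hb.trans (hal _).symm), sub_self,
        zero_add]
      split_ifs with hba
      · subst hba
        exact mult_eq_one (Q.nodup_cyc s b) List.mem_cons_self
      · exact mult_eq_zero.2 fun h => hba (M.eq_of_mem_cyc hC ha (hins b hb) h)
  choose E hE using hE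
  let F : Bool → Quiver.Total V →₀ ℤ := fun s => ∑ a ∈ Q.ins w, E a s
  have hF1 : ∀ s a, F s (Q.next s a) = F s a := fun s a => by
    simp only [F, Finsupp.finsetSum_apply]
    exact Finset.sum_congr rfl fun b hb => (hE b (Q.mem_ins.1 hb)).1 s a
  have hF2 : F true = F false := by
    rw [← sub_eq_zero, ← Finset.sum_sub_distrib,
      Finset.sum_congr rfl fun b hb => ((hE b (Q.mem_ins.1 hb)).2.1).symm, Finset.sum_sub_distrib,
      Q.sum_ins_next (fun c => mult (c :: M.path c.right)) true false, sub_self]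
  obtain ⟨c, hc⟩ := Q.exists_right_eq w
  have hF3 : F true c = 1 := by
    simp only [F, Finsupp.finsetSum_apply]
    rw [Finset.sum_congr rfl fun b hb => (hE b (Q.mem_ins.1 hb)).2.2 true c hc]
    simp [hc]
  have hF4 : ∀ s a, F true (Q.next s a) = F true a := fun s a => by
    cases s
    · rw [hF2, hF1]
    · rw [hF1]
  obtain ⟨b, hb⟩ := Infinite.exists_notMem_finset (F true).support
  rw [Finsupp.mem_support_iff, not_not, Q.eq_of_next_eq hF4 b c, hF3] at hb
  exact one_ne_zero hb

/-- At a vertex `w ≠ v`, exactly one corner of positive polygons has no arrow of weight `1`. -/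
theorem sum_ins [ContractibleSpace Q.Realization] (hC : Q.IsCancellation) (w : V)
    [Decidable (w = v)] :
    ∑ a ∈ Q.ins w, ((1 : ℤ) - M.weight a - M.weight (Q.next true a)) = if w = v then 0 else 1 := by
  classical
  have := Q.nonempty_total
  split_ifs with hw
  · subst hw
    refine Finset.sum_eq_zero fun a ha => ?_
    rw [M.weight_eq_zero (Q.mem_ins.1 ha),
      M.weight_eq_one hC ((Q.left_next true a).trans (Q.mem_ins.1 ha))]
    simp
  have hval : ∀ s a, ((1 : ℤ) - M.weight a - M.weight (Q.next s a)) =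
      if M.weight a = 0 ∧ M.weight (Q.next s a) = 0 then 1 else 0 := fun s a => by
    have := M.weight_next hC s a
    split_ifs <;> omega
  have huniq : ∀ a b : Quiver.Total V, a.right = w → b.right = w → M.weight a = 0 →
      M.weight b = 0 → M.weight (Q.next true a) = 0 → M.weight (Q.next true b) = 0 → a = b := by
    intro a b ha hb ha0 hb0 ha1 hb1
    -- the arrows reached from `next true a` by passing entering arrows of weight `1`
    let T : Set (Quiver.Total V) := {c | ∃ k : ℕ,
      c = Q.next true ((((Q.next false)⁻¹ * Q.next true) ^ k) a) ∧
      ∀ j, 0 < j → j ≤ k → M.weight ((((Q.next false)⁻¹ * Q.next true) ^ j) a) = 1}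
    have hmem := M.mem_of_linked hC (w := w) (T := T) ?_ ((Q.left_next true a).trans ha)
      ((Q.left_next true b).trans hb) ha1 hb1 ⟨0, rfl, by omega⟩
    · obtain ⟨k, hk, hk'⟩ := hmem
      rw [(Q.next true).injective.eq_iff] at hk
      rcases Nat.eq_zero_or_pos k with rfl | hk0
      · exact hk.symm
      · have := hk' k hk0 le_rfl
        rw [← hk, hb0] at this
        omega
    · rintro s c hcw hc ⟨k, hk, hk'⟩
      cases s
      · refine ⟨k + 1, ?_⟩
        have e : (((Q.next false)⁻¹ * Q.next true) ^ (k + 1)) a = c := by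
          rw [pow_succ', Equiv.Perm.mul_apply, Equiv.Perm.mul_apply, ← hk]
          simp
        refine ⟨by rw [e]; rfl, fun j hj hjk => ?_⟩
        rcases Nat.lt_or_eq_of_le hjk with hjk | rfl
        · exact hk' j hj (by omega)
        · rw [e, hc]
      · rw [(Q.next true).injective.eq_iff] at hk
        cases k with
        | zero =>
          rw [pow_zero, Equiv.Perm.one_apply] at hk
          rw [hk, ha0] at hc
          omega
        | succ k =>
          refine ⟨k, ?_, fun j hj hjk => hk' j hj (by omega)⟩
          rw [hk, pow_succ', Equiv.Perm.mul_apply, Equiv.Perm.mul_apply]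
          simp
  have hex : ∃ a : Quiver.Total V, a.right = w ∧ M.weight a = 0 ∧ M.weight (Q.next true a) = 0 := by
    by_contra! hno
    have h1 : ∀ a ∈ Q.ins w, ((1 : ℤ) - M.weight a - M.weight (Q.next true a)) = 0 := fun a ha => by
      have := hno a (Q.mem_ins.1 ha)
      rw [hval, if_neg (by tauto)]
    -- the sum over the negative corners is the same
    have h2 : ∀ a ∈ Q.ins w, ((1 : ℤ) - M.weight a - M.weight (Q.next false a)) = 0 := by
      rw [← Finset.sum_eq_zero_iff_of_nonneg fun a _ => by
        have := M.weight_next hC false a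
        omega]
      rw [← Finset.sum_eq_zero h1]
      simp only [Finset.sum_sub_distrib]
      rw [Q.sum_ins_next (fun c => (M.weight c : ℤ)) false true]
    obtain ⟨a, ha, ha1⟩ := M.exists_weight_ne_one hC w
    have hall : ∀ b : Quiver.Total V, b.right = w → M.weight b = 0 := by
      intro b hb
      have := Q.eq_of_right_eq (fun c => if c.right = w then M.weight c else 0)
        (fun c d hcd => ?_) (hb.trans ha.symm)
      · rw [if_pos hb, if_pos ha] at this
        have := M.weight_le_one hC a
        omega
      · have hr : c.right = d.right := by rw [← Q.left_next true c, hcd, Q.left_next]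
        simp only [hr]
        split_ifs with hd
        · have e1 := h1 c (Q.mem_ins.2 (hr.trans hd))
          have e2 := h2 d (Q.mem_ins.2 hd)
          rw [hcd] at e1
          omega
        · rfl
    -- the first arrow of the minimal path leaving `w` has weight `0`
    have hp := M.isPath w
    have hp0 := M.sum_path hC w
    cases h : M.path w with
    | nil => rw [h] at hp; exact hw hp
    | cons e l =>
      rw [h] at hp hp0
      rw [List.map_cons, List.sum_cons] at hp0
      have e1 := h1 ((Q.next true).symm e) (Q.mem_ins.2 ((Q.left_symm true e).trans hp.1))
      rw [hall _ ((Q.left_symm true e).trans hp.1), Equiv.apply_symm_apply] at e1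
      omega
  obtain ⟨a, ha, ha0, ha1⟩ := hex
  rw [Finset.sum_eq_single_of_mem a (Q.mem_ins.2 ha)]
  · rw [ha0, ha1]; simp
  · intro b hb hba
    rw [hval, if_neg]
    rintro ⟨h0, h1⟩
    exact hba (huniq b a (Q.mem_ins.1 hb) ha h0 ha0 h1 ha1)

end MinimalPaths

/-! ### Intersections of rays in the cancellation case -/

/-- The difference of the weights of the minimal paths to the two ends of `a₀` gives a function on
the states of the strands that jumps only where a strand leaves `(a₀, true)` or reaches
`(a₀, false)`, and whose values on the two states of an arrow differ by at most `1`. -/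
theorem IsCancellation.exists_strand_potential [ContractibleSpace Q.Realization]
    (hC : Q.IsCancellation) (a₀ : Quiver.Total V) [DecidableEq (Quiver.Total V)] :
    ∃ Φ : Quiver.Total V × Bool → ℤ, (∀ b, |Φ (b, true) - Φ (b, false)| ≤ 1) ∧
      Φ (a₀, true) - Φ (a₀, false) = 1 ∧
      ∀ σ, Φ (Q.strand σ) = Φ σ + (if σ = (a₀, true) then 1 else 0) -
        if Q.strand σ = (a₀, false) then 1 else 0 := by
  classical
  have := Q.nonempty_total
  obtain ⟨M⟩ := hC.exists_minimalPaths a₀.left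
  obtain ⟨N⟩ := hC.exists_minimalPaths a₀.right
  let f : Quiver.Total V → ℤ := fun a => M.weight a - N.weight a
  have hcyc : ∀ s a, ((Q.cyc s a).map f).sum = 0 := fun s a => by
    have key : ∀ w : Quiver.Total V → ℕ, ((Q.cyc s a).map fun b => (w b : ℤ)).sum =
        ((Q.cyc s a).map w).sum := fun w => by
      rw [Nat.cast_list_sum, List.map_map]
      rfl
    rw [sum_map_sub, key, key, M.sum_cyc hC, N.sum_cyc hC, sub_self]
  let i : Quiver.Total V → ℤ := fun a => if a = a₀ then 1 else 0
  obtain ⟨u, hu⟩ := Q.exists_arrow_potential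
    (fun s a => bif s then f a + i a - i (Q.next true a) else - f (Q.next false a)) (by
      rintro (_ | _) a
      · have := Q.sum_cyc_next f false a
        rw [hcyc] at this
        simp only [cond_false]
        rw [← neg_zero, ← this, List.sum_neg, List.map_map]
        rfl
      · simp only [cond_true]
        rw [sum_map_sub, List.sum_map_add, hcyc, Q.sum_cyc_next i]
        simp) (fun x => by
      have hi : ∑ a ∈ Q.ins x, i a = if x = a₀.right then 1 else 0 := by
        simp [i, eq_comm]
      have hi' : ∑ a ∈ Q.ins x, i (Q.next true a) = if x = a₀.left then 1 else 0 := by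
        have : ∀ a, i (Q.next true a) = if a = (Q.next true).symm a₀ then 1 else 0 := fun a => by
          simp only [i, Equiv.eq_symm_apply]
        simp [this, left_symm, eq_comm]
      have hM := M.sum_ins hC x
      have hN := N.sum_ins hC x
      have hM' := Q.sum_ins_next (fun c => (M.weight c : ℤ)) true false x
      have hN' := Q.sum_ins_next (fun c => (N.weight c : ℤ)) true false x
      simp only [cond_true, cond_false, Finset.sum_sub_distrib, Finset.sum_add_distrib,
        Finset.sum_neg_distrib, hi, hi', f] at hM hN ⊢
      split_ifs at * <;> omega)
  have hf : ∀ b, |f b| ≤ 1 := fun b => by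
    have h1 := M.weight_le_one hC b
    have h2 := N.weight_le_one hC b
    rw [abs_le]
    constructor <;> simp only [f] <;> omega
  have hf0 : f a₀ = 1 := by
    simp [f, M.weight_eq_one hC rfl, N.weight_eq_zero rfl]
  refine ⟨fun σ => u σ.1 + bif σ.2 then f σ.1 else 0, fun b => by simpa using hf b,
    by simpa using hf0, ?_⟩
  rintro ⟨a, _ | _⟩
  · simp [strand_apply, hu]
  · simp only [strand_apply, hu, cond_true, i, Bool.not_true, cond_false, Prod.mk.injEq, and_true]
    ring

/-- In the cancellation case rays are disjoint. With the function of `exists_strand_potential`, the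
values on the zig ray and on the zag ray of `a` are constant and differ by `2`, which is impossible
at a common arrow; a return of one of the rays to `a` contradicts the values at `a` itself. -/
theorem IsCancellation.raysDisjoint [ContractibleSpace Q.Realization] (hC : Q.IsCancellation) :
    Q.RaysDisjoint := by
  classical
  intro a
  obtain ⟨Φ, hΦ1, hΦ0, hΦ⟩ := hC.exists_strand_potential a
  -- the values along the two rays, as long as they do not return to `a`
  have hval : ∀ s n, (∀ k, 0 < k → k ≤ n → ((Q.strand ^ k) (a, s)).1 ≠ a) →
      Φ ((Q.strand ^ (n + 1)) (a, s)) = (Φ (a, s) + if s then 1 else 0) -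
        if (Q.strand ^ (n + 1)) (a, s) = (a, false) then 1 else 0 := by
    intro s n
    induction n with
    | zero =>
      intro _
      rw [zero_add, pow_one, hΦ]
      simp
    | succ n ih =>
      intro h
      have hne := h (n + 1) (by omega) le_rfl
      have h1 : ∀ t, (Q.strand ^ (n + 1)) (a, s) ≠ (a, t) := fun t h => hne (by rw [h])
      rw [strand_pow_succ _ (n + 1), hΦ, ih fun k h0 hk => h k h0 (by omega), if_neg (h1 false),
        if_neg (h1 true)]
      ring
  have hret : ∀ s n, 0 < n → ((Q.strand ^ n) (a, s)).1 ≠ a := by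
    intro s n
    induction n using Nat.strong_induction_on with
    | _ n ih =>
      intro hn h
      obtain ⟨n, rfl⟩ := Nat.exists_eq_succ_of_ne_zero hn.ne'
      have h1 := hval s n fun k h0 hk => ih k (by omega) h0
      obtain ⟨t, ht⟩ : ∃ t, (Q.strand ^ (n + 1)) (a, s) = (a, t) := ⟨_, Prod.ext h rfl⟩
      rw [ht] at h1
      cases s <;> cases t <;> simp at h1 <;> omega
  have hval' : ∀ s n, 0 < n → Φ ((Q.strand ^ n) (a, s)) = Φ (a, s) + if s then 1 else 0 := by
    intro s n hn
    obtain ⟨n, rfl⟩ := Nat.exists_eq_succ_of_ne_zero hn.ne'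
    have h1 : (Q.strand ^ (n + 1)) (a, s) ≠ (a, false) := fun h => hret s _ hn (by
      rw [Nat.succ_eq_add_one, h])
    rw [hval s n fun k h0 _ => hret s k h0, if_neg h1, sub_zero]
  have key : ∀ i j, 0 < i → 0 < j →
      ((Q.strand ^ i) (a, true)).1 ≠ ((Q.strand ^ j) (a, false)).1 := by
    intro i j hi hj h
    have h1 := hval' true i hi
    have h2 := hval' false j hj
    generalize (Q.strand ^ i) (a, true) = σ at h h1
    generalize (Q.strand ^ j) (a, false) = τ at h h2
    obtain ⟨b, s⟩ := σ
    obtain ⟨c, t⟩ := τ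
    obtain rfl : b = c := h
    have := abs_le.1 (hΦ1 b)
    cases s <;> cases t <;> simp at h1 h2 <;> omega
  rintro (_ | _) i j hi hj
  · exact (key j i hj hi).symm
  · exact key i j hi hj

end QuiverPolyhedron

theorem mainTheorem6 {V : Type*} [Quiver V] (Q : QuiverPolyhedron V)
    (hQ : ContractibleSpace Q.Realization) :
    Q.IsCancellation ↔
      ∀ (a : Quiver.Total V) (i j : ℕ), 0 < i → 0 < j → Q.ray true a i ≠ Q.ray false a j :=
  Iff.trans ⟨fun h => h.raysDisjoint, fun h => h.isCancellation⟩ Q.raysDisjoint_iff
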